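/- All groups are written additively. A map $f:G\to A$ from a group to an abelian group is quadratic if its cross-effect $(x|y)_f=f(x+y)-f(x)-f(y)$ is linear in $x$ and in $y$. A square group $M=(M_{\rm e}\xrightarrow{H}M_{\rm ee}\xrightarrow{P}M_{\rm e})$ consists of a group $M_{\rm e}$, an abelian group $M_{\rm ee}$, a quadratic map $H$ and a homomorphism $P$ such that $(Pa|y)_H=0=(x|Pb)_H$, $P(x|y)_H=-x-y+x+y$ and $PHP(a)=2P(a)$. Morphisms are pairs of homomorphisms compatible with $H$ and $P$; the category is denoted by $\mathsf{SG}$. Then $\operatorname{Coker}P$ is an abelian group, $(\,|\,)_H$ and $\Delta(\bar x)=HPH(x)+H(x+x)-4H(x)$ are well defined on it, and $T=HP-\mathrm{Id}$ is an involution of $M_{\rm ee}$. Let $\mathbb Z_{\rm nil}=(\mathbb Z\xrightarrow{H}\mathbb Z\xrightarrow{0}\mathbb Z)$ with $H(n)=\binom n2$. Let $M$, $N$, $K$ be square groups. **The product $M\circledast N$.** $(M\circledast N)_{\rm e}$ is the group generated by $x\circledast y$ and $a\bar\otimes b$ ($x\in M_{\rm e}$, $y\in N_{\rm e}$, $a\in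 M_{\rm ee}$, $b\in N_{\rm ee}$) with relations: $a\bar\otimes b$ is bilinear and central; $x\circledast(y+y')=x\circledast y+x\circledast y'$; $(x+x')\circledast y=x\circledast y+x'\circledast y+(x'|x)_H\bar\otimes H(y)$; $x\circledast P(b)=(x|x)_H\bar\otimes b$; $P(a)\circledast y=a\bar\otimes\Delta(y)$; $T(a)\bar\otimes T(b)=-a\bar\otimes b$. Further $(M\circledast N)_{\rm ee}=M_{\rm ee}\otimes N_{\rm ee}$, $P(a\otimes b)=a\bar\otimes b$, and $H$ is the quadratic map whose cross-effect on $\operatorname{Coker}P=\operatorname{Coker}P^M\otimes\operatorname{Coker}P^N$ is $(\bar x\otimes\bar y\,|\,\bar x'\otimes\bar y')_H=(x|x')_H\otimes(y|y')_H$, with $H(x\circledast y)=(x|x)_H\otimes H(y)+H(x)\otimes\Delta(y)$ and $H(a\bar\otimes b)=a\otimes b-T(a)\otimes T(b)$. **The product $M\square N$.** $(M\square N)_{\rm e}$ is the group generated by $x\otimes z$ and $[x,y]\otimes c$ ($x,y\in M_{\rm e}$, $z\in N_{\rm e}$, $c\in N_{\rm ee}$) with relations: $[x,y]\otimes c$ is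 central and linear in $x$, $y$ and $c$; $x\otimes z$ is linear in $z$; $(x+y)\otimes z=x\otimes z+y\otimes z+[x,y]\otimes H(z)$; $[x,x]\otimes c=x\otimes P(c)$; $[x,Pa]\otimes c=0$. Further $(M\square N)_{\rm ee}$ is the quotient of $(M_{\rm ee}\otimes\operatorname{Coker}P^N)\oplus(\operatorname{Coker}P^M\otimes\operatorname{Coker}P^M\otimes N_{\rm ee})$ by the relations $(x|y)_H\otimes\bar z=\bar y\otimes\bar x\otimes\Delta(z)$, with $P(a\otimes\bar z)=Pa\otimes z$ and $P(\bar x\otimes\bar y\otimes c)=[x,y]\otimes c$. The map $H$ is the quadratic map with $(\bar x\otimes\bar z|\bar x'\otimes\bar z')_H=\bar x'\otimes\bar x\otimes(z|z')_H$, $H(x\otimes z)=H(x)\otimes\bar z+\bar x\otimes\bar x\otimes H(z)$ and $H([x,y]\otimes c)=\bar x\otimes\bar y\otimes c+\bar y\otimes\bar x\otimes T(c)$. **Monoidal structures.** $\mathsf{SG}$ carries exactly one monoidal structure with tensor product of objects $\circledast$ and unit object $\mathbb Z_{\rm nil}$, in which morphisms act by $x\circledast y\mapsto f(x)\circledast g(y)$,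 $a\bar\otimes b\mapsto f(a)\bar\otimes g(b)$, $a\otimes b\mapsto f(a)\otimes g(b)$; the associativity isomorphism is given by $(x\circledast y)\circledast z\mapsto x\circledast(y\circledast z)$, $(a\bar\otimes b)\circledast z\mapsto a\bar\otimes(b\otimes\Delta(z))$, $(a\otimes b)\bar\otimes c\mapsto a\bar\otimes(b\otimes c)$, $(a\otimes b)\otimes c\mapsto a\otimes(b\otimes c)$; the left unit isomorphism by $n\circledast y\mapsto ny+\binom n2PH(y)$, $n\bar\otimes b\mapsto nP(b)$, $n\otimes b\mapsto nb$; and the right one by $x\circledast n\mapsto nx$, $a\bar\otimes n\mapsto nP(a)$, $a\otimes n\mapsto na$. Likewise $\mathsf{SG}$ carries exactly one monoidal structure with tensor product of objects $\square$ and unit object $\mathbb Z_{\rm nil}$, in which morphisms act by $x\otimes z\mapsto f(x)\otimes g(z)$, $[x,y]\otimes c\mapsto[f(x),f(y)]\otimes g(c)$, $a\otimes\bar z\mapsto f(a)\otimes\overline{g(z)}$, $\bar x\otimes\bar y\otimes c\mapsto\overline{f(x)}\otimes\overline{f(y)}\otimes g(c)$; the associativity isomorphism is given on the e-level by $(x\otimes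 y)\otimes z\mapsto x\otimes(y\otimes z)$, $([x,x']\otimes b)\otimes z\mapsto[x,x']\otimes(b\otimes\bar z)$, $[x\otimes y,x'\otimes y']\otimes c\mapsto[x,x']\otimes(\bar y\otimes\bar y'\otimes c)$, and on the ee-level by $(a\otimes\bar y)\otimes\bar z\mapsto a\otimes\overline{y\otimes z}$, $(\bar x\otimes\bar x'\otimes b)\otimes\bar z\mapsto\bar x\otimes\bar x'\otimes(b\otimes\bar z)$, $\overline{x\otimes y}\otimes\overline{x'\otimes y'}\otimes c\mapsto\bar x\otimes\bar x'\otimes(\bar y\otimes\bar y'\otimes c)$; the left unit isomorphism by $n\otimes y\mapsto ny+\binom n2PH(y)$, $[m,n]\otimes c\mapsto mnP(c)$, $n\otimes\bar y\mapsto n\Delta(y)$, $\bar m\otimes\bar n\otimes c\mapsto mnc$; and the right one by $x\otimes n\mapsto nx$, $[x,y]\otimes n\mapsto nP(y|x)_H$, $a\otimes\bar n\mapsto na$, $\bar x\otimes\bar y\otimes n\mapsto n(y|x)_H$. **Proposition.** For all square groups $M$ and $N$ there is a unique morphism of square groups $\sigma=\sigma_{M,N}:M\square N\to M\circledast N$ such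 that $$\sigma_{\rm e}(x\otimes z)=x\circledast z,\qquad \sigma_{\rm e}([x,y]\otimes c)=(y|x)_H\bar\otimes c,$$ $$\sigma_{\rm ee}(a\otimes\bar z)=a\otimes\Delta(z),\qquad \sigma_{\rm ee}(\bar x\otimes\bar y\otimes c)=(y|x)_H\otimes c$$ for $x,y\in M_{\rm e}$, $z\in N_{\rm e}$, $a\in M_{\rm ee}$, $c\in N_{\rm ee}$. The two monoidal structures described above exist, and the morphisms $\sigma_{M,N}$, together with the identity of $\mathbb Z_{\rm nil}$, equip the identity functor $(\mathsf{SG},\circledast)\to(\mathsf{SG},\square)$ with the structure of a lax monoidal functor (in particular $\sigma$ is natural in $M$ and $N$). -/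

import Mathlib

open CategoryTheory
open scoped TensorProduct

universe u

/-- The cross-effect `(x | y)_f = f (x + y) - f x - f y` of a map to an abelian group. -/
def crossEffect {G A : Type*} [AddGroup G] [AddCommGroup A] (f : G → A) (x y : G) : A :=
  f (x + y) - f x - f y

/-- A map from a group to an abelian group is quadratic if its cross-effect is linear in both
variables. -/
structure IsQuadratic {G A : Type*} [AddGroup G] [AddCommGroup A] (f : G → A) : Prop where
  add_left : ∀ x x' y, crossEffect f (x + x') y = crossEffect f x y + crossEffect f x' y
  add_right : ∀ x y y', crossEffect f x (y + y') = crossEffect f x y + crossEffect f x y'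

/-- Square groups `e --H--> ee --P--> e`. The group `e` is written additively, but it is not
assumed to be commutative. -/
structure SquareGroup : Type (u + 1) where
  e : Type u
  ee : Type u
  [addGroup : AddGroup e]
  [addCommGroup : AddCommGroup ee]
  H : e → ee
  P : ee →+ e
  quadratic : IsQuadratic H
  cross_P_left : ∀ a y, crossEffect H (P a) y = 0
  cross_P_right : ∀ x b, crossEffect H x (P b) = 0
  P_cross : ∀ x y, P (crossEffect H x y) = -x - y + x + y
  PHP : ∀ a, P (H (P a)) = 2 • P a

namespace SquareGroup

attribute [instance] SquareGroup.addGroup SquareGroup.addCommGroup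

/-- Morphisms of square groups: pairs of homomorphisms compatible with `H` and `P`. -/
@[ext]
structure Hom (M N : SquareGroup.{u}) where
  e : M.e →+ N.e
  ee : M.ee →+ N.ee
  map_H : ∀ x, ee (M.H x) = N.H (e x)
  map_P : ∀ a, e (M.P a) = N.P (ee a)

/-- The category of square groups. -/
instance : Category SquareGroup.{u} where
  Hom M N := Hom M N
  id M := ⟨AddMonoidHom.id _, AddMonoidHom.id _, fun _ => rfl, fun _ => rfl⟩
  comp f g := ⟨g.e.comp f.e, g.ee.comp f.ee,
    fun x => by simp [f.map_H, g.map_H], fun a => by simp [f.map_P, g.map_P]⟩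

section Basic

variable (M : SquareGroup.{u})

lemma H_add (x y : M.e) : M.H (x + y) = M.H x + M.H y + crossEffect M.H x y := by
  unfold crossEffect; abel

lemma add_swap (x y : M.e) : x + y = y + x + M.P (crossEffect M.H x y) := by
  rw [M.P_cross]; simp [sub_eq_add_neg, add_assoc]

lemma P_central (a : M.ee) (y : M.e) : M.P a + y = y + M.P a := by
  have h := M.add_swap (M.P a) y
  rwa [M.cross_P_left, map_zero, add_zero] at h

lemma H_zero : M.H 0 = 0 := by
  have h := M.cross_P_left 0 0
  simpa [crossEffect] using h

lemma H_P_add (a b : M.ee) : M.H (M.P (a + b)) = M.H (M.P a) + M.H (M.P b) := by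
  rw [map_add, H_add, M.cross_P_left, add_zero]

/-- The involution `T = HP - Id` of `M.ee`. -/
def T : M.ee →+ M.ee where
  toFun a := M.H (M.P a) - a
  map_zero' := by simp [H_zero]
  map_add' a b := by rw [H_P_add]; abel

lemma T_apply (a : M.ee) : M.T a = M.H (M.P a) - a := rfl

lemma H_P (a : M.ee) : M.H (M.P a) = a + M.T a := by rw [T_apply]; abel

lemma H_P_cross (x y : M.e) :
    M.H (M.P (crossEffect M.H x y)) = crossEffect M.H x y - crossEffect M.H y x := by
  have h : M.H (x + y) = M.H (y + x) + M.H (M.P (crossEffect M.H x y)) := by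
    conv_lhs => rw [M.add_swap x y]
    rw [H_add, M.cross_P_right, add_zero]
  rw [H_add, H_add] at h
  have h' : M.H (M.P (crossEffect M.H x y)) =
      (M.H x + M.H y + crossEffect M.H x y) - (M.H y + M.H x + crossEffect M.H y x) := by
    rw [h]; abel
  rw [h']; abel

lemma T_cross (x y : M.e) : M.T (crossEffect M.H x y) = - crossEffect M.H y x := by
  rw [T_apply, H_P_cross]; abel

lemma T_T (a : M.ee) : M.T (M.T a) = a := by
  have h : M.P (M.T a) = M.P a := by
    have h0 : M.H (M.P a) = M.T a + a := by rw [T_apply]; abel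
    have h1 := M.PHP a
    rw [h0, map_add, two_nsmul] at h1
    exact add_right_cancel h1
  rw [T_apply M (M.T a), h, T_apply]; abel

lemma P_T (a : M.ee) : M.P (M.T a) = M.P a := by
  have h0 : M.H (M.P a) = M.T a + a := by rw [T_apply]; abel
  have h1 := M.PHP a
  rw [h0, map_add, two_nsmul] at h1
  exact add_right_cancel h1

instance : M.P.range.Normal where
  conj_mem := by
    rintro _ ⟨a, rfl⟩ g
    exact ⟨a, by rw [← P_central]; simp⟩

/-- The cokernel of `P`. -/
def coker : Type u := M.e ⧸ M.P.range

/-- The abelian group structure of the cokernel of `P`. -/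
instance : AddCommGroup M.coker where
  __ := (inferInstance : AddGroup (M.e ⧸ M.P.range))
  add_comm a b := by
    induction a using QuotientAddGroup.induction_on with | _ x
    induction b using QuotientAddGroup.induction_on with | _ y
    refine QuotientAddGroup.eq.2 ⟨crossEffect M.H y x, ?_⟩
    rw [M.P_cross, neg_add_rev, sub_eq_add_neg, add_assoc (-y + -x)]

/-- The class `x ↦ x̄` in the cokernel of `P`. -/
def bar : M.e →+ M.coker := QuotientAddGroup.mk' M.P.range

lemma bar_surjective : Function.Surjective M.bar := QuotientAddGroup.mk'_surjective _

lemma bar_P (a : M.ee) : M.bar (M.P a) = 0 :=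
  (QuotientAddGroup.eq_zero_iff (N := M.P.range) _).2 ⟨a, rfl⟩

/-- Descent of a homomorphism along `bar`. -/
def cokerLift {A : Type*} [AddGroup A] (f : M.e →+ A) (h : ∀ a, f (M.P a) = 0) : M.coker →+ A :=
  QuotientAddGroup.lift M.P.range f (by rintro _ ⟨a, rfl⟩; exact h a)

@[simp] lemma cokerLift_bar {A : Type*} [AddGroup A] (f : M.e →+ A) (h : ∀ a, f (M.P a) = 0)
    (x : M.e) : M.cokerLift f h (M.bar x) = f x := rfl

/-- The cross-effect of `H` as a bilinear map on the cokernel of `P`. -/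
def cross : M.coker →ₗ[ℤ] M.coker →ₗ[ℤ] M.ee :=
  AddMonoidHom.toIntLinearMap <| M.cokerLift
    { toFun := fun x => AddMonoidHom.toIntLinearMap <| M.cokerLift
        (AddMonoidHom.mk' (fun y => crossEffect M.H x y) (M.quadratic.add_right x))
        (M.cross_P_right x)
      map_zero' := by
        ext y; obtain ⟨y, rfl⟩ := M.bar_surjective y
        have h := M.cross_P_left 0 y
        rwa [map_zero] at h
      map_add' := fun x x' => by
        ext y; obtain ⟨y, rfl⟩ := M.bar_surjective y
        exact M.quadratic.add_left x x' y }
    (fun a => by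
      ext y; obtain ⟨y, rfl⟩ := M.bar_surjective y
      exact M.cross_P_left a y)

@[simp] lemma cross_bar (x y : M.e) : M.cross (M.bar x) (M.bar y) = crossEffect M.H x y := rfl

/-- The homomorphism `Δ : Coker P → M.ee`, `Δ x̄ = HPH x + H (x + x) - 4 H x`. -/
def Δ : M.coker →+ M.ee :=
  M.cokerLift
    (AddMonoidHom.mk' (fun x => M.H (M.P (M.H x)) + M.H (x + x) - 4 • M.H x) (fun x y => by
      rw [H_add M x y, H_P_add, H_P_add, H_P_cross, H_add M (x + y), H_add M x y, H_add M x x,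
        H_add M y y, M.quadratic.add_left, M.quadratic.add_right, M.quadratic.add_right]
      abel))
    (fun a => by
      have h : M.H (M.P (M.H (M.P a))) = 2 • M.H (M.P a) := by
        rw [M.PHP, two_nsmul, H_add, M.cross_P_left, add_zero, two_nsmul]
      change M.H (M.P (M.H (M.P a))) + M.H (M.P a + M.P a) - 4 • M.H (M.P a) = 0
      rw [h, H_add, M.cross_P_left]; abel)

lemma Δ_bar (x : M.e) : M.Δ (M.bar x) = M.H (M.P (M.H x)) + M.H (x + x) - 4 • M.H x := rfl

lemma Δ_eq (x : M.e) : M.Δ (M.bar x) = crossEffect M.H x x - M.H x + M.T (M.H x) := by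
  rw [Δ_bar, H_add, T_apply]; abel

lemma P_Δ (x : M.e) : M.P (M.Δ (M.bar x)) = 0 := by
  rw [Δ_eq, map_add, P_T, ← map_add, sub_add_cancel, M.P_cross]
  simp [sub_eq_add_neg, add_assoc]

lemma T_Δ (x : M.e) : M.T (M.Δ (M.bar x)) = - M.Δ (M.bar x) := by
  rw [T_apply, P_Δ, H_zero, zero_sub]

end Basic

section Presentation

/-- The (not necessarily abelian) group with generators `X` and relations `r`. -/
def Pres {X : Type u} (r : FreeAddGroup X → FreeAddGroup X → Prop) : Type u :=
  (addConGen r).Quotient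

namespace Pres

variable {X : Type u} {r : FreeAddGroup X → FreeAddGroup X → Prop}

instance : AddGroup (Pres r) := inferInstanceAs (AddGroup (addConGen r).Quotient)

/-- The projection from the free group. -/
def proj : FreeAddGroup X →+ Pres r := (addConGen r).mk'

/-- The class of a generator. -/
def gen (x : X) : Pres r := proj (FreeAddGroup.of x)

lemma proj_surjective : Function.Surjective (proj (r := r)) := AddCon.mk'_surjective

lemma sound {a b : FreeAddGroup X} (h : r a b) : proj (r := r) a = proj b :=
  (AddCon.eq _).2 (AddConGen.Rel.of _ _ h)

/-- The universal property of the presentation. -/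
def lift {G : Type*} [AddGroup G] (f : X → G)
    (h : ∀ a b, r a b → FreeAddGroup.lift f a = FreeAddGroup.lift f b) : Pres r →+ G :=
  (addConGen r).lift (FreeAddGroup.lift f) (AddCon.addConGen_le.2 (fun a b hab => h a b hab))

lemma lift_gen {G : Type*} [AddGroup G] (f : X → G)
    (h : ∀ a b, r a b → FreeAddGroup.lift f a = FreeAddGroup.lift f b) (x : X) :
    lift f h (gen x) = f x := FreeAddGroup.lift_apply_of

lemma swap_neg_right {G : Type*} [AddGroup G] {x y c : G} (hc : ∀ v, c + v = v + c)
    (h : x + y = y + x + c) : x + -y = -y + x + -c := by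
  have h1 : -y + x = x + -y + c := by
    have h2 : -y + (x + y) + -y = -y + (y + x + c) + -y := by rw [h]
    simpa [add_assoc, hc] using h2
  rw [h1, add_neg_cancel_right]

lemma swap_neg_left {G : Type*} [AddGroup G] {x y c : G} (hc : ∀ v, c + v = v + c)
    (h : x + y = y + x + c) : -x + y = y + -x + -c := by
  have h1 : y + -x = -x + y + c := by
    have h2 : -x + (x + y) + -x = -x + (y + x + c) + -x := by rw [h]
    simpa [add_assoc, hc] using h2
  rw [h1, add_neg_cancel_right]

lemma swap_add_right {G : Type*} [AddGroup G] {x y y' c c' : G} (hc : ∀ v, c + v = v + c)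
    (h : x + y = y + x + c) (h' : x + y' = y' + x + c') :
    x + (y + y') = y + y' + x + (c + c') := by
  rw [← add_assoc, h, add_assoc (y + x), hc, ← add_assoc, add_assoc y, h', hc]
  simp only [add_assoc]

lemma swap_add_left {G : Type*} [AddGroup G] {x x' y c c' : G} (hc : ∀ v, c + v = v + c)
    (h : x + y = y + x + c) (h' : x' + y = y + x' + c') :
    x + x' + y = y + (x + x') + (c + c') := by
  rw [add_assoc, h', ← add_assoc, ← add_assoc, h, add_assoc (y + x), hc]
  simp only [add_assoc]

/-- If commutators agree on generators with those prescribed by a bilinear map, then they do so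
everywhere. -/
lemma swap_of_gen {A : Type*} [AddCommGroup A] (b : Pres r → Pres r → A)
    (hl : ∀ u u' v, b (u + u') v = b u v + b u' v) (hr : ∀ u v v', b u (v + v') = b u v + b u v')
    (P : A →+ Pres r) (hP : ∀ a v, P a + v = v + P a)
    (h : ∀ x y, gen x + gen y = gen y + gen x + P (b (gen x) (gen y))) (u v : Pres r) :
    u + v = v + u + P (b u v) := by
  have hl0 : ∀ v, b 0 v = 0 := fun v => by simpa using hl 0 0 v
  have hr0 : ∀ u, b u 0 = 0 := fun u => by simpa using hr u 0 0
  have hln : ∀ u v, b (-u) v = - b u v := fun u v => by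
    rw [eq_neg_iff_add_eq_zero, ← hl, neg_add_cancel, hl0]
  have hrn : ∀ u v, b u (-v) = - b u v := fun u v => by
    rw [eq_neg_iff_add_eq_zero, ← hr, neg_add_cancel, hr0]
  have key : ∀ (x : X) (v : Pres r), gen x + v = v + gen x + P (b (gen x) v) := by
    intro x v
    obtain ⟨w, rfl⟩ := proj_surjective v
    induction w using FreeAddGroup.induction_on with
    | C1 => simp [hr0]
    | of y => exact h x y
    | neg_of y hy =>
      rw [map_neg, hrn, map_neg]
      exact swap_neg_right (hP _) hy
    | add v v' hv hv' =>
      rw [map_add, hr, map_add]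
      exact swap_add_right (hP _) hv hv'
  obtain ⟨w, rfl⟩ := proj_surjective u
  induction w using FreeAddGroup.induction_on with
  | C1 => simp [hl0]
  | of y => exact key y v
  | neg_of y hy =>
    rw [map_neg, hln, map_neg]
    exact swap_neg_left (hP _) hy
  | add v v' hv hv' =>
    rw [map_add, hl, map_add]
    exact swap_add_left (hP _) hv hv'

end Pres

/-- The group of pairs `(a, x)` with `(a, x) + (a', x') = (a + a' + β x x', x + x')`.
A homomorphism to it is a homomorphism to `X` together with a quadratic map to `A` whose
cross-effect is given by `β`. -/
@[ext]
structure Ext {X A : Type*} [AddCommGroup X] [AddCommGroup A] (β : X →ₗ[ℤ] X →ₗ[ℤ] A) where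
  fst : A
  snd : X

namespace Ext

variable {X A : Type*} [AddCommGroup X] [AddCommGroup A] {β : X →ₗ[ℤ] X →ₗ[ℤ] A}

instance : Zero (Ext β) := ⟨⟨0, 0⟩⟩
instance : Add (Ext β) := ⟨fun p q => ⟨p.fst + q.fst + β p.snd q.snd, p.snd + q.snd⟩⟩
instance : Neg (Ext β) := ⟨fun p => ⟨-p.fst + β p.snd p.snd, -p.snd⟩⟩

@[simp] lemma zero_fst : (0 : Ext β).fst = 0 := rfl
@[simp] lemma zero_snd : (0 : Ext β).snd = 0 := rfl
@[simp] lemma add_fst (p q : Ext β) : (p + q).fst = p.fst + q.fst + β p.snd q.snd := rfl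
@[simp] lemma add_snd (p q : Ext β) : (p + q).snd = p.snd + q.snd := rfl
@[simp] lemma neg_fst (p : Ext β) : (-p).fst = -p.fst + β p.snd p.snd := rfl
@[simp] lemma neg_snd (p : Ext β) : (-p).snd = -p.snd := rfl

instance : AddGroup (Ext β) :=
  AddGroup.ofLeftAxioms
    (fun p q s => by ext <;> simp [add_assoc]; abel)
    (fun p => by ext <;> simp)
    (fun p => by ext <;> simp)

/-- The projection to `X`. -/
def sndHom : Ext β →+ X := AddMonoidHom.mk' Ext.snd (fun _ _ => rfl)

end Ext

/-- If an element commutes with all generators, then it is central. -/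
lemma Pres.central_of_gen {X : Type u} {r : FreeAddGroup X → FreeAddGroup X → Prop} {c : Pres r}
    (h : ∀ x, c + gen x = gen x + c) (v : Pres r) : c + v = v + c := by
  obtain ⟨w, rfl⟩ := proj_surjective v
  induction w using FreeAddGroup.induction_on with
  | C1 => simp
  | of y => exact h y
  | neg_of y hy => rw [map_neg]; exact (AddCommute.neg_right (show AddCommute c _ from hy)).eq
  | add v v' hv hv' =>
    rw [map_add]
    exact (AddCommute.add_right (show AddCommute c _ from hv) (show AddCommute c _ from hv')).eq

lemma cancel_swap {G : Type*} [AddGroup G] {p q s t c d k : G} (hc : ∀ v, c + v = v + c)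
    (hd : ∀ v, d + v = v + d) (hk : ∀ v, k + v = v + k)
    (h : p + q + c + (s + t + d) = p + s + (q + t) + (c + d + k)) : q + s = s + q + k := by
  have h1 : p + (q + s + (t + (c + d))) = p + (s + q + k + (t + (c + d))) := by
    calc p + (q + s + (t + (c + d))) = p + q + ((s + t) + c) + d := by
          rw [hc d]
          have := hd c
          simp only [add_assoc, this]
      _ = p + q + c + (s + t + d) := by rw [← hc (s + t)]; simp only [add_assoc]
      _ = p + s + (q + t) + (c + d + k) := h
      _ = p + (s + q + k + (t + (c + d))) := by
          rw [add_assoc (s + q) k, hk]; simp only [add_assoc]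
  exact add_right_cancel (add_left_cancel h1)

lemma add_self_add {G : Type*} [AddGroup G] {a b : G} (h : a + b = b + a) :
    a + a + (b + b) = a + b + (a + b) := by
  rw [add_assoc a a, ← add_assoc a b b, h, add_assoc b a b, ← add_assoc a b, h]

/-- A square group from a presented group `E`, a homomorphism `F : E → Ext β`, whose first
component is `H`, and a homomorphism `P : A → E`. -/
def ofPres {X : Type u} {r : FreeAddGroup X → FreeAddGroup X → Prop} {A Y : Type u}
    [AddCommGroup A] [AddCommGroup Y] {β : Y →ₗ[ℤ] Y →ₗ[ℤ] A} (F : Pres r →+ Ext β)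
    (P : A →+ Pres r) (hP : ∀ a v, P a + v = v + P a) (h0 : ∀ a, (F (P a)).snd = 0)
    (hs : ∀ x y, Pres.gen x + Pres.gen y = Pres.gen y + Pres.gen x +
      P (β (F (Pres.gen x)).snd (F (Pres.gen y)).snd))
    (hPHP : ∀ a, P (F (P a)).fst = 2 • P a) : SquareGroup.{u} :=
  have hcr : ∀ u v, crossEffect (fun u => (F u).fst) u v = β (F u).snd (F v).snd := by
    intro u v; simp [crossEffect]; abel
  { e := Pres r
    ee := A
    H := fun u => (F u).fst
    P := P
    quadratic := ⟨fun u u' v => by simp [hcr], fun u v v' => by simp [hcr]⟩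
    cross_P_left := fun a v => by simp [hcr, h0]
    cross_P_right := fun v a => by simp [hcr, h0]
    P_cross := fun u v => by
      have h := Pres.swap_of_gen (fun u v => β (F u).snd (F v).snd) (by simp) (by simp) P hP hs u v
      rw [hcr, sub_eq_add_neg, add_assoc, h, add_assoc v u, add_assoc (-u), neg_add_cancel_left,
        neg_add_cancel_left]
    PHP := hPHP }

/-- A biadditive map as a `ℤ`-bilinear map. -/
def bilin {A B C : Type*} [AddCommGroup A] [AddCommGroup B] [AddCommGroup C] (f : A → B → C)
    (hl : ∀ a a' b, f (a + a') b = f a b + f a' b)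
    (hr : ∀ a b b', f a (b + b') = f a b + f a b') : A →ₗ[ℤ] B →ₗ[ℤ] C :=
  AddMonoidHom.toIntLinearMap <| AddMonoidHom.mk'
    (fun a => AddMonoidHom.toIntLinearMap <| AddMonoidHom.mk' (f a) (hr a))
    (fun a a' => by ext b; exact hl a a' b)

@[simp] lemma bilin_apply {A B C : Type*} [AddCommGroup A] [AddCommGroup B] [AddCommGroup C]
    (f : A → B → C) (hl : ∀ a a' b, f (a + a') b = f a b + f a' b)
    (hr : ∀ a b b', f a (b + b') = f a b + f a b') (a : A) (b : B) :
    bilin f hl hr a b = f a b := rfl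

/-- The center of a group is an abelian group. -/
instance centerAddCommGroup {G : Type*} [AddGroup G] : AddCommGroup (AddSubgroup.center G) where
  __ := (inferInstance : AddGroup (AddSubgroup.center G))
  add_comm a b := Subtype.ext (AddSubgroup.mem_center_iff.1 b.2 a)

/-- A biadditive map to the center of a group, as a homomorphism on the tensor product. -/
def centralLift {A B G : Type*} [AddCommGroup A] [AddCommGroup B] [AddGroup G] (f : A → B → G)
    (hl : ∀ a a' b, f (a + a') b = f a b + f a' b)
    (hr : ∀ a b b', f a (b + b') = f a b + f a b') (hc : ∀ a b v, f a b + v = v + f a b) :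
    A ⊗[ℤ] B →+ AddSubgroup.center G :=
  (TensorProduct.lift (bilin
    (fun a b => (⟨f a b, AddSubgroup.mem_center_iff.2 (fun v => (hc a b v).symm)⟩ :
      AddSubgroup.center G))
    (fun a a' b => Subtype.ext (hl a a' b)) (fun a b b' => Subtype.ext (hr a b b')))).toAddMonoidHom

lemma centralLift_tmul {A B G : Type*} [AddCommGroup A] [AddCommGroup B] [AddGroup G]
    (f : A → B → G) (hl : ∀ a a' b, f (a + a') b = f a b + f a' b)
    (hr : ∀ a b b', f a (b + b') = f a b + f a b') (hc : ∀ a b v, f a b + v = v + f a b)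
    (a : A) (b : B) : (centralLift f hl hr hc (a ⊗ₜ b) : G) = f a b := by
  simp [centralLift]

lemma center_comm {G : Type*} [AddGroup G] (c : AddSubgroup.center G) (v : G) :
    (c : G) + v = v + c := (AddSubgroup.mem_center_iff.1 c.2 v).symm

end Presentation

section Tensor

variable (M N : SquareGroup.{u})

/-- Generators `x ⊛ y` and `a ⊗̄ b` of the `e`-level of the tensor product. -/
inductive TensorGen : Type u
  | o (x : M.e) (y : N.e)
  | b (a : M.ee) (b : N.ee)

variable {M N} in
/-- The generator `x ⊛ y` in the free group. -/
abbrev fo (x : M.e) (y : N.e) : FreeAddGroup (TensorGen M N) := .of (.o x y)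

variable {M N} in
/-- The generator `a ⊗̄ b` in the free group. -/
abbrev fb (a : M.ee) (b : N.ee) : FreeAddGroup (TensorGen M N) := .of (.b a b)

/-- The defining relations of the `e`-level of the tensor product. -/
inductive TensorRel : FreeAddGroup (TensorGen M N) → FreeAddGroup (TensorGen M N) → Prop
  | central (a b w) : TensorRel (fb a b + w) (w + fb a b)
  | add_b (a a' b) : TensorRel (fb (a + a') b) (fb a b + fb a' b)
  | b_add (a b b') : TensorRel (fb a (b + b')) (fb a b + fb a b')
  | o_add (x y y') : TensorRel (fo x (y + y')) (fo x y + fo x y')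
  | add_o (x x' y) :
      TensorRel (fo (x + x') y) (fo x y + fo x' y + fb (crossEffect M.H x' x) (N.H y))
  | o_P (x b) : TensorRel (fo x (N.P b)) (fb (crossEffect M.H x x) b)
  | P_o (a y) : TensorRel (fo (M.P a) y) (fb a (N.Δ (N.bar y)))
  | T_b_T (a b) : TensorRel (fb (M.T a) (N.T b)) (-fb a b)

namespace Tensor

/-- The bilinear map `ρ (x̄ ⊗ ȳ) (x̄' ⊗ ȳ') = (x | x')_H ⊗ (y | y')_H`. -/
def ρ : M.coker ⊗[ℤ] N.coker →ₗ[ℤ] M.coker ⊗[ℤ] N.coker →ₗ[ℤ] M.ee ⊗[ℤ] N.ee :=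
  TensorProduct.map₂ M.cross N.cross

@[simp] lemma ρ_tmul (x x' : M.e) (y y' : N.e) :
    ρ M N (M.bar x ⊗ₜ N.bar y) (M.bar x' ⊗ₜ N.bar y') =
      crossEffect M.H x x' ⊗ₜ crossEffect N.H y y' := rfl

variable {M N}

/-- The element `x ⊛ y`. -/
def go (x : M.e) (y : N.e) : Pres (TensorRel M N) := Pres.gen (.o x y)

/-- The element `a ⊗̄ b`. -/
def gb (a : M.ee) (b : N.ee) : Pres (TensorRel M N) := Pres.gen (.b a b)

lemma gb_central (a : M.ee) (b : N.ee) (v : Pres (TensorRel M N)) : gb a b + v = v + gb a b := by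
  obtain ⟨w, rfl⟩ := Pres.proj_surjective v
  exact Pres.sound (TensorRel.central a b w)

lemma add_gb (a a' : M.ee) (b : N.ee) : gb (a + a') b = gb a b + gb a' b := by
  exact Pres.sound (TensorRel.add_b a a' b)

lemma gb_add (a : M.ee) (b b' : N.ee) : gb a (b + b') = gb a b + gb a b' := by
  exact Pres.sound (TensorRel.b_add a b b')

lemma go_add (x : M.e) (y y' : N.e) : go x (y + y') = go x y + go x y' := by
  exact Pres.sound (TensorRel.o_add x y y')

lemma add_go (x x' : M.e) (y : N.e) :
    go (x + x') y = go x y + go x' y + gb (crossEffect M.H x' x) (N.H y) := by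
  exact Pres.sound (TensorRel.add_o x x' y)

lemma T_gb_T (a : M.ee) (b : N.ee) : gb (M.T a) (N.T b) = - gb a b := by
  exact Pres.sound (TensorRel.T_b_T a b)

lemma go_swap (x x' : M.e) (y y' : N.e) : go x y + go x' y' =
    go x' y' + go x y + gb (crossEffect M.H x x') (crossEffect N.H y y') := by
  apply cancel_swap (p := go x' y) (t := go x y') (gb_central (crossEffect M.H x x') (N.H y))
    (gb_central (crossEffect M.H x x') (N.H y')) (gb_central _ _)
  rw [← add_go, ← add_go, ← go_add, add_go, go_add, go_add, N.H_add, gb_add, gb_add]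

variable (M N)

/-- `P (a ⊗ b) = a ⊗̄ b`. -/
def P : M.ee ⊗[ℤ] N.ee →+ Pres (TensorRel M N) :=
  (AddSubgroup.center _).subtype.comp (centralLift gb add_gb gb_add gb_central)

lemma P_tmul (a : M.ee) (b : N.ee) : P M N (a ⊗ₜ b) = gb a b :=
  centralLift_tmul gb add_gb gb_add gb_central a b

/-- The quadratic map `H` together with the projection to `Coker P ⊗ Coker P`, on generators. -/
def genF : TensorGen M N → Ext (ρ M N)
  | .o x y => ⟨crossEffect M.H x x ⊗ₜ N.H y + M.H x ⊗ₜ N.Δ (N.bar y), M.bar x ⊗ₜ N.bar y⟩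
  | .b a b => ⟨a ⊗ₜ b - M.T a ⊗ₜ N.T b, 0⟩

/-- The quadratic map `H` together with the projection to `Coker P ⊗ Coker P`. -/
def F : Pres (TensorRel M N) →+ Ext (ρ M N) :=
  Pres.lift (genF M N) (by
    intro p q h
    induction h with
    | central a b w => ext <;> simp [genF, add_comm]
    | add_b a a' b =>
      ext
      · simp [genF, TensorProduct.add_tmul]; abel
      · simp [genF]
    | b_add a b b' =>
      ext
      · simp [genF, TensorProduct.tmul_add]; abel
      · simp [genF]
    | o_add x y y' =>
      ext
      · simp [genF, TensorProduct.tmul_add, H_add]; abel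
      · simp [genF, TensorProduct.tmul_add]
    | add_o x x' y =>
      ext
      · simp [genF, TensorProduct.tmul_add, TensorProduct.add_tmul, H_add, T_cross, Δ_eq,
          M.quadratic.add_left, M.quadratic.add_right, TensorProduct.neg_tmul,
          TensorProduct.tmul_sub]
        abel
      · simp [genF, TensorProduct.add_tmul]
    | o_P x b =>
      ext
      · simp [genF, bar_P, H_P, TensorProduct.tmul_add, T_cross, TensorProduct.neg_tmul]
      · simp [genF, bar_P]
    | P_o a y =>
      ext
      · simp [genF, T_Δ, H_P, TensorProduct.add_tmul, M.cross_P_left, TensorProduct.tmul_neg]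
      · simp [genF, bar_P]
    | T_b_T a b =>
      ext
      · simp [genF, T_T]
      · simp [genF])

lemma F_go (x : M.e) (y : N.e) : F M N (go x y) =
    ⟨crossEffect M.H x x ⊗ₜ N.H y + M.H x ⊗ₜ N.Δ (N.bar y), M.bar x ⊗ₜ N.bar y⟩ :=
  Pres.lift_gen _ _ _

lemma F_gb (a : M.ee) (b : N.ee) : F M N (gb a b) = ⟨a ⊗ₜ b - M.T a ⊗ₜ N.T b, 0⟩ :=
  Pres.lift_gen _ _ _

lemma F_P (w : M.ee ⊗[ℤ] N.ee) : (F M N (P M N w)).snd = 0 := by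
  induction w with
  | zero => simp
  | tmul a b => rw [P_tmul, F_gb]
  | add u v hu hv => simp [hu, hv]

end Tensor

/-- The tensor product `M ⊛ N` of square groups. -/
def tensor : SquareGroup.{u} :=
  ofPres (Tensor.F M N) (Tensor.P M N) (fun w v => center_comm _ v) (Tensor.F_P M N)
    (by
      rintro (⟨x, y⟩ | ⟨a, b⟩) (⟨x', y'⟩ | ⟨a', b'⟩)
      · change Tensor.go x y + Tensor.go x' y' = Tensor.go x' y' + Tensor.go x y +
          Tensor.P M N (Tensor.ρ M N (Tensor.F M N (Tensor.go x y)).snd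
            (Tensor.F M N (Tensor.go x' y')).snd)
        rw [Tensor.F_go, Tensor.F_go]
        rw [Tensor.ρ_tmul, Tensor.P_tmul]
        exact Tensor.go_swap x x' y y'
      · change _ + Tensor.gb a' b' = Tensor.gb a' b' + _ +
          Tensor.P M N (Tensor.ρ M N _ (Tensor.F M N (Tensor.gb a' b')).snd)
        rw [Tensor.F_gb, map_zero, map_zero, add_zero, Tensor.gb_central]
      · change Tensor.gb a b + _ = _ + Tensor.gb a b +
          Tensor.P M N (Tensor.ρ M N (Tensor.F M N (Tensor.gb a b)).snd _)
        rw [Tensor.F_gb, map_zero, LinearMap.zero_apply, map_zero, add_zero, Tensor.gb_central]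
      · change Tensor.gb a b + _ = _ + Tensor.gb a b +
          Tensor.P M N (Tensor.ρ M N (Tensor.F M N (Tensor.gb a b)).snd _)
        rw [Tensor.F_gb, map_zero, LinearMap.zero_apply, map_zero, add_zero, Tensor.gb_central])
    (by
      intro w
      induction w with
      | zero => simp
      | tmul a b =>
        rw [Tensor.P_tmul, Tensor.F_gb, map_sub, Tensor.P_tmul, Tensor.P_tmul, Tensor.T_gb_T,
          sub_neg_eq_add, two_nsmul]
      | add u v hu hv =>
        simp only [map_add, Ext.add_fst, Tensor.F_P, map_zero, add_zero, hu, hv, two_nsmul]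
        exact add_self_add (center_comm _ _))

variable {M N}

/-- The element `x ⊛ y` of `(M ⊛ N).e`. -/
def otimes (x : M.e) (y : N.e) : (tensor M N).e := Tensor.go x y

/-- The element `a ⊗̄ b` of `(M ⊛ N).e`. -/
def obar (a : M.ee) (b : N.ee) : (tensor M N).e := Tensor.gb a b

/-- The element `a ⊗ b` of `(M ⊛ N).ee`. -/
def tmul (a : M.ee) (b : N.ee) : (tensor M N).ee := (a ⊗ₜ[ℤ] b : M.ee ⊗[ℤ] N.ee)

lemma tensor_P (a : M.ee) (b : N.ee) : (tensor M N).P (tmul a b) = obar a b :=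
  Tensor.P_tmul M N a b

lemma tensor_H_otimes (x : M.e) (y : N.e) : (tensor M N).H (otimes x y) =
    tmul (crossEffect M.H x x) (N.H y) + tmul (M.H x) (N.Δ (N.bar y)) :=
  congrArg Ext.fst (Tensor.F_go M N x y)

lemma tensor_H_obar (a : M.ee) (b : N.ee) : (tensor M N).H (obar a b) =
    tmul a b - tmul (M.T a) (N.T b) :=
  congrArg Ext.fst (Tensor.F_gb M N a b)

lemma tensor_cross (x x' : M.e) (y y' : N.e) :
    crossEffect (tensor M N).H (otimes x y) (otimes x' y') =
      tmul (crossEffect M.H x x') (crossEffect N.H y y') := by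
  change (Tensor.F M N (Tensor.go x y + Tensor.go x' y')).fst - (Tensor.F M N (Tensor.go x y)).fst
    - (Tensor.F M N (Tensor.go x' y')).fst = _
  rw [map_add, Ext.add_fst, add_assoc, add_sub_cancel_left, add_sub_cancel_left, Tensor.F_go,
    Tensor.F_go]
  rfl

end Tensor

section Box

variable (M N : SquareGroup.{u})

namespace Box

/-- The subgroup generated by the differences of the two sides of the relation
`(x | y)_H ⊗ z̄ ∼ ȳ ⊗ x̄ ⊗ Δ z̄`. -/
def eeRel : AddSubgroup ((M.ee ⊗[ℤ] N.coker) × ((M.coker ⊗[ℤ] M.coker) ⊗[ℤ] N.ee)) :=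
  AddSubgroup.closure {p | ∃ (x y : M.e) (z : N.e),
    p = (crossEffect M.H x y ⊗ₜ N.bar z, -((M.bar y ⊗ₜ M.bar x) ⊗ₜ N.Δ (N.bar z)))}

/-- The `ee`-level of `M □ N`. -/
def EE : Type u :=
  ((M.ee ⊗[ℤ] N.coker) × ((M.coker ⊗[ℤ] M.coker) ⊗[ℤ] N.ee)) ⧸ eeRel M N

instance : AddCommGroup (EE M N) :=
  inferInstanceAs (AddCommGroup
    (((M.ee ⊗[ℤ] N.coker) × ((M.coker ⊗[ℤ] M.coker) ⊗[ℤ] N.ee)) ⧸ eeRel M N))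

/-- The projection to the `ee`-level of `M □ N`. -/
def eeMk : (M.ee ⊗[ℤ] N.coker) × ((M.coker ⊗[ℤ] M.coker) ⊗[ℤ] N.ee) →+ EE M N :=
  QuotientAddGroup.mk' (eeRel M N)

lemma eeMk_surjective : Function.Surjective (eeMk M N) := QuotientAddGroup.mk'_surjective _

variable {M N}

/-- The class of `a ⊗ z̄`. -/
def inl (a : M.ee) (z : N.coker) : EE M N := eeMk M N (a ⊗ₜ z, 0)

/-- The class of `x̄ ⊗ ȳ ⊗ c`. -/
def inr (x y : M.coker) (c : N.ee) : EE M N := eeMk M N (0, (x ⊗ₜ y) ⊗ₜ c)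

lemma inl_add_left (a a' : M.ee) (z : N.coker) : inl (a + a') z = inl a z + inl a' z := by
  simp only [inl, TensorProduct.add_tmul, ← map_add, Prod.mk_add_mk, add_zero]

lemma inl_add_right (a : M.ee) (z z' : N.coker) : inl a (z + z') = inl a z + inl a z' := by
  simp only [inl, TensorProduct.tmul_add, ← map_add, Prod.mk_add_mk, add_zero]

lemma inl_zero_right (a : M.ee) : inl a (0 : N.coker) = 0 := by
  have h := inl_add_right a (0 : N.coker) 0
  simpa using h

lemma inr_add_left (x x' y : M.coker) (c : N.ee) : inr (x + x') y c = inr x y c + inr x' y c := by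
  simp only [inr, TensorProduct.add_tmul, ← map_add, Prod.mk_add_mk, add_zero]

lemma inr_add_mid (x y y' : M.coker) (c : N.ee) : inr x (y + y') c = inr x y c + inr x y' c := by
  simp only [inr, TensorProduct.tmul_add, TensorProduct.add_tmul, ← map_add, Prod.mk_add_mk,
    add_zero]

lemma inr_add_right (x y : M.coker) (c c' : N.ee) : inr x y (c + c') = inr x y c + inr x y c' := by
  simp only [inr, TensorProduct.tmul_add, ← map_add, Prod.mk_add_mk, add_zero]

lemma inr_sub_right (x y : M.coker) (c c' : N.ee) : inr x y (c - c') = inr x y c - inr x y c' := by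
  rw [eq_sub_iff_add_eq, ← inr_add_right, sub_add_cancel]

lemma inr_zero_left (y : M.coker) (c : N.ee) : inr 0 y c = 0 := by
  simpa using inr_add_left 0 0 y c

lemma inr_zero_mid (y : M.coker) (c : N.ee) : inr y 0 c = 0 := by
  simpa using inr_add_mid y 0 0 c

lemma inl_cross (x y : M.e) (z : N.e) :
    inl (crossEffect M.H x y) (N.bar z) = inr (M.bar y) (M.bar x) (N.Δ (N.bar z)) := by
  rw [← sub_eq_zero, inl, inr, ← map_sub]
  refine (QuotientAddGroup.eq_zero_iff (N := eeRel M N) _).2 (AddSubgroup.subset_closure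
    ⟨x, y, z, ?_⟩)
  simp

variable (M N)

/-- The bilinear map `ρ (x̄ ⊗ z̄) (x̄' ⊗ z̄') = x̄' ⊗ x̄ ⊗ (z | z')_H`. -/
def ρ : M.coker ⊗[ℤ] N.coker →ₗ[ℤ] M.coker ⊗[ℤ] N.coker →ₗ[ℤ] EE M N :=
  LinearMap.compr₂ (TensorProduct.map₂ (TensorProduct.mk ℤ M.coker M.coker).flip N.cross)
    ((eeMk M N).comp (AddMonoidHom.inr _ _)).toIntLinearMap

@[simp] lemma ρ_tmul (x x' : M.e) (z z' : N.e) :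
    ρ M N (M.bar x ⊗ₜ N.bar z) (M.bar x' ⊗ₜ N.bar z') =
      inr (M.bar x') (M.bar x) (crossEffect N.H z z') := rfl

end Box

/-- Generators `x ⊗ z` and `[x, y] ⊗ c` of the `e`-level of `M □ N`. -/
inductive BoxGen : Type u
  | o (x : M.e) (z : N.e)
  | br (x y : M.e) (c : N.ee)

variable {M N} in
/-- The generator `x ⊗ z` in the free group. -/
abbrev go (x : M.e) (z : N.e) : FreeAddGroup (BoxGen M N) := .of (.o x z)

variable {M N} in
/-- The generator `[x, y] ⊗ c` in the free group. -/
abbrev gbr (x y : M.e) (c : N.ee) : FreeAddGroup (BoxGen M N) := .of (.br x y c)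

/-- The defining relations of the `e`-level of `M □ N`: the relations of the group `M.e ⊗ N`, and
the relation `[x, P a] ⊗ c = 0`. -/
inductive BoxRel : FreeAddGroup (BoxGen M N) → FreeAddGroup (BoxGen M N) → Prop
  | central (x y c w) : BoxRel (gbr x y c + w) (w + gbr x y c)
  | br_add_left (x x' y c) : BoxRel (gbr (x + x') y c) (gbr x y c + gbr x' y c)
  | br_add_mid (x y y' c) : BoxRel (gbr x (y + y') c) (gbr x y c + gbr x y' c)
  | br_add_right (x y c c') : BoxRel (gbr x y (c + c')) (gbr x y c + gbr x y c')
  | o_add (x z z') : BoxRel (go x (z + z')) (go x z + go x z')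
  | add_o (x y z) : BoxRel (go (x + y) z) (go x z + go y z + gbr x y (N.H z))
  | br_self (x c) : BoxRel (gbr x x c) (go x (N.P c))
  | br_P (x a c) : BoxRel (gbr x (M.P a) c) 0

namespace Box

variable {M N}

/-- The element `x ⊗ z`. -/
def o (x : M.e) (z : N.e) : Pres (BoxRel M N) := Pres.gen (.o x z)

/-- The element `[x, y] ⊗ c`. -/
def br (x y : M.e) (c : N.ee) : Pres (BoxRel M N) := Pres.gen (.br x y c)

lemma br_central (x y : M.e) (c : N.ee) (v : Pres (BoxRel M N)) :
    br x y c + v = v + br x y c := by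
  obtain ⟨w, rfl⟩ := Pres.proj_surjective v
  exact Pres.sound (BoxRel.central x y c w)

lemma br_add_left (x x' y : M.e) (c : N.ee) : br (x + x') y c = br x y c + br x' y c :=
  Pres.sound (BoxRel.br_add_left x x' y c)

lemma br_add_mid (x y y' : M.e) (c : N.ee) : br x (y + y') c = br x y c + br x y' c :=
  Pres.sound (BoxRel.br_add_mid x y y' c)

lemma br_add_right (x y : M.e) (c c' : N.ee) : br x y (c + c') = br x y c + br x y c' :=
  Pres.sound (BoxRel.br_add_right x y c c')

lemma br_zero (x y : M.e) : br x y (0 : N.ee) = 0 := by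
  simpa using br_add_right x y (0 : N.ee) 0

lemma o_add (x : M.e) (z z' : N.e) : o x (z + z') = o x z + o x z' :=
  Pres.sound (BoxRel.o_add x z z')

lemma add_o (x y : M.e) (z : N.e) : o (x + y) z = o x z + o y z + br x y (N.H z) :=
  Pres.sound (BoxRel.add_o x y z)

lemma br_self (x : M.e) (c : N.ee) : br x x c = o x (N.P c) :=
  Pres.sound (BoxRel.br_self x c)

lemma br_P (x : M.e) (a : M.ee) (c : N.ee) : br x (M.P a) c = 0 :=
  Pres.sound (BoxRel.br_P x a c)

lemma br_swap (x y : M.e) (c : N.ee) : br x y c + br y x c = br x y (N.H (N.P c)) := by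
  have h := br_self (x + y) c
  rw [add_o, br_add_left, br_add_mid, br_add_mid, br_self, br_self] at h
  have h1 : o x (N.P c) + (br x y c + br y x c + o y (N.P c)) =
      o x (N.P c) + (br x y (N.H (N.P c)) + o y (N.P c)) := by
    rw [br_central x y (N.H (N.P c))]
    simpa only [add_assoc] using h
  exact add_right_cancel (add_left_cancel h1)

lemma br_comm (x y : M.e) (c : N.ee) : br y x c = br x y (N.T c) := by
  have h := br_swap x y c
  rw [N.H_P, br_add_right] at h
  exact add_left_cancel h

lemma P_br (x : M.e) (a : M.ee) (c : N.ee) : br (M.P a) x c = 0 := by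
  rw [br_comm, br_P]

lemma o_swap (x x' : M.e) (z z' : N.e) : o x z + o x' z' =
    o x' z' + o x z + br x' x (crossEffect N.H z z') := by
  apply cancel_swap (p := o x' z) (t := o x z') (br_central x' x (N.H z))
    (br_central x' x (N.H z')) (br_central _ _ _)
  rw [← add_o, ← add_o, ← o_add, add_o, o_add, o_add, N.H_add, br_add_right, br_add_right]

lemma o_P_central (a : M.ee) (z : N.e) (v : Pres (BoxRel M N)) :
    o (M.P a) z + v = v + o (M.P a) z := by
  apply Pres.central_of_gen
  rintro (⟨x', z'⟩ | ⟨x, y, c⟩)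
  · have h := o_swap (M.P a) x' z z'
    rwa [br_P, add_zero] at h
  · exact (br_central x y c _).symm

lemma o_P_P (a : M.ee) (c : N.ee) : o (M.P a) (N.P c) = 0 := by
  rw [← br_self, br_P]

lemma o_P_add (a a' : M.ee) (z : N.e) : o (M.P (a + a')) z = o (M.P a) z + o (M.P a') z := by
  rw [map_add, add_o, br_P, add_zero]

variable (M N)

/-- The map `z̄ ↦ P a ⊗ z`. -/
def oP (a : M.ee) : N.coker →+ Pres (BoxRel M N) :=
  N.cokerLift (AddMonoidHom.mk' (fun z => o (M.P a) z) (fun z z' => o_add _ z z'))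
    (fun c => o_P_P a c)

/-- The map `x̄ ⊗ ȳ ↦ [x, y] ⊗ c`. -/
def brBar (c : N.ee) : M.coker →+ M.coker →+ AddSubgroup.center (Pres (BoxRel M N)) :=
  have hc : ∀ x y, br x y c ∈ AddSubgroup.center (Pres (BoxRel M N)) := fun x y =>
    AddSubgroup.mem_center_iff.2 (fun v => (br_central x y c v).symm)
  M.cokerLift
    (AddMonoidHom.mk'
      (fun x => M.cokerLift
        (AddMonoidHom.mk' (fun y => (⟨br x y c, hc x y⟩ : AddSubgroup.center (Pres (BoxRel M N))))
          (fun y y' => Subtype.ext (br_add_mid x y y' c)))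
        (fun a => Subtype.ext (br_P x a c)))
      (fun x x' => by
        ext y; obtain ⟨y, rfl⟩ := M.bar_surjective y
        exact br_add_left x x' y c))
    (fun a => by
      ext y; obtain ⟨y, rfl⟩ := M.bar_surjective y
      exact P_br y a c)

lemma brBar_bar (c : N.ee) (x y : M.e) :
    (brBar M N c (M.bar x) (M.bar y) : Pres (BoxRel M N)) = br x y c := rfl

lemma brBar_add (c c' : N.ee) : brBar M N (c + c') = brBar M N c + brBar M N c' := by
  ext x y
  obtain ⟨x, rfl⟩ := M.bar_surjective x
  obtain ⟨y, rfl⟩ := M.bar_surjective y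
  exact br_add_right x y c c'

/-- The first component of `P`, `a ⊗ z̄ ↦ P a ⊗ z`. -/
def P₁ : M.ee ⊗[ℤ] N.coker →+ AddSubgroup.center (Pres (BoxRel M N)) :=
  centralLift (fun a z => oP M N a z)
    (fun a a' z => by obtain ⟨z, rfl⟩ := N.bar_surjective z; exact o_P_add a a' z)
    (fun a z z' => map_add _ z z')
    (fun a z v => by obtain ⟨z, rfl⟩ := N.bar_surjective z; exact o_P_central a z v)

/-- The second component of `P`, `x̄ ⊗ ȳ ⊗ c ↦ [x, y] ⊗ c`. -/
def P₂ : (M.coker ⊗[ℤ] M.coker) ⊗[ℤ] N.ee →+ AddSubgroup.center (Pres (BoxRel M N)) :=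
  (TensorProduct.lift (bilin
    (fun c w => TensorProduct.lift (bilin (fun x y => brBar M N c x y)
      (fun x x' y => by simp) (fun x y y' => by simp)) w)
    (fun c c' w => by
      induction w with
      | zero => simp
      | tmul x y => simp [brBar_add]
      | add u v hu hv => simp only [map_add, hu, hv]; abel)
    (fun c w w' => map_add _ w w')).flip).toAddMonoidHom

lemma P₁_tmul (a : M.ee) (z : N.e) :
    (P₁ M N (a ⊗ₜ N.bar z) : Pres (BoxRel M N)) = o (M.P a) z :=
  centralLift_tmul _ _ _ _ a (N.bar z)

lemma P₂_tmul (x y : M.e) (c : N.ee) :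
    (P₂ M N ((M.bar x ⊗ₜ M.bar y) ⊗ₜ c) : Pres (BoxRel M N)) = br x y c := by
  simp [P₂, brBar_bar]

lemma o_commutator (x y : M.e) (z : N.e) :
    o (M.P (crossEffect M.H x y)) z = br y x (N.Δ (N.bar z)) := by
  have h1 : o (x + y) z = o (y + x) z + o (M.P (crossEffect M.H x y)) z := by
    conv_lhs => rw [M.add_swap x y]
    rw [add_o, br_P, add_zero]
  rw [add_o, add_o, o_swap x y z z, add_assoc, add_assoc (_ + _)] at h1
  have h2 := add_left_cancel h1
  rw [Δ_eq, sub_eq_add_neg, add_right_comm, br_add_right, br_add_right, ← br_comm y x, h2,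
    br_central, add_assoc, ← br_add_right, add_neg_cancel, br_zero, add_zero]

/-- The homomorphism `P` with `P (a ⊗ z̄) = P a ⊗ z` and `P (x̄ ⊗ ȳ ⊗ c) = [x, y] ⊗ c`. -/
def P : EE M N →+ Pres (BoxRel M N) :=
  (AddSubgroup.center _).subtype.comp <|
    QuotientAddGroup.lift (eeRel M N) ((P₁ M N).coprod (P₂ M N)) (by
      rw [eeRel, AddSubgroup.closure_le]
      rintro _ ⟨x, y, z, rfl⟩
      apply Subtype.ext
      simp only [AddMonoidHom.coprod_apply, map_neg]
      rw [← sub_eq_add_neg, AddSubgroup.coe_sub, P₁_tmul, P₂_tmul, o_commutator, sub_self]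
      rfl)

lemma P_inl (a : M.ee) (z : N.e) : P M N (inl a (N.bar z)) = o (M.P a) z := by
  rw [← P₁_tmul]
  change (((P₁ M N).coprod (P₂ M N) (a ⊗ₜ N.bar z, 0) : AddSubgroup.center _) : Pres (BoxRel M N)) = _
  simp

lemma P_inr (x y : M.e) (c : N.ee) : P M N (inr (M.bar x) (M.bar y) c) = br x y c := by
  rw [← P₂_tmul]
  change (((P₁ M N).coprod (P₂ M N) (0, (M.bar x ⊗ₜ M.bar y) ⊗ₜ c) : AddSubgroup.center _) : Pres (BoxRel M N)) = _
  simp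

lemma ee_induction {p : EE M N → Prop} (h0 : p 0) (hl : ∀ a z, p (inl a (N.bar z)))
    (hr : ∀ x y c, p (inr (M.bar x) (M.bar y) c)) (ha : ∀ u v, p u → p v → p (u + v)) (w : EE M N) :
    p w := by
  obtain ⟨⟨s, t⟩, rfl⟩ := eeMk_surjective M N w
  have hs : p (eeMk M N (s, 0)) := by
    induction s with
    | zero => exact (map_zero (eeMk M N)).symm ▸ h0
    | tmul a z => obtain ⟨z, rfl⟩ := N.bar_surjective z; exact hl a z
    | add u v hu hv =>
      have h := ha _ _ hu hv
      rwa [← map_add, Prod.mk_add_mk, add_zero] at h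
  have ht : p (eeMk M N (0, t)) := by
    induction t with
    | zero => exact (map_zero (eeMk M N)).symm ▸ h0
    | tmul w c =>
      induction w with
      | zero => rw [TensorProduct.zero_tmul]; exact (map_zero (eeMk M N)).symm ▸ h0
      | tmul x y =>
        obtain ⟨x, rfl⟩ := M.bar_surjective x
        obtain ⟨y, rfl⟩ := M.bar_surjective y
        exact hr x y c
      | add u v hu hv =>
        have h := ha _ _ hu hv
        rwa [← map_add, Prod.mk_add_mk, add_zero, ← TensorProduct.add_tmul] at h
    | add u v hu hv =>
      have h := ha _ _ hu hv
      rwa [← map_add, Prod.mk_add_mk, add_zero] at h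
  have h := ha _ _ hs ht
  rwa [← map_add, Prod.mk_add_mk, add_zero, zero_add] at h

/-- The quadratic map `H` together with the projection to `Coker P ⊗ Coker P`, on generators. -/
def genF : BoxGen M N → Ext (ρ M N)
  | .o x z => ⟨inl (M.H x) (N.bar z) + inr (M.bar x) (M.bar x) (N.H z), M.bar x ⊗ₜ N.bar z⟩
  | .br x y c => ⟨inr (M.bar x) (M.bar y) c + inr (M.bar y) (M.bar x) (N.T c), 0⟩

/-- The quadratic map `H` together with the projection to `Coker P ⊗ Coker P`. -/
def F : Pres (BoxRel M N) →+ Ext (ρ M N) :=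
  Pres.lift (genF M N) (by
    intro p q h
    induction h with
    | central x y c w => ext <;> simp [genF, add_comm]
    | br_add_left x x' y c =>
      ext
      · simp [genF, inr_add_left, inr_add_mid]; abel
      · simp [genF]
    | br_add_mid x y y' c =>
      ext
      · simp [genF, inr_add_left, inr_add_mid]; abel
      · simp [genF]
    | br_add_right x y c c' =>
      ext
      · simp [genF, inr_add_right]; abel
      · simp [genF]
    | o_add x z z' =>
      ext
      · simp [genF, inl_add_right, inr_add_right, H_add]; abel
      · simp [genF, TensorProduct.tmul_add]
    | add_o x y z =>
      ext
      · simp [genF, inl_add_left, inr_add_left, inr_add_mid, inr_add_right, inr_sub_right, H_add,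
          inl_cross, Δ_eq]
        abel
      · simp [genF, TensorProduct.add_tmul]
    | br_self x c =>
      ext
      · simp [genF, bar_P, inl_zero_right, H_P, inr_add_right]
      · simp [genF, bar_P]
    | br_P x a c =>
      ext
      · simp [genF, bar_P, inr_zero_left, inr_zero_mid]
      · simp [genF])

lemma F_o (x : M.e) (z : N.e) : F M N (o x z) =
    ⟨inl (M.H x) (N.bar z) + inr (M.bar x) (M.bar x) (N.H z), M.bar x ⊗ₜ N.bar z⟩ :=
  Pres.lift_gen _ _ _

lemma F_br (x y : M.e) (c : N.ee) : F M N (br x y c) =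
    ⟨inr (M.bar x) (M.bar y) c + inr (M.bar y) (M.bar x) (N.T c), 0⟩ :=
  Pres.lift_gen _ _ _

lemma F_P (w : EE M N) : (F M N (P M N w)).snd = 0 := by
  induction w using ee_induction with
  | h0 => simp
  | hl a z => rw [P_inl, F_o]; simp [bar_P]
  | hr x y c => rw [P_inr, F_br]
  | ha u v hu hv => simp [hu, hv]

end Box

/-- The product `M □ N` of square groups. -/
def box : SquareGroup.{u} :=
  ofPres (Box.F M N) (Box.P M N) (fun w v => center_comm _ v) (Box.F_P M N)
    (by
      rintro (⟨x, y⟩ | ⟨x, y, c⟩) (⟨x', y'⟩ | ⟨x', y', c'⟩)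
      · change Box.o x y + Box.o x' y' = Box.o x' y' + Box.o x y +
          Box.P M N (Box.ρ M N (Box.F M N (Box.o x y)).snd (Box.F M N (Box.o x' y')).snd)
        rw [Box.F_o, Box.F_o]
        rw [Box.ρ_tmul, Box.P_inr]
        exact Box.o_swap x x' y y'
      · change _ + Box.br x' y' c' = Box.br x' y' c' + _ +
          Box.P M N (Box.ρ M N _ (Box.F M N (Box.br x' y' c')).snd)
        rw [Box.F_br, map_zero, map_zero, add_zero, Box.br_central]
      · change Box.br x y c + _ = _ + Box.br x y c +
          Box.P M N (Box.ρ M N (Box.F M N (Box.br x y c)).snd _)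
        rw [Box.F_br, map_zero, LinearMap.zero_apply, map_zero, add_zero, Box.br_central]
      · change Box.br x y c + _ = _ + Box.br x y c +
          Box.P M N (Box.ρ M N (Box.F M N (Box.br x y c)).snd _)
        rw [Box.F_br, map_zero, LinearMap.zero_apply, map_zero, add_zero, Box.br_central])
    (by
      intro w
      induction w using Box.ee_induction with
      | h0 => simp
      | hl a z =>
        rw [Box.P_inl, Box.F_o, M.bar_P, Box.inr_zero_left, add_zero, Box.P_inl, M.PHP, two_nsmul,
          Box.add_o, Box.br_P, add_zero, two_nsmul]
      | hr x y c =>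
        rw [Box.P_inr, Box.F_br, map_add, Box.P_inr, Box.P_inr, ← Box.br_comm, two_nsmul]
      | ha u v hu hv =>
        simp only [map_add, Ext.add_fst, Box.F_P, map_zero, add_zero, hu, hv, two_nsmul]
        exact add_self_add (center_comm _ _))

variable {M N}

/-- The element `x ⊗ z` of `(M □ N).e`. -/
def boxO (x : M.e) (z : N.e) : (box M N).e := Box.o x z

/-- The element `[x, y] ⊗ c` of `(M □ N).e`. -/
def boxBr (x y : M.e) (c : N.ee) : (box M N).e := Box.br x y c

/-- The element `a ⊗ z̄` of `(M □ N).ee`. -/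
def boxInl (a : M.ee) (z : N.e) : (box M N).ee := Box.inl a (N.bar z)

/-- The element `x̄ ⊗ ȳ ⊗ c` of `(M □ N).ee`. -/
def boxInr (x y : M.e) (c : N.ee) : (box M N).ee := Box.inr (M.bar x) (M.bar y) c

lemma box_P_inl (a : M.ee) (z : N.e) : (box M N).P (boxInl a z) = boxO (M.P a) z :=
  Box.P_inl M N a z

lemma box_P_inr (x y : M.e) (c : N.ee) : (box M N).P (boxInr x y c) = boxBr x y c :=
  Box.P_inr M N x y c

lemma box_H_o (x : M.e) (z : N.e) :
    (box M N).H (boxO x z) = boxInl (M.H x) z + boxInr x x (N.H z) :=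
  congrArg Ext.fst (Box.F_o M N x z)

lemma box_H_br (x y : M.e) (c : N.ee) :
    (box M N).H (boxBr x y c) = boxInr x y c + boxInr y x (N.T c) :=
  congrArg Ext.fst (Box.F_br M N x y c)

lemma box_cross (x x' : M.e) (z z' : N.e) :
    crossEffect (box M N).H (boxO x z) (boxO x' z') = boxInr x' x (crossEffect N.H z z') := by
  change (Box.F M N (Box.o x z + Box.o x' z')).fst - (Box.F M N (Box.o x z)).fst
    - (Box.F M N (Box.o x' z')).fst = _
  rw [map_add, Ext.add_fst, add_assoc, add_sub_cancel_left, add_sub_cancel_left, Box.F_o,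
    Box.F_o]
  rfl

end Box

/-- `n (n - 1) / 2` for an integer `n`. -/
def choose2 (n : ℤ) : ℤ := n * (n - 1) / 2

lemma two_choose2 (n : ℤ) : 2 * choose2 n = n * (n - 1) := by
  refine Int.mul_ediv_cancel' ?_
  rcases Int.even_or_odd n with h | h
  · exact (h.mul_right _).two_dvd
  · exact ((h.sub_odd odd_one).mul_left _).two_dvd

lemma choose2_cross (m n : ℤ) : choose2 (m + n) - choose2 m - choose2 n = m * n := by
  have h1 := two_choose2 (m + n)
  have h2 := two_choose2 m
  have h3 := two_choose2 n
  nlinarith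

/-- The square group `ℤ_nil = (ℤ → ℤ → ℤ)` with `H n = n (n - 1) / 2` and `P = 0`. -/
def Znil : SquareGroup.{u} :=
  have hcr : ∀ m n : ULift.{u} ℤ,
      crossEffect (fun n : ULift.{u} ℤ => (⟨choose2 n.down⟩ : ULift.{u} ℤ)) m n =
        ⟨m.down * n.down⟩ := fun m n => ULift.ext _ _ (choose2_cross m.down n.down)
  { e := ULift ℤ
    ee := ULift ℤ
    H := fun n => ⟨choose2 n.down⟩
    P := 0
    quadratic := ⟨fun x x' y => by simp only [hcr]; exact ULift.ext _ _ (add_mul _ _ _),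
      fun x y y' => by simp only [hcr]; exact ULift.ext _ _ (mul_add _ _ _)⟩
    cross_P_left := fun a y => by rw [hcr]; exact ULift.ext _ _ (zero_mul _)
    cross_P_right := fun a y => by rw [hcr]; exact ULift.ext _ _ (mul_zero _)
    P_cross := fun x y => by
      change 0 = -x - y + x + y
      abel
    PHP := fun a => by simp }

/-- An integer as an element of `ℤ_nil` at the `e`-level. -/
def Znil.ofE (n : ℤ) : Znil.{u}.e := (⟨n⟩ : ULift ℤ)

/-- An integer as an element of `ℤ_nil` at the `ee`-level. -/
def Znil.ofEE (n : ℤ) : Znil.{u}.ee := (⟨n⟩ : ULift ℤ)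

/-- The structure of a monoidal category on the category of square groups with the given tensor
product `obj` of objects, and with `ℤ_nil` as unit object. -/
@[ext]
structure MonoidalOn (obj : SquareGroup.{u} → SquareGroup.{u} → SquareGroup.{u}) where
  /-- The tensor product of morphisms. -/
  map : ∀ {M M' N N' : SquareGroup.{u}}, (M ⟶ M') → (N ⟶ N') → (obj M N ⟶ obj M' N')
  /-- The associativity isomorphism. -/
  assoc : ∀ M N K : SquareGroup.{u}, obj (obj M N) K ≅ obj M (obj N K)
  /-- The left unit isomorphism. -/
  lunit : ∀ M : SquareGroup.{u}, obj Znil M ≅ M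
  /-- The right unit isomorphism. -/
  runit : ∀ M : SquareGroup.{u}, obj M Znil ≅ M
  map_id : ∀ M N : SquareGroup.{u}, map (𝟙 M) (𝟙 N) = 𝟙 (obj M N)
  map_comp : ∀ {M M' M'' N N' N'' : SquareGroup.{u}} (f : M ⟶ M') (f' : M' ⟶ M'')
    (g : N ⟶ N') (g' : N' ⟶ N''), map (f ≫ f') (g ≫ g') = map f g ≫ map f' g'
  assoc_naturality : ∀ {M M' N N' K K' : SquareGroup.{u}} (f : M ⟶ M') (g : N ⟶ N')
    (h : K ⟶ K'), map (map f g) h ≫ (assoc M' N' K').hom = (assoc M N K).hom ≫ map f (map g h)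
  lunit_naturality : ∀ {M N : SquareGroup.{u}} (f : M ⟶ N),
    map (𝟙 Znil) f ≫ (lunit N).hom = (lunit M).hom ≫ f
  runit_naturality : ∀ {M N : SquareGroup.{u}} (f : M ⟶ N),
    map f (𝟙 Znil) ≫ (runit N).hom = (runit M).hom ≫ f
  pentagon : ∀ L M N K : SquareGroup.{u},
    map (assoc L M N).hom (𝟙 K) ≫ (assoc L (obj M N) K).hom ≫ map (𝟙 L) (assoc M N K).hom =
      (assoc (obj L M) N K).hom ≫ (assoc L M (obj N K)).hom
  triangle : ∀ M N : SquareGroup.{u},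
    (assoc M Znil N).hom ≫ map (𝟙 M) (lunit N).hom = map (runit M).hom (𝟙 N)

namespace MonoidalOn

variable {obj obj' : SquareGroup.{u} → SquareGroup.{u} → SquareGroup.{u}}

/-- The category of square groups, as the monoidal category given by `S`. -/
@[nolint unusedArguments]
def Cat (_ : MonoidalOn obj) : Type (u + 1) := SquareGroup.{u}

variable (S : MonoidalOn obj) (Q : MonoidalOn obj')

instance : Category S.Cat := inferInstanceAs (Category SquareGroup.{u})

instance : MonoidalCategory S.Cat where
  tensorObj := obj
  whiskerLeft M _ _ g := S.map (𝟙 M) g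
  whiskerRight f N := S.map f (𝟙 N)
  tensorHom f g := S.map f g
  tensorUnit := Znil
  associator := S.assoc
  leftUnitor := S.lunit
  rightUnitor := S.runit
  tensorHom_def f g := by
    refine Eq.trans ?_ (S.map_comp _ _ _ _)
    exact congrArg₂ (fun f g => S.map f g) (Category.comp_id f).symm (Category.id_comp g).symm
  id_tensorHom_id := S.map_id
  tensorHom_comp_tensorHom f g f' g' := (S.map_comp f f' g g').symm
  whiskerLeft_id := S.map_id
  id_whiskerRight := S.map_id
  associator_naturality := S.assoc_naturality
  leftUnitor_naturality := S.lunit_naturality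
  rightUnitor_naturality := S.runit_naturality
  pentagon := S.pentagon
  triangle := S.triangle

/-- The identity functor of the category of square groups, as a functor between the two monoidal
categories given by `S` and `Q`. -/
def idFunctor : S.Cat ⥤ Q.Cat := 𝟭 SquareGroup.{u}

end MonoidalOn

/-- The formulas that determine the monoidal structure `⊛` of the category of square groups. -/
structure IsTensorStructure (S : MonoidalOn tensor.{u}) : Prop where
  map_e : ∀ {M M' N N' : SquareGroup.{u}} (f : M ⟶ M') (g : N ⟶ N') (x : M.e) (y : N.e),
    (S.map f g).e (otimes x y) = otimes (f.e x) (g.e y)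
  map_e_bar : ∀ {M M' N N' : SquareGroup.{u}} (f : M ⟶ M') (g : N ⟶ N') (a : M.ee) (b : N.ee),
    (S.map f g).e (obar a b) = obar (f.ee a) (g.ee b)
  map_ee : ∀ {M M' N N' : SquareGroup.{u}} (f : M ⟶ M') (g : N ⟶ N') (a : M.ee) (b : N.ee),
    (S.map f g).ee (tmul a b) = tmul (f.ee a) (g.ee b)
  assoc_e : ∀ {M N K : SquareGroup.{u}} (x : M.e) (y : N.e) (z : K.e),
    (S.assoc M N K).hom.e (otimes (otimes x y) z) = otimes x (otimes y z)
  assoc_e_bar_otimes : ∀ {M N K : SquareGroup.{u}} (a : M.ee) (b : N.ee) (z : K.e),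
    (S.assoc M N K).hom.e (otimes (obar a b) z) = obar a (tmul b (K.Δ (K.bar z)))
  assoc_e_bar : ∀ {M N K : SquareGroup.{u}} (a : M.ee) (b : N.ee) (c : K.ee),
    (S.assoc M N K).hom.e (obar (tmul a b) c) = obar a (tmul b c)
  assoc_ee : ∀ {M N K : SquareGroup.{u}} (a : M.ee) (b : N.ee) (c : K.ee),
    (S.assoc M N K).hom.ee (tmul (tmul a b) c) = tmul a (tmul b c)
  lunit_e : ∀ {M : SquareGroup.{u}} (n : ℤ) (y : M.e),
    (S.lunit M).hom.e (otimes (Znil.ofE n) y) = n • y + choose2 n • M.P (M.H y)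
  lunit_e_bar : ∀ {M : SquareGroup.{u}} (n : ℤ) (b : M.ee),
    (S.lunit M).hom.e (obar (Znil.ofEE n) b) = n • M.P b
  lunit_ee : ∀ {M : SquareGroup.{u}} (n : ℤ) (b : M.ee),
    (S.lunit M).hom.ee (tmul (Znil.ofEE n) b) = n • b
  runit_e : ∀ {M : SquareGroup.{u}} (x : M.e) (n : ℤ),
    (S.runit M).hom.e (otimes x (Znil.ofE n)) = n • x
  runit_e_bar : ∀ {M : SquareGroup.{u}} (a : M.ee) (n : ℤ),
    (S.runit M).hom.e (obar a (Znil.ofEE n)) = n • M.P a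
  runit_ee : ∀ {M : SquareGroup.{u}} (a : M.ee) (n : ℤ),
    (S.runit M).hom.ee (tmul a (Znil.ofEE n)) = n • a

/-- The formulas that determine the monoidal structure `□` of the category of square groups, which
is induced by the composition of quadratic endofunctors of the category of groups. -/
structure IsBoxStructure (Q : MonoidalOn box.{u}) : Prop where
  map_e : ∀ {M M' N N' : SquareGroup.{u}} (f : M ⟶ M') (g : N ⟶ N') (x : M.e) (z : N.e),
    (Q.map f g).e (boxO x z) = boxO (f.e x) (g.e z)
  map_e_br : ∀ {M M' N N' : SquareGroup.{u}} (f : M ⟶ M') (g : N ⟶ N') (x y : M.e) (c : N.ee),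
    (Q.map f g).e (boxBr x y c) = boxBr (f.e x) (f.e y) (g.ee c)
  map_ee_inl : ∀ {M M' N N' : SquareGroup.{u}} (f : M ⟶ M') (g : N ⟶ N') (a : M.ee) (z : N.e),
    (Q.map f g).ee (boxInl a z) = boxInl (f.ee a) (g.e z)
  map_ee_inr : ∀ {M M' N N' : SquareGroup.{u}} (f : M ⟶ M') (g : N ⟶ N') (x y : M.e) (c : N.ee),
    (Q.map f g).ee (boxInr x y c) = boxInr (f.e x) (f.e y) (g.ee c)
  assoc_e : ∀ {M N K : SquareGroup.{u}} (x : M.e) (y : N.e) (z : K.e),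
    (Q.assoc M N K).hom.e (boxO (boxO x y) z) = boxO x (boxO y z)
  assoc_e_br_o : ∀ {M N K : SquareGroup.{u}} (x x' : M.e) (b : N.ee) (z : K.e),
    (Q.assoc M N K).hom.e (boxO (boxBr x x' b) z) = boxBr x x' (boxInl b z)
  assoc_e_br : ∀ {M N K : SquareGroup.{u}} (x x' : M.e) (y y' : N.e) (c : K.ee),
    (Q.assoc M N K).hom.e (boxBr (boxO x y) (boxO x' y') c) = boxBr x x' (boxInr y y' c)
  assoc_ee_inl_inl : ∀ {M N K : SquareGroup.{u}} (a : M.ee) (y : N.e) (z : K.e),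
    (Q.assoc M N K).hom.ee (boxInl (boxInl a y) z) = boxInl a (boxO y z)
  assoc_ee_inr_inl : ∀ {M N K : SquareGroup.{u}} (x x' : M.e) (b : N.ee) (z : K.e),
    (Q.assoc M N K).hom.ee (boxInl (boxInr x x' b) z) = boxInr x x' (boxInl b z)
  assoc_ee_inr : ∀ {M N K : SquareGroup.{u}} (x x' : M.e) (y y' : N.e) (c : K.ee),
    (Q.assoc M N K).hom.ee (boxInr (boxO x y) (boxO x' y') c) = boxInr x x' (boxInr y y' c)
  lunit_e : ∀ {M : SquareGroup.{u}} (n : ℤ) (y : M.e),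
    (Q.lunit M).hom.e (boxO (Znil.ofE n) y) = n • y + choose2 n • M.P (M.H y)
  lunit_e_br : ∀ {M : SquareGroup.{u}} (m n : ℤ) (c : M.ee),
    (Q.lunit M).hom.e (boxBr (Znil.ofE m) (Znil.ofE n) c) = (m * n) • M.P c
  lunit_ee_inl : ∀ {M : SquareGroup.{u}} (n : ℤ) (y : M.e),
    (Q.lunit M).hom.ee (boxInl (Znil.ofEE n) y) = n • M.Δ (M.bar y)
  lunit_ee_inr : ∀ {M : SquareGroup.{u}} (m n : ℤ) (c : M.ee),
    (Q.lunit M).hom.ee (boxInr (Znil.ofE m) (Znil.ofE n) c) = (m * n) • c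
  runit_e : ∀ {M : SquareGroup.{u}} (x : M.e) (n : ℤ),
    (Q.runit M).hom.e (boxO x (Znil.ofE n)) = n • x
  runit_e_br : ∀ {M : SquareGroup.{u}} (x y : M.e) (n : ℤ),
    (Q.runit M).hom.e (boxBr x y (Znil.ofEE n)) = n • M.P (crossEffect M.H y x)
  runit_ee_inl : ∀ {M : SquareGroup.{u}} (a : M.ee) (n : ℤ),
    (Q.runit M).hom.ee (boxInl a (Znil.ofE n)) = n • a
  runit_ee_inr : ∀ {M : SquareGroup.{u}} (x y : M.e) (n : ℤ),
    (Q.runit M).hom.ee (boxInr x y (Znil.ofEE n)) = n • crossEffect M.H y x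

/-- The formulas for `σ : M □ N ⟶ M ⊛ N` on generators. -/
structure IsSigma {M N : SquareGroup.{u}} (σ : box M N ⟶ tensor M N) : Prop where
  e_o : ∀ (x : M.e) (z : N.e), σ.e (boxO x z) = otimes x z
  e_br : ∀ (x y : M.e) (c : N.ee), σ.e (boxBr x y c) = obar (crossEffect M.H y x) c
  ee_inl : ∀ (a : M.ee) (z : N.e), σ.ee (boxInl a z) = tmul a (N.Δ (N.bar z))
  ee_inr : ∀ (x y : M.e) (c : N.ee), σ.ee (boxInr x y c) = tmul (crossEffect M.H y x) c

end SquareGroup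

/-! Both products are given by generators and relations, so the theorem splits into building
morphisms and comparing them.

Comparing is easy. A morphism commutes with `P`, so its `e`-level on the image of `P` is forced by
its `ee`-level. It therefore suffices to test the elements `x ⊛ y` (or `x ⊗ z`) together with
generators of the `ee`-level (`Generates.hom_ext`). This condition is inherited by iterated
products, and in `ℤ_nil` the element `1` suffices. Naturality, pentagon, triangle, uniqueness of
both structures and of `σ`, and the lax coherence laws then become identities between explicit
formulas. The only inputs with content there are `(x|y)_H ⊗ z̄ = ȳ ⊗ x̄ ⊗ Δ z̄`, the naturality of
`Δ` and of the cross-effect, and `Δ(x ⊛ y) = Δ x ⊗ Δ y` (`Δ_otimes`), which makes `σ` associative.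

Building uses the universal properties `tensor_exists_hom` and `box_exists_hom`. They give the
products of morphisms, the unit maps and `σ` directly: the relations of `M □ N` go to those of `M ⊛
N` under `a ⊗ z̄ ↦ a ⊗ Δ z̄` and `x̄ ⊗ ȳ ⊗ c ↦ (y|x)_H ⊗ c`.

The work is in the associators, where a factor is itself a presented group. For fixed `z` the map `u
↦ u ⊛ z` is not additive; its defect is `P` of an expression biadditive in the two summands. Such
maps are homomorphisms to a central extension (`Twisted`), so they can be defined on generators
(`Pres.exists_twisted`). Identities between them follow once both sides have the same additive
defect and agree on generators (`eq_of_add_eq`). Commutators produced on the way are `P` of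
cross-effects, and `cross_eq_of_generates` computes these; they cancel against the cross-effect
terms of `H` because `P T = P`, `T (x|y)_H = -(y|x)_H` and `H P = Id + T`. The associators in the
two directions are built separately and are inverse to each other on generators. -/

namespace SquareGroup

/-! ### Functions on presented groups that are additive up to a central biadditive error. -/

section Twisted

variable {E : Type*} [AddGroup E]

/-- The group of pairs `(w, u)` with `(w, u) + (w', u') = (w + w' + P (c u u'), u + u')`. -/
@[ext]
structure Twisted (L : SquareGroup.{u}) (c : E →+ E →+ L.ee) where
  fst : L.e
  snd : E

lemma add_P_add (L : SquareGroup.{u}) (x y : L.e) (a : L.ee) :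
    x + L.P a + y = x + y + L.P a := by
  rw [add_assoc, L.P_central, add_assoc]

lemma add_P_add_P (L : SquareGroup.{u}) (x : L.e) (a b : L.ee) :
    x + L.P a + L.P b = x + L.P (a + b) := by
  rw [map_add, add_assoc]

namespace Twisted

variable {L : SquareGroup.{u}} {c : E →+ E →+ L.ee}

instance : Zero (Twisted L c) := ⟨⟨0, 0⟩⟩
instance : Add (Twisted L c) :=
  ⟨fun p q => ⟨p.fst + q.fst + L.P (c p.snd q.snd), p.snd + q.snd⟩⟩
instance : Neg (Twisted L c) := ⟨fun p => ⟨-p.fst + L.P (c p.snd p.snd), -p.snd⟩⟩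

@[simp] lemma zero_fst : (0 : Twisted L c).fst = 0 := rfl
@[simp] lemma zero_snd : (0 : Twisted L c).snd = 0 := rfl
@[simp] lemma add_fst (p q : Twisted L c) :
    (p + q).fst = p.fst + q.fst + L.P (c p.snd q.snd) := rfl
@[simp] lemma add_snd (p q : Twisted L c) : (p + q).snd = p.snd + q.snd := rfl
@[simp] lemma neg_fst (p : Twisted L c) : (-p).fst = -p.fst + L.P (c p.snd p.snd) := rfl
@[simp] lemma neg_snd (p : Twisted L c) : (-p).snd = -p.snd := rfl

/-- Biadditivity of `c` is the cocycle condition, and it suffices because the image of `P` is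
central. The group `E` need not be abelian. -/
instance : AddGroup (Twisted L c) :=
  AddGroup.ofLeftAxioms
    (fun p q s => by
      ext
      · simp only [add_fst, add_snd, map_add, AddMonoidHom.add_apply]
        rw [L.add_P_add]
        simp only [add_assoc]
        congr 3
        rw [← map_add, ← map_add, ← map_add, ← map_add]
        congr 1; abel
      · simp [add_assoc])
    (fun p => by ext <;> simp)
    (fun p => by
      ext
      · simp only [add_fst, neg_fst, neg_snd, zero_fst, map_neg, AddMonoidHom.neg_apply]
        rw [L.add_P_add]; simp
      · simp)

/-- The projection to `E`. -/
def sndHom : Twisted L c →+ E := AddMonoidHom.mk' Twisted.snd (fun _ _ => rfl)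

end Twisted

/-- A function on a presented group with values in a square group, which is additive up to a
biadditive map, from its values on the generators. -/
lemma Pres.exists_twisted {X : Type u} {r : FreeAddGroup X → FreeAddGroup X → Prop}
    {L : SquareGroup.{u}} (c : Pres r →+ Pres r →+ L.ee) (φ : X → L.e)
    (h : ∀ a b, r a b → (FreeAddGroup.lift (fun x => (⟨φ x, gen x⟩ : Twisted L c)) a).fst =
      (FreeAddGroup.lift (fun x => (⟨φ x, gen x⟩ : Twisted L c)) b).fst) :
    ∃ f : Pres r → L.e, (∀ x, f (gen x) = φ x) ∧
      ∀ u v, f (u + v) = f u + f v + L.P (c u v) := by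
  -- The second component is the projection itself, so it respects the relations automatically and
  -- only the first component needs a hypothesis.
  have hs : ∀ w, (FreeAddGroup.lift (fun x => (⟨φ x, gen x⟩ : Twisted L c)) w).snd = proj w := by
    intro w
    refine DFunLike.congr_fun (f := Twisted.sndHom.comp (FreeAddGroup.lift _)) (g := proj) ?_ w
    ext x
    simp [Twisted.sndHom, gen]
  let F : Pres r →+ Twisted L c := Pres.lift (fun x => ⟨φ x, gen x⟩) (fun a b hab =>
    Twisted.ext (h a b hab) (by rw [hs, hs]; exact sound hab))
  -- Thus `F` is a section of the extension, and its first component has exactly the defect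
  -- prescribed by the cocycle.
  have hF : ∀ u, (F u).snd = u := by
    intro u
    obtain ⟨w, rfl⟩ := proj_surjective u
    exact hs w
  refine ⟨fun u => (F u).fst, fun x => ?_, fun u v => ?_⟩
  · exact congrArg Twisted.fst (Pres.lift_gen _ _ x)
  · simp only [map_add, Twisted.add_fst, hF]

/-- Two functions, which are additive up to the same error term, agree as soon as they agree on
generators. -/
lemma eq_of_add_eq {E G : Type*} [AddGroup E] [AddGroup G] {S : Set E}
    (hS : AddSubgroup.closure S = ⊤) {f g : E → G} (c : E → E → G)
    (hf : ∀ u v, f (u + v) = f u + f v + c u v) (hg : ∀ u v, g (u + v) = g u + g v + c u v)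
    (h : ∀ s ∈ S, f s = g s) (u : E) : f u = g u := by
  -- The defect already determines the value at `0`; no normalization is assumed.
  have h0 : ∀ f : E → G, (∀ u v, f (u + v) = f u + f v + c u v) → f 0 = - c 0 0 := by
    intro f hf
    have := hf 0 0
    rw [add_zero, add_assoc] at this
    exact eq_neg_of_add_eq_zero_left (left_eq_add.1 this)
  have hu : u ∈ AddSubgroup.closure S := hS ▸ AddSubgroup.mem_top u
  induction hu using AddSubgroup.closure_induction with
  | mem s hs => exact h s hs
  | zero => rw [h0 f hf, h0 g hg]
  | add u v _ _ hu hv => rw [hf, hg, hu, hv]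
  -- The value at `-u` is recovered from `u + -u = 0`, since the values at `0` and at `u` and the
  -- defect agree.
  | neg u _ hu =>
    have h1 := hf u (-u)
    have h2 := hg u (-u)
    rw [add_neg_cancel, h0 f hf] at h1
    rw [add_neg_cancel, h0 g hg, h1, hu] at h2
    exact add_left_cancel (add_right_cancel h2)

end Twisted

/-! ### Generation of a square group modulo the image of `P`. -/

section Generates

/-- The elements of `S` and `R` generate the square group `A`, where those of `S` need to generate
`A.e` only together with the image of `P`. -/
structure Generates (A : SquareGroup.{u}) (S : Set A.e) (R : Set A.ee) : Prop where
  e : AddSubgroup.closure (S ∪ Set.range A.P) = ⊤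
  ee : AddSubgroup.closure R = ⊤

namespace Generates

variable {A B : SquareGroup.{u}} {S : Set A.e} {R : Set A.ee}

lemma univ (A : SquareGroup.{u}) : Generates A Set.univ Set.univ :=
  ⟨by simp, by simp⟩

/-- On the image of `P` the `e`-level is dictated by the `ee`-level through `map_P`, so this part of
the generating set needs no separate check. -/
lemma hom_ext (h : Generates A S R) {f g : A ⟶ B} (he : ∀ s ∈ S, f.e s = g.e s)
    (hee : ∀ r ∈ R, f.ee r = g.ee r) : f = g := by
  have h1 : f.ee = g.ee := AddMonoidHom.eq_of_eqOn_dense h.ee hee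
  refine Hom.ext (AddMonoidHom.eq_of_eqOn_dense h.e ?_) h1
  rintro _ (hs | ⟨a, rfl⟩)
  · exact he _ hs
  · rw [f.map_P, g.map_P, h1]

end Generates

@[simp] lemma comp_e {A B C : SquareGroup.{u}} (f : A ⟶ B) (g : B ⟶ C) (x : A.e) :
    (f ≫ g).e x = g.e (f.e x) := rfl

@[simp] lemma comp_ee {A B C : SquareGroup.{u}} (f : A ⟶ B) (g : B ⟶ C) (x : A.ee) :
    (f ≫ g).ee x = g.ee (f.ee x) := rfl

@[simp] lemma id_e (A : SquareGroup.{u}) (x : A.e) : Hom.e (𝟙 A) x = x := rfl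

@[simp] lemma id_ee (A : SquareGroup.{u}) (x : A.ee) : Hom.ee (𝟙 A) x = x := rfl

end Generates

/-! ### Operations preserved by morphisms, and multiadditive maps. -/

section Homs

variable {M N : SquareGroup.{u}}

lemma Hom.map_cross (f : M ⟶ N) (x y : M.e) :
    f.ee (crossEffect M.H x y) = crossEffect N.H (f.e x) (f.e y) := by
  simp [crossEffect, f.map_H]

lemma Hom.map_T (f : M ⟶ N) (a : M.ee) : f.ee (M.T a) = N.T (f.ee a) := by
  simp [T_apply, f.map_H, f.map_P]

/-- By `Δ_eq`, `Δ` is built from the cross-effect, `H` and `T`, all of which morphisms preserve. -/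
lemma Hom.map_Δ (f : M ⟶ N) (x : M.e) : f.ee (M.Δ (M.bar x)) = N.Δ (N.bar (f.e x)) := by
  rw [Δ_eq, Δ_eq, map_add, map_sub, f.map_cross, f.map_T, f.map_H]

end Homs

/-- The cross-effect of `H` as a biadditive map. -/
def crossHom (M : SquareGroup.{u}) : M.e →+ M.e →+ M.ee :=
  AddMonoidHom.mk' (fun x => AddMonoidHom.mk' (crossEffect M.H x) (M.quadratic.add_right x))
    (fun x x' => by ext y; exact M.quadratic.add_left x x' y)

lemma cross_add_left (M : SquareGroup.{u}) (x x' y : M.e) :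
    crossEffect M.H (x + x') y = crossEffect M.H x y + crossEffect M.H x' y :=
  M.quadratic.add_left x x' y

lemma cross_add_right (M : SquareGroup.{u}) (x y y' : M.e) :
    crossEffect M.H x (y + y') = crossEffect M.H x y + crossEffect M.H x y' :=
  M.quadratic.add_right x y y'

lemma crossHom_apply (M : SquareGroup.{u}) (x y : M.e) :
    M.crossHom x y = crossEffect M.H x y := rfl

/-- A biadditive map as an additive map to additive maps. -/
def biadd {A B C : Type*} [AddGroup A] [AddGroup B] [AddCommGroup C] (f : A → B → C)
    (hl : ∀ a a' b, f (a + a') b = f a b + f a' b)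
    (hr : ∀ a b b', f a (b + b') = f a b + f a b') : A →+ B →+ C :=
  AddMonoidHom.mk' (fun a => AddMonoidHom.mk' (f a) (hr a)) (fun a a' => by ext b; exact hl a a' b)

@[simp] lemma biadd_apply {A B C : Type*} [AddGroup A] [AddGroup B] [AddCommGroup C]
    (f : A → B → C) (hl : ∀ a a' b, f (a + a') b = f a b + f a' b)
    (hr : ∀ a b b', f a (b + b') = f a b + f a b') (a : A) (b : B) : biadd f hl hr a b = f a b :=
  rfl

/-- A triadditive map as an additive map to additive maps to additive maps. -/
def triadd {A B C D : Type*} [AddGroup A] [AddGroup B] [AddGroup C] [AddCommGroup D]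
    (f : A → B → C → D) (hl : ∀ a a' b c, f (a + a') b c = f a b c + f a' b c)
    (hm : ∀ a b b' c, f a (b + b') c = f a b c + f a b' c)
    (hr : ∀ a b c c', f a b (c + c') = f a b c + f a b c') : A →+ B →+ C →+ D :=
  AddMonoidHom.mk' (fun a => biadd (f a) (hm a) (hr a))
    (fun a a' => by ext b c; exact hl a a' b c)

@[simp] lemma triadd_apply {A B C D : Type*} [AddGroup A] [AddGroup B] [AddGroup C]
    [AddCommGroup D] (f : A → B → C → D)
    (hl : ∀ a a' b c, f (a + a') b c = f a b c + f a' b c)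
    (hm : ∀ a b b' c, f a (b + b') c = f a b c + f a b' c)
    (hr : ∀ a b c c', f a b (c + c') = f a b c + f a b c') (a : A) (b : B) (c : C) :
    triadd f hl hm hr a b c = f a b c := rfl

/-- Two biadditive maps agree as soon as they agree on generators. -/
lemma biadd_ext {A B C : Type*} [AddGroup A] [AddGroup B] [AddCommGroup C] {S : Set A} {R : Set B}
    (hS : AddSubgroup.closure S = ⊤) (hR : AddSubgroup.closure R = ⊤) {f g : A →+ B →+ C}
    (h : ∀ s ∈ S, ∀ r ∈ R, f s r = g s r) (a : A) (b : B) : f a b = g a b := by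
  have : f = g := AddMonoidHom.eq_of_eqOn_dense hS fun s hs =>
    AddMonoidHom.eq_of_eqOn_dense hR (h s hs)
  rw [this]

end SquareGroup

namespace SquareGroup

variable {L M N : SquareGroup.{u}}

lemma H_add_P (M : SquareGroup.{u}) (x : M.e) (a : M.ee) :
    M.H (x + M.P a) = M.H x + M.H (M.P a) := by
  rw [H_add, M.cross_P_right, add_zero]

lemma Δ_P (M : SquareGroup.{u}) (a : M.ee) : M.Δ (M.bar (M.P a)) = 0 := by
  rw [bar_P, map_zero]

/-- The homomorphism `Δ` on `M.e`. -/
def ΔHom (M : SquareGroup.{u}) : M.e →+ M.ee := M.Δ.comp M.bar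

/-- Used with `T` a preimage under a map additive in one variable, to extend membership from
generators modulo `P` to all elements. -/
lemma closure_image_union {A : SquareGroup.{u}} {S : Set A.e} (T : AddSubgroup A.e)
    (hP : ∀ a, A.P a ∈ T) (hS : S ⊆ T) (h : AddSubgroup.closure (S ∪ Set.range A.P) = ⊤)
    (u : A.e) : u ∈ T := by
  have h1 : AddSubgroup.closure (S ∪ Set.range A.P) ≤ T := by
    rw [AddSubgroup.closure_le]
    rintro _ (hs | ⟨a, rfl⟩)
    exacts [hS hs, hP a]
  exact h1 (h ▸ AddSubgroup.mem_top u)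

/-! ### Calculus in `M ⊛ N` and its universal property. -/

section TensorAPI

lemma otimes_add (x : M.e) (y y' : N.e) : otimes x (y + y') = otimes x y + otimes x y' :=
  Tensor.go_add x y y'

lemma tmul_add (a : M.ee) (b b' : N.ee) : tmul a (b + b') = tmul a b + tmul a b' :=
  TensorProduct.tmul_add a b b'

lemma add_tmul (a a' : M.ee) (b : N.ee) : tmul (a + a') b = tmul a b + tmul a' b :=
  TensorProduct.add_tmul a a' b

/-- The biadditive map `a ⊗ b`. -/
def tmulHom (M N : SquareGroup.{u}) : M.ee →+ N.ee →+ (tensor M N).ee :=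
  biadd tmul add_tmul tmul_add

lemma tmul_zero (a : M.ee) : tmul a (0 : N.ee) = 0 := map_zero (tmulHom M N a)

lemma zero_tmul (b : N.ee) : tmul (0 : M.ee) b = 0 := TensorProduct.zero_tmul _ b

lemma tmul_neg (a : M.ee) (b : N.ee) : tmul a (-b) = -tmul a b := map_neg (tmulHom M N a) b

lemma neg_tmul (a : M.ee) (b : N.ee) : tmul (-a) b = -tmul a b := TensorProduct.neg_tmul a b

lemma tmul_sub (a : M.ee) (b b' : N.ee) : tmul a (b - b') = tmul a b - tmul a b' :=
  map_sub (tmulHom M N a) b b'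

lemma sub_tmul (a a' : M.ee) (b : N.ee) : tmul (a - a') b = tmul a b - tmul a' b :=
  TensorProduct.sub_tmul a a' b

lemma add_otimes (x x' : M.e) (y : N.e) : otimes (x + x') y =
    otimes x y + otimes x' y + (tensor M N).P (tmul (crossEffect M.H x' x) (N.H y)) := by
  rw [tensor_P]; exact Tensor.add_go x x' y

lemma otimes_P (x : M.e) (b : N.ee) :
    otimes x (N.P b) = (tensor M N).P (tmul (crossEffect M.H x x) b) := by
  rw [tensor_P]; exact Pres.sound (TensorRel.o_P x b)

lemma P_otimes (a : M.ee) (y : N.e) :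
    otimes (M.P a) y = (tensor M N).P (tmul a (N.Δ (N.bar y))) := by
  rw [tensor_P]; exact Pres.sound (TensorRel.P_o a y)

lemma T_tmul (a : M.ee) (b : N.ee) : (tensor M N).T (tmul a b) = -tmul (M.T a) (N.T b) := by
  rw [T_apply, tensor_P, tensor_H_obar]; abel

/-- Expand `Δ = (u|u) - H u + T H u` at `u = x ⊛ y`. The terms with left factor `(x|x)_H` combine to
`(x|x)_H ⊗ Δ y`, as `T` negates `(x|x)_H`; the others combine to `(-H x + T H x) ⊗ Δ y`, as `T`
negates `Δ y`. This multiplicativity is what makes `σ` associative. -/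
lemma Δ_otimes (x : M.e) (y : N.e) : (tensor M N).Δ ((tensor M N).bar (otimes x y)) =
    tmul (M.Δ (M.bar x)) (N.Δ (N.bar y)) := by
  rw [Δ_eq, tensor_cross, tensor_H_otimes, map_add, T_tmul, T_tmul, T_cross, T_Δ, neg_tmul,
    tmul_neg, neg_neg, neg_neg, Δ_eq M, add_tmul, sub_tmul]
  -- Only the `Δ y` paired with `(x|x)_H` is expanded; the other two terms already occur unexpanded
  -- on the left.
  conv_rhs => enter [1, 1]; rw [Δ_eq N, tmul_add, tmul_sub]
  abel

/-- The universal property of the `ee`-level of the tensor product. -/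
def tensorLift {A : Type*} [AddCommGroup A] (g : M.ee →+ N.ee →+ A) : (tensor M N).ee →+ A :=
  (TensorProduct.lift (bilin (fun a b => g a b) (by simp) (by simp))).toAddMonoidHom

@[simp] lemma tensorLift_tmul {A : Type*} [AddCommGroup A] (g : M.ee →+ N.ee →+ A) (a : M.ee)
    (b : N.ee) : tensorLift g (tmul a b) = g a b :=
  TensorProduct.lift.tmul (f' := bilin (fun a b => g a b) (by simp) (by simp)) a b

lemma tensor_ee_closure {R : Set M.ee} {R' : Set N.ee} (h : AddSubgroup.closure R = ⊤)
    (h' : AddSubgroup.closure R' = ⊤) :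
    AddSubgroup.closure (Set.image2 tmul R R' : Set (tensor M N).ee) = ⊤ := by
  rw [eq_top_iff]
  intro w _
  have key : ∀ a b, tmul a b ∈ AddSubgroup.closure (Set.image2 tmul R R' : Set (tensor M N).ee) := by
    intro a b
    have h1 : ∀ a ∈ R, ∀ b,
        tmul a b ∈ AddSubgroup.closure (Set.image2 tmul R R' : Set (tensor M N).ee) := by
      intro a ha b
      have hb : b ∈ AddSubgroup.closure R' := h' ▸ AddSubgroup.mem_top b
      exact (AddSubgroup.closure_le ((AddSubgroup.closure (Set.image2 tmul R R')).comap (tmulHom M N a))).2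
        (fun b hb => AddSubgroup.subset_closure ⟨a, ha, b, hb, rfl⟩) hb
    have ha : a ∈ AddSubgroup.closure R := h ▸ AddSubgroup.mem_top a
    exact (AddSubgroup.closure_le ((AddSubgroup.closure (Set.image2 tmul R R')).comap ((tmulHom M N).flip b))).2
      (fun a ha => h1 a ha b) ha
  induction w using TensorProduct.induction_on with
  | zero => exact zero_mem _
  | tmul a b => exact key a b
  | add u v hu hv => exact add_mem (hu trivial) (hv trivial)

/-- The map `y ↦ x ⊛ y` is a homomorphism, while `x ↦ x ⊛ y` is additive only modulo the image of
`P`. This is enough for generation modulo that image. -/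
lemma tensor_e_closure {S : Set M.e} {S' : Set N.e}
    (h : AddSubgroup.closure (S ∪ Set.range M.P) = ⊤)
    (h' : AddSubgroup.closure (S' ∪ Set.range N.P) = ⊤) :
    AddSubgroup.closure (Set.image2 otimes S S' ∪ Set.range (tensor M N).P) = ⊤ := by
  rw [eq_top_iff]
  set T := AddSubgroup.closure (Set.image2 otimes S S' ∪ Set.range (tensor M N).P) with hT
  have hP : ∀ w, (tensor M N).P w ∈ T := fun w => AddSubgroup.subset_closure (.inr ⟨w, rfl⟩)
  have h1 : ∀ x ∈ S, ∀ y, otimes x y ∈ T := by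
    intro x hx y
    exact closure_image_union (T.comap (AddMonoidHom.mk' (otimes x) (otimes_add x)))
      (fun b => by
        change otimes x (N.P b) ∈ T
        rw [otimes_P]; exact hP _)
      (fun y hy => AddSubgroup.subset_closure (.inl ⟨x, hx, y, hy, rfl⟩)) h' y
  have h2 : ∀ x y, otimes x y ∈ T := by
    intro x y
    have hx : x ∈ AddSubgroup.closure (S ∪ Set.range M.P) := h ▸ AddSubgroup.mem_top x
    have h0 : otimes (0 : M.e) y ∈ T := by
      rw [← map_zero M.P, P_otimes]; exact hP _
    induction hx using AddSubgroup.closure_induction with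
    | mem x hx =>
      obtain hx | ⟨a, rfl⟩ := hx
      · exact h1 x hx y
      · rw [P_otimes]; exact hP _
    | zero => exact h0
    | add x x' _ _ hx hx' => rw [add_otimes]; exact add_mem (add_mem hx hx') (hP _)
    -- As `x ↦ x ⊛ y` is not a homomorphism, `(-x) ⊛ y` is isolated from `0 ⊛ y = (-x) ⊛ y + x ⊛ y +
    -- P(…)`.
    | neg x _ hx =>
      have h3 := add_otimes (-x) x y
      rw [neg_add_cancel] at h3
      rw [h3, add_mem_cancel_right (hP _), add_mem_cancel_right hx] at h0
      exact h0
  intro u _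
  obtain ⟨w, rfl⟩ := Pres.proj_surjective u
  induction w using FreeAddGroup.induction_on with
  | C1 => exact zero_mem _
  | of y =>
    rcases y with ⟨x, y⟩ | ⟨a, b⟩
    · exact h2 x y
    · have h3 := hP (tmul a b)
      rw [tensor_P] at h3
      exact h3
  | neg_of y hy => exact neg_mem (hy trivial)
  | add v v' hv hv' => exact add_mem (hv trivial) (hv' trivial)

lemma Generates.tensor {S : Set M.e} {R : Set M.ee} {S' : Set N.e} {R' : Set N.ee}
    (h : Generates M S R) (h' : Generates N S' R') :
    Generates (tensor M N) (Set.image2 otimes S S') (Set.image2 tmul R R') :=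
  ⟨tensor_e_closure h.e h'.e, tensor_ee_closure h.ee h'.ee⟩

/-- Functions on the `e`-level of the tensor product, which are additive up to a biadditive map. -/
lemma tensor_exists_twisted (c : (tensor M N).e →+ (tensor M N).e →+ L.ee)
    (hl : ∀ w u, c ((tensor M N).P w) u = 0) (hr : ∀ w u, c u ((tensor M N).P w) = 0)
    (ψ : (tensor M N).ee →+ L.ee) (φ : M.e → N.e → L.e)
    (φ_add : ∀ x y y', φ x (y + y') = φ x y + φ x y' + L.P (c (otimes x y) (otimes x y')))
    (add_φ : ∀ x x' y, φ (x + x') y = φ x y + φ x' y + L.P (c (otimes x y) (otimes x' y)) +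
      L.P (ψ (tmul (crossEffect M.H x' x) (N.H y))))
    (φ_P : ∀ x b, φ x (N.P b) = L.P (ψ (tmul (crossEffect M.H x x) b)))
    (P_φ : ∀ a y, φ (M.P a) y = L.P (ψ (tmul a (N.Δ (N.bar y)))))
    (hT : ∀ a b, L.P (ψ (tmul (M.T a) (N.T b))) = - L.P (ψ (tmul a b))) :
    ∃ f : (tensor M N).e → L.e, (∀ x y, f (otimes x y) = φ x y) ∧
      (∀ w, f ((tensor M N).P w) = L.P (ψ w)) ∧
      ∀ u v, f (u + v) = f u + f v + L.P (c u v) := by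
  obtain ⟨c', hc'⟩ : ∃ c' : Pres (TensorRel M N) →+ Pres (TensorRel M N) →+ L.ee,
      ∀ u v, c' u v = c u v := ⟨c, fun _ _ => rfl⟩
  -- The generators `a ⊗̄ b` lie in the image of `P`, so they contribute nothing to the defect.
  have hl' : ∀ a b, c' (Pres.gen (.b a b)) = 0 := fun a b => by
    ext u
    rw [hc']
    exact (congrArg (fun v => c v u) (tensor_P a b)).symm.trans (hl _ u)
  have hr' : ∀ a b u, c' u (Pres.gen (.b a b)) = 0 := fun a b u => by
    rw [hc']
    exact (congrArg (c u) (tensor_P a b)).symm.trans (hr _ u)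
  obtain ⟨f, hf, hadd⟩ := Pres.exists_twisted (L := L) c'
    (fun x => match x with
      | .o x y => φ x y
      | .b a b => L.P (ψ (tmul a b))) (by
    intro p q h
    induction h with
    | central a b w =>
      simp only [map_add, FreeAddGroup.lift_apply_of, Twisted.add_fst, hl', hr',
        AddMonoidHom.zero_apply, map_zero, add_zero, L.P_central]
    | add_b a a' b =>
      simp [add_tmul, hl']
    | b_add a b b' =>
      simp [tmul_add, hl']
    | o_add x y y' =>
      simp only [map_add, FreeAddGroup.lift_apply_of, Twisted.add_fst, hc']
      exact φ_add x y y'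
    | add_o x x' y =>
      simp only [map_add, FreeAddGroup.lift_apply_of, Twisted.add_fst, hr', map_zero, add_zero]
      simp only [hc']
      exact add_φ x x' y
    | o_P x b => simpa using φ_P x b
    | P_o a y => simpa using P_φ a y
    | T_b_T a b => simpa [hl'] using hT a b)
  have hadd' : ∀ u v : (tensor M N).e, f (u + v) = f u + f v + L.P (c u v) :=
    fun u v => (hadd u v).trans (congrArg (fun a => f u + f v + L.P a) (hc' u v))
  refine ⟨f, fun x y => hf (.o x y), fun w => ?_, hadd'⟩
  -- The defect vanishes on the image of `P`, so `f ∘ P` is a homomorphism and can be compared with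
  -- `P ∘ ψ` on pure tensors.
  have h1 : (AddMonoidHom.mk' (fun w => f ((tensor M N).P w)) fun w w' => by
      have := hadd' ((tensor M N).P w) ((tensor M N).P w')
      rwa [hl, map_zero, add_zero, ← map_add] at this) = L.P.comp ψ := by
    refine AddMonoidHom.eq_of_eqOn_dense
      (tensor_ee_closure (M := M) (N := N) (R := Set.univ) (R' := Set.univ) (by simp) (by simp)) ?_
    rintro _ ⟨a, _, b, _, rfl⟩
    exact (congrArg f (tensor_P a b)).trans (hf (.b a b))
  exact DFunLike.congr_fun h1 w

/-- Compatibility with `H` may be checked on generators. -/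
lemma map_H_of_generates {A L : SquareGroup.{u}} {S : Set A.e}
    (hS : AddSubgroup.closure (S ∪ Set.range A.P) = ⊤)
    (f : A.e →+ L.e) (g : A.ee →+ L.ee) (hP : ∀ a, f (A.P a) = L.P (g a))
    (hT : ∀ a, g (A.T a) = L.T (g a)) (hH : ∀ x ∈ S, g (A.H x) = L.H (f x))
    (hc : ∀ x ∈ S, ∀ y ∈ S, g (crossEffect A.H x y) = crossEffect L.H (f x) (f y)) (x : A.e) :
    g (A.H x) = L.H (f x) := by
  refine eq_of_add_eq hS (fun x y => g (crossEffect A.H x y))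
    (f := fun x => g (A.H x)) (g := fun x => L.H (f x)) (fun x y => by rw [H_add, map_add, map_add])
    (fun x y => ?_) ?_ x
  -- Both maps have the same defect because the two cross-effects are biadditive, agree on `S`, and
  -- vanish on the image of `P`.
  · rw [map_add, H_add]
    congr 1
    symm
    refine biadd_ext hS hS (f := biadd (fun x y => g (crossEffect A.H x y)) ?_ ?_)
      (g := biadd (fun x y => crossEffect L.H (f x) (f y)) ?_ ?_) ?_ x y
    · simp [cross_add_left]
    · simp [cross_add_right]
    · simp [cross_add_left]
    · simp [cross_add_right]
    · rintro x (hx | ⟨a, rfl⟩) y (hy | ⟨b, rfl⟩)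
      · exact hc x hx y hy
      · simp [hP, cross_P_right]
      · simp [hP, cross_P_left]
      · simp [hP, cross_P_right]
  · rintro _ (hx | ⟨a, rfl⟩)
    · exact hH _ hx
    -- On the image of `P` one has `H P = Id + T`, so compatibility with `T` is all that is needed.
    · rw [hP, H_P, H_P, map_add, hT]

/-- The universal property of the tensor product. -/
lemma tensor_exists_hom (g : M.ee →+ N.ee →+ L.ee) (f : M.e → N.e → L.e)
    (f_add : ∀ x y y', f x (y + y') = f x y + f x y')
    (add_f : ∀ x x' y, f (x + x') y = f x y + f x' y + L.P (g (crossEffect M.H x' x) (N.H y)))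
    (f_P : ∀ x b, f x (N.P b) = L.P (g (crossEffect M.H x x) b))
    (P_f : ∀ a y, f (M.P a) y = L.P (g a (N.Δ (N.bar y))))
    (hT : ∀ a b, L.T (g a b) = - g (M.T a) (N.T b))
    (hH : ∀ x y, L.H (f x y) = g (crossEffect M.H x x) (N.H y) + g (M.H x) (N.Δ (N.bar y)))
    (hc : ∀ x x' y y', crossEffect L.H (f x y) (f x' y') =
      g (crossEffect M.H x x') (crossEffect N.H y y')) :
    ∃ F : tensor M N ⟶ L, (∀ x y, F.e (otimes x y) = f x y) ∧
      ∀ a b, F.ee (tmul a b) = g a b := by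
  obtain ⟨F, hF, hP, hadd⟩ := tensor_exists_twisted (L := L) (M := M) (N := N) 0 (by simp) (by simp)
    (tensorLift g) f (by simpa using f_add) (by simpa using add_f) (by simpa using f_P)
    (by simpa using P_f)
    -- The relation `T(a) ⊗̄ T(b) = -a ⊗̄ b` needs no separate hypothesis: apply `P` to `hT` and use
    -- `P T = P`.
    (fun a b => by
      rw [tensorLift_tmul, tensorLift_tmul, ← neg_neg (g (M.T a) (N.T b)), ← hT, map_neg, P_T])
  let F' : (tensor M N).e →+ L.e := AddMonoidHom.mk' F (by simpa using hadd)
  refine ⟨⟨F', tensorLift g, map_H_of_generates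
    ((Generates.univ M).tensor (Generates.univ N)).e F' _ hP (fun w => ?_) ?_ ?_, hP⟩, hF,
    tensorLift_tmul g⟩
  · refine DFunLike.congr_fun (f := (tensorLift g).comp (tensor M N).T)
      (g := L.T.comp (tensorLift g)) (AddMonoidHom.eq_of_eqOn_dense
      ((Generates.univ M).tensor (Generates.univ N)).ee ?_) w
    rintro _ ⟨a, _, b, _, rfl⟩
    simp [T_tmul, hT]
  · rintro _ ⟨x, _, y, _, rfl⟩
    rw [tensor_H_otimes, map_add, tensorLift_tmul, tensorLift_tmul]
    exact ((congrArg L.H (hF x y)).trans (hH x y)).symm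
  · rintro _ ⟨x, _, y, _, rfl⟩ _ ⟨x', _, y', _, rfl⟩
    rw [tensor_cross, tensorLift_tmul, ← hc]
    exact (congrArg₂ _ (hF x y) (hF x' y')).symm

end TensorAPI

end SquareGroup

namespace SquareGroup

variable {L M N : SquareGroup.{u}}

/-! ### Calculus in `M □ N` and its universal property. -/

section BoxAPI

lemma boxO_add (x : M.e) (z z' : N.e) : boxO x (z + z') = boxO x z + boxO x z' :=
  Box.o_add x z z'

lemma add_boxO (x y : M.e) (z : N.e) :
    boxO (x + y) z = boxO x z + boxO y z + (box M N).P (boxInr x y (N.H z)) := by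
  rw [box_P_inr]; exact Box.add_o x y z

lemma boxO_P (x : M.e) (c : N.ee) : boxO x (N.P c) = (box M N).P (boxInr x x c) := by
  rw [box_P_inr]; exact (Box.br_self x c).symm

lemma P_boxO (a : M.ee) (z : N.e) : boxO (M.P a) z = (box M N).P (boxInl a z) :=
  (box_P_inl a z).symm

/-- The biadditive map `a ⊗ z̄`. -/
def boxInlHom (M N : SquareGroup.{u}) : M.ee →+ N.e →+ (box M N).ee :=
  biadd (C := (box M N).ee) boxInl (fun a a' z => Box.inl_add_left a a' (N.bar z))
    (fun a z z' => (congrArg (Box.inl a) (map_add N.bar z z')).trans (Box.inl_add_right a _ _))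

lemma boxInlHom_apply (a : M.ee) (z : N.e) : boxInlHom M N a z = boxInl a z := rfl

/-- The triadditive map `x̄ ⊗ ȳ ⊗ c`. -/
def boxInrHom (M N : SquareGroup.{u}) : M.e →+ M.e →+ N.ee →+ (box M N).ee :=
  AddMonoidHom.mk' (fun x => biadd (C := (box M N).ee) (boxInr x)
      (fun y y' c => (congrArg (Box.inr _ · c) (map_add M.bar y y')).trans
        (Box.inr_add_mid _ _ _ c))
      (fun y c c' => Box.inr_add_right (M.bar x) (M.bar y) c c'))
    (fun x x' => by
      ext y c
      exact (congrArg (Box.inr · _ c) (map_add M.bar x x')).trans (Box.inr_add_left _ _ _ c))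

lemma boxInrHom_apply (x y : M.e) (c : N.ee) : boxInrHom M N x y c = boxInr x y c := rfl

lemma add_boxInl (a a' : M.ee) (z : N.e) : boxInl (a + a') z = boxInl a z + boxInl a' z := by
  simp [← boxInlHom_apply]

lemma sub_boxInl (a a' : M.ee) (z : N.e) : boxInl (a - a') z = boxInl a z - boxInl a' z := by
  simp [← boxInlHom_apply]

lemma zero_boxInl (z : N.e) : boxInl (0 : M.ee) z = 0 := by
  simp [← boxInlHom_apply]

lemma boxInl_add (a : M.ee) (z z' : N.e) : boxInl a (z + z') = boxInl a z + boxInl a z' := by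
  simp [← boxInlHom_apply]

lemma boxInl_P (a : M.ee) (c : N.ee) : boxInl a (N.P c) = 0 :=
  (congrArg (Box.inl a) (N.bar_P c)).trans (Box.inl_zero_right a)

lemma boxInr_add (x y : M.e) (c c' : N.ee) : boxInr x y (c + c') = boxInr x y c + boxInr x y c' := by
  simp [← boxInrHom_apply]

lemma boxInr_sub (x y : M.e) (c c' : N.ee) : boxInr x y (c - c') = boxInr x y c - boxInr x y c' := by
  simp [← boxInrHom_apply]

lemma boxInr_zero (x y : M.e) : boxInr x y (0 : N.ee) = 0 := by
  simp [← boxInrHom_apply]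

lemma add_boxInr (x x' y : M.e) (c : N.ee) : boxInr (x + x') y c = boxInr x y c + boxInr x' y c := by
  simp [← boxInrHom_apply]

lemma boxInr_add_mid (x y y' : M.e) (c : N.ee) :
    boxInr x (y + y') c = boxInr x y c + boxInr x y' c := by
  simp [← boxInrHom_apply]

lemma P_boxInr (a : M.ee) (y : M.e) (c : N.ee) : boxInr (M.P a) y c = 0 :=
  (congrArg (Box.inr · _ c) (M.bar_P a)).trans (Box.inr_zero_left _ _)

lemma boxInr_P (x : M.e) (a : M.ee) (c : N.ee) : boxInr x (M.P a) c = 0 :=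
  (congrArg (Box.inr _ · c) (M.bar_P a)).trans (Box.inr_zero_mid _ _)

lemma boxInl_cross (x y : M.e) (z : N.e) :
    boxInl (crossEffect M.H x y) z = boxInr y x (N.Δ (N.bar z)) :=
  Box.inl_cross x y z

lemma T_boxInl (a : M.ee) (z : N.e) : (box M N).T (boxInl a z) = boxInl (M.T a) z := by
  rw [T_apply, box_P_inl, box_H_o, P_boxInr, add_zero, T_apply, sub_boxInl]

lemma T_boxInr (x y : M.e) (c : N.ee) : (box M N).T (boxInr x y c) = boxInr y x (N.T c) := by
  rw [T_apply, box_P_inr, box_H_br, add_sub_cancel_left]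

/-- In `(u|u) - H u + T H u` the terms with left factors `x̄ ⊗ x̄` add up to `x̄ ⊗ x̄ ⊗ Δ z`, which
the defining relation of the `ee`-level turns into `(x|x)_H ⊗ z̄`. -/
lemma Δ_boxO (x : M.e) (z : N.e) :
    (box M N).Δ ((box M N).bar (boxO x z)) = boxInl (M.Δ (M.bar x)) z := by
  rw [Δ_eq, box_cross, box_H_o, map_add, T_boxInl, T_boxInr, Δ_eq, add_boxInl, sub_boxInl,
    boxInl_cross, Δ_eq, boxInr_add, boxInr_sub]
  abel

section

variable {A : Type*} [AddCommGroup A] (h : M.ee →+ N.e →+ A) (k : M.e →+ M.e →+ N.ee →+ A)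
    (h_P : ∀ a c, h a (N.P c) = 0) (P_k : ∀ a y c, k (M.P a) y c = 0)
    (k_P : ∀ x a c, k x (M.P a) c = 0)
    (hk : ∀ x y z, h (crossEffect M.H x y) z = k y x (N.Δ (N.bar z)))

/-- The homomorphism on the direct sum, of which the `ee`-level of `M □ N` is a quotient. -/
def boxLiftAux : (M.ee ⊗[ℤ] N.coker) × ((M.coker ⊗[ℤ] M.coker) ⊗[ℤ] N.ee) →+ A :=
  let h' : M.ee →+ N.coker →+ A := AddMonoidHom.mk' (fun a => N.cokerLift (h a) (h_P a))
    (fun a a' => by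
      ext z; obtain ⟨z, rfl⟩ := N.bar_surjective z
      simp)
  let k' : M.coker →+ M.coker →+ N.ee →+ A := M.cokerLift
    (AddMonoidHom.mk' (fun x => M.cokerLift (k x) (fun a => AddMonoidHom.ext (k_P x a)))
      (fun x x' => by
        ext y : 1; obtain ⟨y, rfl⟩ := M.bar_surjective y
        simp))
    (fun a => by
      ext y : 1; obtain ⟨y, rfl⟩ := M.bar_surjective y
      exact AddMonoidHom.ext (P_k a y))
  (TensorProduct.lift (bilin (fun a z => h' a z) (by simp) (by simp))).toAddMonoidHom.coprod
    (TensorProduct.lift (bilin (fun w c =>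
      (TensorProduct.lift (bilin (fun x y => k' x y) (by simp) (by simp)) w) c)
      (by simp) (by simp))).toAddMonoidHom

lemma boxLiftAux_inl (a : M.ee) (z : N.e) :
    boxLiftAux h k h_P P_k k_P (a ⊗ₜ N.bar z, 0) = h a z := by
  simp [boxLiftAux]

lemma boxLiftAux_inr (x y : M.e) (c : N.ee) :
    boxLiftAux h k h_P P_k k_P (0, (M.bar x ⊗ₜ M.bar y) ⊗ₜ c) = k x y c := by
  simp [boxLiftAux]

-- The hypothesis `hk` says that the homomorphism kills each generator of the subgroup of relations.
include hk in
lemma eeRel_le_ker : Box.eeRel M N ≤ (boxLiftAux h k h_P P_k k_P).ker := by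
  rw [Box.eeRel, AddSubgroup.closure_le]
  rintro _ ⟨x, y, z, rfl⟩
  simp [boxLiftAux, hk]

/-- The universal property of the `ee`-level of `M □ N`. -/
def boxLift : (box M N).ee →+ A :=
  QuotientAddGroup.lift (Box.eeRel M N) (boxLiftAux h k h_P P_k k_P)
    (eeRel_le_ker h k h_P P_k k_P hk)

@[simp] lemma boxLift_inl (a : M.ee) (z : N.e) :
    boxLift h k h_P P_k k_P hk (boxInl a z) = h a z :=
  boxLiftAux_inl h k h_P P_k k_P a z

@[simp] lemma boxLift_inr (x y : M.e) (c : N.ee) :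
    boxLift h k h_P P_k k_P hk (boxInr x y c) = k x y c :=
  boxLiftAux_inr h k h_P P_k k_P x y c

end

/-- A biadditive map, which vanishes on the images of `P`, as a homomorphism on `(M □ N).e`. -/
def boxEHom {A : Type*} [AddCommGroup A] (φ : M.e →+ N.e →+ A)
    (hr : ∀ x c, φ x (N.P c) = 0) : (box M N).e →+ A :=
  Pres.lift (r := BoxRel M N) (fun x => match x with
    | .o x z => φ x z
    | .br _ _ _ => 0) (by
    intro p q h
    induction h <;> simp [hr])

section

variable {A : Type*} [AddCommGroup A] (φ : M.e →+ N.e →+ A) (hr : ∀ x c, φ x (N.P c) = 0)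

@[simp] lemma boxEHom_o (x : M.e) (z : N.e) : boxEHom φ hr (boxO x z) = φ x z :=
  Pres.lift_gen _ _ _

lemma boxEHom_br (x y : M.e) (c : N.ee) : boxEHom φ hr (boxBr x y c) = 0 :=
  Pres.lift_gen _ _ _

@[simp] lemma boxEHom_P (hl : ∀ a z, φ (M.P a) z = 0) (w : (box M N).ee) : boxEHom φ hr ((box M N).P w) = 0 := by
  induction w using Box.ee_induction with
  | h0 => exact (congrArg _ (map_zero (box M N).P)).trans (map_zero _)
  | hl a z => exact ((congrArg _ (box_P_inl a z)).trans (boxEHom_o φ hr _ z)).trans (hl a z)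
  | hr x y c => exact (congrArg _ (box_P_inr x y c)).trans (boxEHom_br φ hr x y c)
  | ha u v hu hv =>
    exact ((congrArg _ (map_add (box M N).P u v)).trans (map_add _ _ _)).trans
      ((congrArg₂ _ hu hv).trans (add_zero 0))

end

/-- As for `⊛`, additivity of `x ↦ x ⊗ z` modulo the image of `P` suffices; the generators `[x, y] ⊗
c` lie in that image. -/
lemma box_e_closure {S : Set M.e} {S' : Set N.e}
    (h : AddSubgroup.closure (S ∪ Set.range M.P) = ⊤)
    (h' : AddSubgroup.closure (S' ∪ Set.range N.P) = ⊤) :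
    AddSubgroup.closure (Set.image2 boxO S S' ∪ Set.range (box M N).P) = ⊤ := by
  rw [eq_top_iff]
  set T := AddSubgroup.closure (Set.image2 boxO S S' ∪ Set.range (box M N).P) with hT
  have hP : ∀ w, (box M N).P w ∈ T := fun w => AddSubgroup.subset_closure (.inr ⟨w, rfl⟩)
  have h1 : ∀ x ∈ S, ∀ y, boxO x y ∈ T := by
    intro x hx y
    exact closure_image_union (T.comap (AddMonoidHom.mk' (boxO x) (boxO_add x)))
      (fun b => by
        change boxO x (N.P b) ∈ T
        rw [boxO_P]; exact hP _)
      (fun y hy => AddSubgroup.subset_closure (.inl ⟨x, hx, y, hy, rfl⟩)) h' y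
  have h2 : ∀ x y, boxO x y ∈ T := by
    intro x y
    have hx : x ∈ AddSubgroup.closure (S ∪ Set.range M.P) := h ▸ AddSubgroup.mem_top x
    have h0 : boxO (0 : M.e) y ∈ T := by
      rw [← map_zero M.P, P_boxO]; exact hP _
    induction hx using AddSubgroup.closure_induction with
    | mem x hx =>
      obtain hx | ⟨a, rfl⟩ := hx
      · exact h1 x hx y
      · rw [P_boxO]; exact hP _
    | zero => exact h0
    | add x x' _ _ hx hx' => rw [add_boxO]; exact add_mem (add_mem hx hx') (hP _)
    | neg x _ hx =>
      have h3 := add_boxO (-x) x y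
      rw [neg_add_cancel] at h3
      rw [h3, add_mem_cancel_right (hP _), add_mem_cancel_right hx] at h0
      exact h0
  intro u _
  obtain ⟨w, rfl⟩ := Pres.proj_surjective u
  induction w using FreeAddGroup.induction_on with
  | C1 => exact zero_mem _
  | of y =>
    rcases y with ⟨x, y⟩ | ⟨x, y, c⟩
    · exact h2 x y
    · have h3 := hP (boxInr x y c)
      rw [box_P_inr] at h3
      exact h3
  | neg_of y hy => exact neg_mem (hy trivial)
  | add v v' hv hv' => exact add_mem (hv trivial) (hv' trivial)

/-- Each slot is extended from generators in turn. The slots that come from cokernels vanish on the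
image of `P`, so generators modulo `P` are enough there. -/
lemma box_ee_closure {S : Set M.e} {R : Set M.ee} {S' : Set N.e} {R' : Set N.ee}
    (h : Generates M S R) (h' : Generates N S' R') :
    AddSubgroup.closure (Set.image2 boxInl R S' ∪ {w | ∃ x ∈ S, ∃ y ∈ S, ∃ c ∈ R', w = boxInr x y c} :
      Set (box M N).ee) = ⊤ := by
  rw [eq_top_iff]
  intro w _
  set T := AddSubgroup.closure (Set.image2 boxInl R S' ∪
    {w | ∃ x ∈ S, ∃ y ∈ S, ∃ c ∈ R', w = boxInr x y c} : Set (box M N).ee) with hT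
  have h1 : ∀ a ∈ R, ∀ z, boxInl a z ∈ T := fun a ha z =>
    closure_image_union (T.comap (boxInlHom M N a))
      (fun c => by
        change boxInl a (N.P c) ∈ T
        rw [boxInl_P]; exact zero_mem _)
      (fun z hz => AddSubgroup.subset_closure (.inl ⟨a, ha, z, hz, rfl⟩)) h'.e z
  have h2 : ∀ a z, boxInl a z ∈ T := fun a z => by
    have ha : a ∈ AddSubgroup.closure R := h.ee ▸ AddSubgroup.mem_top a
    exact (AddSubgroup.closure_le (T.comap ((boxInlHom M N).flip z))).2 (fun a ha => h1 a ha z) ha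
  have h3 : ∀ x ∈ S, ∀ y ∈ S, ∀ c, boxInr x y c ∈ T := fun x hx y hy c => by
    have hc : c ∈ AddSubgroup.closure R' := h'.ee ▸ AddSubgroup.mem_top c
    exact (AddSubgroup.closure_le (T.comap (boxInrHom M N x y))).2
      (fun c hc => AddSubgroup.subset_closure (.inr ⟨x, hx, y, hy, c, hc, rfl⟩)) hc
  have h4 : ∀ x ∈ S, ∀ y c, boxInr x y c ∈ T := fun x hx y c =>
    closure_image_union (T.comap ((boxInrHom M N x).flip c))
      (fun a => by
        change boxInr x (M.P a) c ∈ T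
        rw [boxInr_P]; exact zero_mem _)
      (fun y hy => h3 x hx y hy c) h.e y
  have h5 : ∀ x y c, boxInr x y c ∈ T := fun x y c =>
    closure_image_union (T.comap (((boxInrHom M N).flip y).flip c))
      (fun a => by
        change boxInr (M.P a) y c ∈ T
        rw [P_boxInr]; exact zero_mem _)
      (fun x hx => h4 x hx y c) h.e x
  exact Box.ee_induction M N (p := fun w => w ∈ T) (zero_mem T) h2 h5
    (fun u v hu hv => add_mem (S := AddSubgroup (box M N).ee) hu hv) w

lemma Generates.box {S : Set M.e} {R : Set M.ee} {S' : Set N.e} {R' : Set N.ee}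
    (h : Generates M S R) (h' : Generates N S' R') :
    Generates (box M N) (Set.image2 boxO S S')
      (Set.image2 boxInl R S' ∪ {w | ∃ x ∈ S, ∃ y ∈ S, ∃ c ∈ R', w = boxInr x y c}) :=
  ⟨box_e_closure h.e h'.e, box_ee_closure h h'⟩

/-- Functions on the `e`-level of `M □ N`, which are additive up to a biadditive map. -/
lemma box_exists_twisted (c : (box M N).e →+ (box M N).e →+ L.ee)
    (hl : ∀ w u, c ((box M N).P w) u = 0) (hr : ∀ w u, c u ((box M N).P w) = 0)
    (ψ : (box M N).ee →+ L.ee) (φ : M.e → N.e → L.e)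
    (φ_add : ∀ x z z', φ x (z + z') = φ x z + φ x z' + L.P (c (boxO x z) (boxO x z')))
    (add_φ : ∀ x y z, φ (x + y) z = φ x z + φ y z + L.P (c (boxO x z) (boxO y z)) +
      L.P (ψ (boxInr x y (N.H z))))
    (φ_P : ∀ x b, φ x (N.P b) = L.P (ψ (boxInr x x b)))
    (P_φ : ∀ a z, φ (M.P a) z = L.P (ψ (boxInl a z))) :
    ∃ f : (box M N).e → L.e, (∀ x z, f (boxO x z) = φ x z) ∧
      (∀ w, f ((box M N).P w) = L.P (ψ w)) ∧
      ∀ u v, f (u + v) = f u + f v + L.P (c u v) := by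
  obtain ⟨c', hc'⟩ : ∃ c' : Pres (BoxRel M N) →+ Pres (BoxRel M N) →+ L.ee,
      ∀ u v, c' u v = c u v := ⟨c, fun _ _ => rfl⟩
  have hl' : ∀ x y b, c' (Pres.gen (.br x y b)) = 0 := fun x y b => by
    ext u
    rw [hc']
    exact (congrArg (fun v => c v u) (box_P_inr x y b)).symm.trans (hl _ u)
  have hr' : ∀ x y b u, c' u (Pres.gen (.br x y b)) = 0 := fun x y b u => by
    rw [hc']
    exact (congrArg (c u) (box_P_inr x y b)).symm.trans (hr _ u)
  obtain ⟨f, hf, hadd⟩ := Pres.exists_twisted (L := L) c'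
    (fun x => match x with
      | .o x y => φ x y
      | .br x y b => L.P (ψ (boxInr x y b))) (by
    intro p q h
    induction h with
    | central x y b w =>
      simp only [map_add, FreeAddGroup.lift_apply_of, Twisted.add_fst, hl', hr',
        AddMonoidHom.zero_apply, map_zero, add_zero, L.P_central]
    | br_add_left x x' y b => simp [add_boxInr, hl']
    | br_add_mid x y y' b => simp [boxInr_add_mid, hl']
    | br_add_right x y b b' => simp [boxInr_add, hl']
    | o_add x y y' =>
      simp only [map_add, FreeAddGroup.lift_apply_of, Twisted.add_fst, hc']
      exact φ_add x y y'
    | add_o x x' y =>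
      simp only [map_add, FreeAddGroup.lift_apply_of, Twisted.add_fst, hr', map_zero, add_zero]
      simp only [hc']
      exact add_φ x x' y
    | br_self x b => simpa using (φ_P x b).symm
    | br_P x a b => simp [boxInr_P])
  have hadd' : ∀ u v : (box M N).e, f (u + v) = f u + f v + L.P (c u v) :=
    fun u v => (hadd u v).trans (congrArg (fun a => f u + f v + L.P a) (hc' u v))
  refine ⟨f, fun x y => hf (.o x y), fun w => ?_, hadd'⟩
  -- Again `f ∘ P` is additive. On `a ⊗ z̄` the hypothesis `P_φ` is needed, because `P a ⊗ z` is a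
  -- generator of the first kind.
  have h1 : (AddMonoidHom.mk' (fun w => f ((box M N).P w)) fun w w' => by
      have := hadd' ((box M N).P w) ((box M N).P w')
      rwa [hl, map_zero, add_zero, ← map_add] at this) = L.P.comp ψ := by
    refine AddMonoidHom.eq_of_eqOn_dense
      (box_ee_closure (Generates.univ M) (Generates.univ N)) ?_
    rintro _ (⟨a, _, z, _, rfl⟩ | ⟨x, _, y, _, b, _, rfl⟩)
    · exact ((congrArg f (box_P_inl a z)).trans (hf (.o _ z))).trans (P_φ a z)
    · exact (congrArg f (box_P_inr x y b)).trans (hf (.br x y b))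
  exact DFunLike.congr_fun h1 w

/-- The universal property of `M □ N`. -/
lemma box_exists_hom (h : M.ee →+ N.e →+ L.ee) (k : M.e →+ M.e →+ N.ee →+ L.ee)
    (f : M.e → N.e → L.e)
    (h_P : ∀ a c, h a (N.P c) = 0) (P_k : ∀ a y c, k (M.P a) y c = 0)
    (k_P : ∀ x a c, k x (M.P a) c = 0)
    (hk : ∀ x y z, h (crossEffect M.H x y) z = k y x (N.Δ (N.bar z)))
    (f_add : ∀ x z z', f x (z + z') = f x z + f x z')
    (add_f : ∀ x y z, f (x + y) z = f x z + f y z + L.P (k x y (N.H z)))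
    (f_P : ∀ x c, f x (N.P c) = L.P (k x x c))
    (P_f : ∀ a z, f (M.P a) z = L.P (h a z))
    (hTh : ∀ a z, L.T (h a z) = h (M.T a) z)
    (hT : ∀ x y c, L.T (k x y c) = k y x (N.T c))
    (hH : ∀ x z, L.H (f x z) = h (M.H x) z + k x x (N.H z))
    (hc : ∀ x x' z z', crossEffect L.H (f x z) (f x' z') = k x' x (crossEffect N.H z z')) :
    ∃ F : box M N ⟶ L, (∀ x z, F.e (boxO x z) = f x z) ∧ (∀ a z, F.ee (boxInl a z) = h a z) ∧
      ∀ x y c, F.ee (boxInr x y c) = k x y c := by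
  let G := boxLift h k h_P P_k k_P hk
  obtain ⟨F, hF, hP, hadd⟩ := box_exists_twisted (L := L) (M := M) (N := N) 0 (by simp) (by simp)
    G f (by simpa using f_add) (by simpa [G] using add_f) (by simpa [G] using f_P)
    (by simpa [G] using P_f)
  let F' : (box M N).e →+ L.e := AddMonoidHom.mk' F (by simpa using hadd)
  refine ⟨⟨F', G, map_H_of_generates
    ((Generates.univ M).box (Generates.univ N)).e F' _ hP (fun w => ?_) ?_ ?_, hP⟩, hF,
    boxLift_inl h k h_P P_k k_P hk, boxLift_inr h k h_P P_k k_P hk⟩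
  · refine DFunLike.congr_fun (f := G.comp (box M N).T)
      (g := L.T.comp G) (AddMonoidHom.eq_of_eqOn_dense
      ((Generates.univ M).box (Generates.univ N)).ee ?_) w
    rintro _ (⟨a, _, z, _, rfl⟩ | ⟨x, _, y, _, b, _, rfl⟩)
    · simp [T_boxInl, hTh, G]
    · simp [T_boxInr, hT, G]
  · rintro _ ⟨x, _, z, _, rfl⟩
    rw [box_H_o, map_add, boxLift_inl, boxLift_inr]
    exact ((congrArg L.H (hF x z)).trans (hH x z)).symm
  · rintro _ ⟨x, _, z, _, rfl⟩ _ ⟨x', _, z', _, rfl⟩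
    rw [box_cross, boxLift_inr, ← hc]
    exact (congrArg₂ _ (hF x z) (hF x' z')).symm

end BoxAPI

end SquareGroup

namespace SquareGroup

/-! ### Integer multiples and binomial corrections. -/

section Multiples

variable (M : SquareGroup.{u})

lemma choose2_zero : choose2 0 = 0 := rfl

lemma choose2_one : choose2 1 = 0 := rfl

lemma choose2_add (m n : ℤ) : choose2 (m + n) = choose2 m + choose2 n + m * n := by
  rw [← choose2_cross]; ring

lemma P_cross_swap (x y : M.e) : M.P (crossEffect M.H y x) = -M.P (crossEffect M.H x y) := by
  rw [← M.P_T, T_cross, map_neg]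

lemma P_zsmul_cross_swap (n : ℤ) (x y : M.e) :
    M.P (n • crossEffect M.H y x) = M.P (-(n • crossEffect M.H x y)) := by
  rw [map_zsmul, P_cross_swap, ← map_neg, ← map_zsmul, smul_neg]

lemma cross_zsmul_left (n : ℤ) (x y : M.e) :
    crossEffect M.H (n • x) y = n • crossEffect M.H x y := by
  simp [← crossHom_apply]

lemma cross_zsmul_right (n : ℤ) (x y : M.e) :
    crossEffect M.H x (n • y) = n • crossEffect M.H x y := by
  simp [← crossHom_apply]

lemma cross_add_P_left (x y : M.e) (a : M.ee) :
    crossEffect M.H (x + M.P a) y = crossEffect M.H x y := by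
  rw [cross_add_left, cross_P_left, add_zero]

lemma cross_add_P_right (x y : M.e) (a : M.ee) :
    crossEffect M.H x (y + M.P a) = crossEffect M.H x y := by
  rw [cross_add_right, cross_P_right, add_zero]

/-- Both sides are additive in `n`: moving `n x` past `m y` costs a commutator with coefficient `m
n`, which is the cross-effect of the binomial coefficient. Hence it is enough to take `n = 1`. -/
lemma zsmul_add_eq (n : ℤ) (x y : M.e) :
    n • (x + y) = n • x + n • y + M.P (choose2 n • crossEffect M.H y x) := by
  refine eq_of_add_eq Int.addSubgroupClosure_one (f := fun n : ℤ => n • (x + y))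
    (g := fun n : ℤ => n • x + n • y + M.P (choose2 n • crossEffect M.H y x)) (fun _ _ => 0)
    (fun m n => by rw [add_zero, add_zsmul]) (fun m n => ?_) ?_ n
  · rw [add_zero, add_zsmul, add_zsmul, ← add_assoc, add_assoc (m • x), M.add_swap (n • x) (m • y),
      choose2_add, cross_zsmul_left, cross_zsmul_right, smul_smul, mul_comm n m,
      P_zsmul_cross_swap M (m * n)]
    simp only [← add_assoc]
    rw [M.add_P_add _ (n • y), M.add_P_add _ (n • x), M.add_P_add _ (n • y), add_P_add_P,
      add_P_add_P, add_zsmul, add_zsmul]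
    congr 2
    abel
  · rintro _ rfl
    simp [choose2_one]

/-- As functions of `n` both sides have defect `m n (x|x)_H`, and they agree at `n = 1`. -/
lemma H_zsmul (n : ℤ) (x : M.e) :
    M.H (n • x) = n • M.H x + choose2 n • crossEffect M.H x x := by
  refine eq_of_add_eq Int.addSubgroupClosure_one (f := fun n : ℤ => M.H (n • x))
    (g := fun n : ℤ => n • M.H x + choose2 n • crossEffect M.H x x)
    (fun m n => (m * n) • crossEffect M.H x x)
    (fun m n => ?_) (fun m n => ?_) ?_ n
  · rw [add_zsmul, H_add, cross_zsmul_left, cross_zsmul_right, smul_smul]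
  · rw [choose2_add]; simp only [add_zsmul]; abel
  · rintro _ rfl
    simp [choose2_one]

end Multiples

/-! ### The unit object, generated by `1`, with `T = -1` and `Δ` the identity of the integers. -/

namespace Znil

/-- An element of the `e`-level of `ℤ_nil` as an integer. -/
def toE : Znil.{u}.e →+ ℤ := AddMonoidHom.mk' (fun n : ULift.{u} ℤ => n.down) (fun _ _ => rfl)

/-- An element of the `ee`-level of `ℤ_nil` as an integer. -/
def toEE : Znil.{u}.ee →+ ℤ := AddMonoidHom.mk' (fun n : ULift.{u} ℤ => n.down) (fun _ _ => rfl)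

lemma toE_inj {m n : Znil.{u}.e} (h : toE m = toE n) : m = n := ULift.ext _ _ h
lemma toEE_inj {m n : Znil.{u}.ee} (h : toEE m = toEE n) : m = n := ULift.ext _ _ h

@[simp] lemma toE_ofE (n : ℤ) : toE (ofE.{u} n) = n := rfl
@[simp] lemma toEE_ofEE (n : ℤ) : toEE (ofEE.{u} n) = n := rfl

@[simp] lemma toEE_H (n : Znil.{u}.e) : toEE (Znil.H n) = choose2 (toE n) := rfl

@[simp] lemma P_eq_zero (n : Znil.{u}.ee) : Znil.P n = 0 := rfl

@[simp] lemma toEE_cross (m n : Znil.{u}.e) :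
    toEE (crossEffect Znil.H m n) = toE m * toE n :=
  choose2_cross (toE m) (toE n)

@[simp] lemma toEE_T (n : Znil.{u}.ee) : toEE (Znil.T n) = -toEE n := by
  simp [T_apply, H_zero]

@[simp] lemma toEE_Δ (n : Znil.{u}.e) : toEE (Znil.Δ (Znil.bar n)) = toE n := by
  have := two_choose2 (toE n)
  simp only [Δ_eq, map_add, map_sub, toEE_cross, toEE_T, toEE_H]
  linarith

lemma generates : Generates Znil.{u} {ofE 1} {ofEE 1} where
  e := by
    refine eq_top_iff.2 fun n _ => ?_
    have : n = toE n • ofE 1 := toE_inj (by simp)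
    rw [this]
    exact zsmul_mem (AddSubgroup.subset_closure (.inl (Set.mem_singleton _))) _
  ee := by
    refine eq_top_iff.2 fun n _ => ?_
    have : n = toEE n • ofEE 1 := toEE_inj (by simp)
    rw [this]
    exact zsmul_mem (AddSubgroup.subset_closure (Set.mem_singleton _)) _

lemma H_one : Znil.{u}.H (ofE 1) = 0 := toEE_inj (by simp [choose2_one])

lemma cross_one : crossEffect Znil.{u}.H (ofE 1) (ofE 1) = ofEE 1 := toEE_inj (by simp)

lemma Δ_ofE (n : ℤ) : Znil.{u}.Δ (Znil.bar (ofE n)) = ofEE n := toEE_inj (by simp)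

end Znil

/-- The map `n y + (n choose 2) P H y`. -/
def znilAct (M : SquareGroup.{u}) (n : ℤ) (y : M.e) : M.e := n • y + choose2 n • M.P (M.H y)

section

variable (M : SquareGroup.{u})

lemma znilAct_eq (n : ℤ) (y : M.e) : M.znilAct n y = n • y + M.P (choose2 n • M.H y) := by
  rw [znilAct, map_zsmul]

/-- The correction `P H` is what makes `y ↦ n y + (n choose 2) P H y` additive: the cross-effect of
`H` cancels the commutator in `n (y + y')`. -/
lemma znilAct_add (n : ℤ) (y y' : M.e) :
    M.znilAct n (y + y') = M.znilAct n y + M.znilAct n y' := by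
  rw [znilAct_eq, znilAct_eq, znilAct_eq, zsmul_add_eq, H_add, P_zsmul_cross_swap]
  simp only [← add_assoc, smul_add]
  rw [M.add_P_add _ (n • y'), add_P_add_P, add_P_add_P]
  congr 2
  abel

lemma add_znilAct (m n : ℤ) (y : M.e) :
    M.znilAct (m + n) y = M.znilAct m y + M.znilAct n y + M.P ((m * n) • M.H y) := by
  rw [znilAct_eq, znilAct_eq, znilAct_eq, add_zsmul, choose2_add, add_zsmul, add_zsmul]
  simp only [← add_assoc]
  rw [M.add_P_add _ (n • y), add_P_add_P, add_P_add_P, add_assoc (choose2 m • _)]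

/-- By `PHP = 2 P` the coefficient is `n + 2 (n choose 2) = n²`. -/
lemma znilAct_P (n : ℤ) (b : M.ee) : M.znilAct n (M.P b) = M.P ((n * n) • b) := by
  rw [znilAct, M.PHP, ← natCast_zsmul, smul_smul, ← add_zsmul, map_zsmul]
  congr 1
  have := two_choose2 n
  push_cast; linarith

/-- This is the value of `H` on `n ⊛ y` carried over to `M`, where `(n|n)_H = n²` and `H n = n
choose 2`. -/
lemma H_znilAct (n : ℤ) (y : M.e) :
    M.H (M.znilAct n y) = (n * n) • M.H y + choose2 n • M.Δ (M.bar y) := by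
  have : n * n = n + 2 * choose2 n := by rw [two_choose2]; ring
  rw [znilAct_eq, H_add_P, H_zsmul, H_P, map_zsmul, Δ_eq, this, smul_add, smul_sub, add_zsmul,
    two_mul, add_zsmul]
  abel

lemma cross_znilAct (m n : ℤ) (y y' : M.e) :
    crossEffect M.H (M.znilAct m y) (M.znilAct n y') = (m * n) • crossEffect M.H y y' := by
  rw [znilAct_eq, znilAct_eq, cross_add_P_left, cross_add_P_right, cross_zsmul_left,
    cross_zsmul_right, smul_smul]

end

end SquareGroup

namespace SquareGroup

/-! ### The unit isomorphisms of both products. -/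

section Unitors

variable (M : SquareGroup.{u})

lemma znilAct_one (y : M.e) : M.znilAct 1 y = y := by
  simp [znilAct, choose2_one]

lemma znilAct_zero (y : M.e) : M.znilAct 0 y = 0 := by
  simp [znilAct, choose2_zero]

/-- The inverse is `y ↦ 1 ⊛ y`, `b ↦ 1 ⊗ b`. It respects `H` and `P` since `H 1 = 0` and `(1|1)_H =
1`. -/
lemma exists_tensor_lunit : ∃ e : tensor Znil M ≅ M,
    (∀ n y, e.hom.e (otimes n y) = M.znilAct (Znil.toE n) y) ∧
      ∀ n b, e.hom.ee (tmul n b) = Znil.toEE n • b := by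
  obtain ⟨F, hF, hF'⟩ := tensor_exists_hom (M := Znil) (N := M) (L := M)
    (biadd (fun n b => Znil.toEE n • b) (by simp [add_zsmul]) (by simp))
    (fun n y => M.znilAct (Znil.toE n) y) (fun n => M.znilAct_add _)
    (fun m n y => by rw [map_add, add_znilAct]; simp [mul_comm])
    (fun n b => by simp [znilAct_P])
    (fun n y => by simp [znilAct_zero, P_Δ])
    (fun n b => by simp)
    (fun n y => by simp [H_znilAct])
    (fun m n y y' => by simp [cross_znilAct])
  let G : M ⟶ tensor Znil M :=
    { e := AddMonoidHom.mk' (otimes (Znil.ofE 1)) (otimes_add _)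
      ee := tmulHom Znil M (Znil.ofEE 1)
      map_H := fun y => by
        change _ = (tensor Znil M).H (otimes (Znil.ofE 1) y)
        rw [tensor_H_otimes, Znil.cross_one, Znil.H_one, zero_tmul, add_zero]; rfl
      map_P := fun b => by
        change otimes (Znil.ofE 1) (M.P b) = _
        rw [otimes_P, Znil.cross_one]; rfl }
  refine ⟨⟨F, G, (Znil.generates.tensor (Generates.univ M)).hom_ext ?_ ?_,
    (Generates.univ M).hom_ext ?_ ?_⟩, hF, hF'⟩
  · rintro _ ⟨_, rfl, y, _, rfl⟩
    change otimes (Znil.ofE 1) (F.e _) = otimes (Znil.ofE 1) y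
    rw [hF, Znil.toE_ofE, znilAct_one]
  · rintro _ ⟨_, rfl, y, _, rfl⟩
    change tmul (Znil.ofEE 1) (F.ee _) = tmul (Znil.ofEE 1) y
    rw [hF']; simp
  · intro y _
    change F.e (otimes (Znil.ofE 1) y) = y
    rw [hF, Znil.toE_ofE, znilAct_one]
  · intro y _
    change F.ee (tmul (Znil.ofEE 1) y) = y
    rw [hF']; simp

/-- The inverse is `x ↦ x ⊛ 1`, `a ↦ a ⊗ 1`. It is additive because `H 1 = 0`, and respects `H` and
`P` because moreover `Δ 1 = 1`. -/
lemma exists_tensor_runit : ∃ e : tensor M Znil ≅ M,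
    (∀ x n, e.hom.e (otimes x n) = Znil.toE n • x) ∧
      ∀ a n, e.hom.ee (tmul a n) = Znil.toEE n • a := by
  obtain ⟨F, hF, hF'⟩ := tensor_exists_hom (M := M) (N := Znil) (L := M)
    (biadd (fun a n => Znil.toEE n • a) (by simp) (by simp [add_zsmul]))
    (fun x n => Znil.toE n • x) (fun x m n => by rw [map_add, add_zsmul])
    (fun x x' n => by simp [zsmul_add_eq])
    (fun x n => by simp [P_cross])
    (fun a n => by simp)
    (fun a n => by simp)
    (fun x n => by simp [H_zsmul, add_comm])
    (fun x x' m n => by simp [cross_zsmul_left, cross_zsmul_right, smul_smul, mul_comm])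
  let G : M ⟶ tensor M Znil :=
    { e := AddMonoidHom.mk' (fun x => otimes x (Znil.ofE 1)) (fun x x' => by
        rw [add_otimes, Znil.H_one, tmul_zero, map_zero, add_zero])
      ee := (tmulHom M Znil).flip (Znil.ofEE 1)
      map_H := fun x => by
        change _ = (tensor M Znil).H (otimes x (Znil.ofE 1))
        rw [tensor_H_otimes, Znil.Δ_ofE, Znil.H_one, tmul_zero, zero_add]; rfl
      map_P := fun a => by
        change otimes (M.P a) (Znil.ofE 1) = _
        rw [P_otimes, Znil.Δ_ofE]; rfl }
  refine ⟨⟨F, G, ((Generates.univ M).tensor Znil.generates).hom_ext ?_ ?_,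
    (Generates.univ M).hom_ext ?_ ?_⟩, hF, hF'⟩
  · rintro _ ⟨x, _, _, rfl, rfl⟩
    change otimes (F.e _) (Znil.ofE 1) = otimes x (Znil.ofE 1)
    rw [hF]; simp
  · rintro _ ⟨x, _, _, rfl, rfl⟩
    change tmul (F.ee _) (Znil.ofEE 1) = tmul x (Znil.ofEE 1)
    rw [hF']; simp
  · intro y _
    change F.e (otimes y (Znil.ofE 1)) = y
    rw [hF]; simp
  · intro y _
    change F.ee (tmul y (Znil.ofEE 1)) = y
    rw [hF']; simp

/-- The inverse is `y ↦ 1 ⊗ y`, `b ↦ 1̄ ⊗ 1̄ ⊗ b`. -/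
lemma exists_box_lunit : ∃ e : box Znil M ≅ M,
    (∀ n y, e.hom.e (boxO n y) = M.znilAct (Znil.toE n) y) ∧
    (∀ n y, e.hom.ee (boxInl n y) = Znil.toEE n • M.Δ (M.bar y)) ∧
      ∀ m n b, e.hom.ee (boxInr m n b) = (Znil.toE m * Znil.toE n) • b := by
  obtain ⟨F, hF, hl, hr⟩ := box_exists_hom (M := Znil) (N := M) (L := M)
    (biadd (fun n y => Znil.toEE n • M.Δ (M.bar y)) (by simp [add_zsmul]) (by simp))
    (triadd (fun m n b => (Znil.toE m * Znil.toE n) • b)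
      (by simp [add_mul, add_zsmul]) (by simp [mul_add, add_zsmul]) (by simp))
    (fun n y => M.znilAct (Znil.toE n) y)
    (by simp [bar_P]) (by simp) (by simp) (by simp [mul_comm])
    (fun n => M.znilAct_add _)
    (fun m n y => by rw [map_add, add_znilAct]; simp)
    (fun n b => by simp [znilAct_P])
    (fun n y => by simp [znilAct_zero, P_Δ])
    (by simp [T_Δ])
    (by simp [mul_comm])
    (fun n y => by simp [H_znilAct, add_comm])
    (fun m n y y' => by simp [cross_znilAct, mul_comm])
  let G : M ⟶ box Znil M :=
    { e := AddMonoidHom.mk' (boxO (Znil.ofE 1)) (boxO_add _)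
      ee := boxInrHom Znil M (Znil.ofE 1) (Znil.ofE 1)
      map_H := fun y => by
        change _ = (box Znil M).H (boxO (Znil.ofE 1) y)
        rw [box_H_o, Znil.H_one, zero_boxInl, zero_add]; rfl
      map_P := fun b => boxO_P _ b }
  refine ⟨⟨F, G, (Znil.generates.box (Generates.univ M)).hom_ext ?_ ?_,
    (Generates.univ M).hom_ext ?_ ?_⟩, hF, hl, hr⟩
  · rintro _ ⟨_, rfl, y, _, rfl⟩
    change boxO (Znil.ofE 1) (F.e _) = boxO (Znil.ofE 1) y
    rw [hF, Znil.toE_ofE, znilAct_one]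
  · rintro _ (⟨_, rfl, y, _, rfl⟩ | ⟨_, rfl, _, rfl, b, _, rfl⟩)
    -- The summand `ℤ ⊗ Coker P` is absorbed by the defining relation `(1|1)_H ⊗ ȳ = 1̄ ⊗ 1̄ ⊗ Δ ȳ`.
    · change boxInr (Znil.ofE 1) (Znil.ofE 1) (F.ee _) = boxInl (Znil.ofEE 1) y
      rw [hl, biadd_apply, Znil.toEE_ofEE, one_zsmul, ← boxInl_cross, Znil.cross_one]
    · change boxInr (Znil.ofE 1) (Znil.ofE 1) (F.ee _) = boxInr (Znil.ofE 1) (Znil.ofE 1) b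
      rw [hr]; simp
  · intro y _
    change F.e (boxO (Znil.ofE 1) y) = y
    rw [hF, Znil.toE_ofE, znilAct_one]
  · intro y _
    change F.ee (boxInr (Znil.ofE 1) (Znil.ofE 1) y) = y
    rw [hr]; simp

/-- The inverse is `x ↦ x ⊗ 1`, `a ↦ a ⊗ 1̄`. -/
lemma exists_box_runit : ∃ e : box M Znil ≅ M,
    (∀ x n, e.hom.e (boxO x n) = Znil.toE n • x) ∧
    (∀ a n, e.hom.ee (boxInl a n) = Znil.toE n • a) ∧
      ∀ x y n, e.hom.ee (boxInr x y n) = Znil.toEE n • crossEffect M.H y x := by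
  obtain ⟨F, hF, hl, hr⟩ := box_exists_hom (M := M) (N := Znil) (L := M)
    (biadd (fun a n => Znil.toE n • a) (by simp) (by simp [add_zsmul]))
    (triadd (fun x y n => Znil.toEE n • crossEffect M.H y x)
      (by simp [cross_add_right]) (by simp [cross_add_left]) (by simp [add_zsmul]))
    (fun x n => Znil.toE n • x)
    (by simp) (by simp [cross_P_right]) (by simp [cross_P_left]) (by simp)
    (fun x m n => by rw [map_add, add_zsmul])
    (fun x x' n => by simp [zsmul_add_eq])
    (fun x n => by simp [P_cross])
    (fun a n => by simp)
    (by simp)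
    (by simp [T_cross])
    (fun x n => by simp [H_zsmul])
    (fun x x' m n => by simp [cross_zsmul_left, cross_zsmul_right, smul_smul, mul_comm])
  let G : M ⟶ box M Znil :=
    { e := AddMonoidHom.mk' (fun x => boxO x (Znil.ofE 1)) (fun x x' => by
        rw [add_boxO, Znil.H_one, boxInr_zero, map_zero, add_zero])
      ee := (boxInlHom M Znil).flip (Znil.ofE 1)
      map_H := fun x => by
        change _ = (box M Znil).H (boxO x (Znil.ofE 1))
        rw [box_H_o, Znil.H_one, boxInr_zero, add_zero]; rfl
      map_P := fun a => P_boxO _ _ }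
  refine ⟨⟨F, G, ((Generates.univ M).box Znil.generates).hom_ext ?_ ?_,
    (Generates.univ M).hom_ext ?_ ?_⟩, hF, hl, hr⟩
  · rintro _ ⟨x, _, _, rfl, rfl⟩
    change boxO (F.e _) (Znil.ofE 1) = boxO x (Znil.ofE 1)
    rw [hF]; simp
  · rintro _ (⟨a, _, _, rfl, rfl⟩ | ⟨x, _, y, _, _, rfl, rfl⟩)
    · change boxInl (F.ee _) (Znil.ofE 1) = boxInl a (Znil.ofE 1)
      rw [hl]; simp
    -- Here `Δ 1 = 1` lets the defining relation rewrite `(y|x)_H ⊗ 1̄` as `x̄ ⊗ ȳ ⊗ 1`.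
    · change boxInl (F.ee _) (Znil.ofE 1) = boxInr x y (Znil.ofEE 1)
      rw [hr, triadd_apply, Znil.toEE_ofEE, one_zsmul, boxInl_cross, Znil.Δ_ofE]
  · intro y _
    change F.e (boxO y (Znil.ofE 1)) = y
    rw [hF]; simp
  · intro y _
    change F.ee (boxInl y (Znil.ofE 1)) = y
    rw [hl]; simp

end Unitors

end SquareGroup

namespace SquareGroup

/-- Used to show that a sum of two maps, each additive up to a defect, is again of this kind; the
interchange adds a cross-effect to the defect. -/
lemma add_add_add_swap (L : SquareGroup.{u}) (p q r s : L.e) :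
    (p + q) + (r + s) = (p + r) + (q + s) + L.P (crossEffect L.H q r) := by
  have h : (p + q) + (r + s) = p + (q + r) + s := by simp only [add_assoc]
  rw [h, L.add_swap q r, ← add_assoc, add_P_add]
  simp only [add_assoc]

lemma add_P_add_add_P (L : SquareGroup.{u}) (p q : L.e) (a b : L.ee) :
    (p + L.P a) + (q + L.P b) = p + q + L.P (a + b) := by
  rw [← add_assoc, add_P_add, add_P_add_P]

/-- A cross-effect of `H` is determined by its values on generators. -/
lemma cross_eq_of_generates {A A' L : SquareGroup.{u}} {S : Set A.e} {S' : Set A'.e}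
    (hS : AddSubgroup.closure (S ∪ Set.range A.P) = ⊤)
    (hS' : AddSubgroup.closure (S' ∪ Set.range A'.P) = ⊤) {f : A.e → L.e} {f' : A'.e → L.e}
    (hf : ∀ u v, ∃ a, f (u + v) = f u + f v + L.P a) (hf' : ∀ u v, ∃ a, f' (u + v) = f' u + f' v + L.P a)
    (hP : ∀ a, ∃ b, f (A.P a) = L.P b) (hP' : ∀ a, ∃ b, f' (A'.P a) = L.P b)
    (g : A.e →+ A'.e →+ L.ee) (gl : ∀ a v, g (A.P a) v = 0) (gr : ∀ u a, g u (A'.P a) = 0)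
    (h : ∀ s ∈ S, ∀ t ∈ S', crossEffect L.H (f s) (f' t) = g s t) (u : A.e) (v : A'.e) :
    crossEffect L.H (f u) (f' v) = g u v := by
  refine biadd_ext hS hS' (f := biadd (fun u v => crossEffect L.H (f u) (f' v)) ?_ ?_) (g := g)
    ?_ u v
  · intro u u' v
    obtain ⟨a, ha⟩ := hf u u'
    rw [ha, cross_add_P_left, cross_add_left]
  · intro u v v'
    obtain ⟨a, ha⟩ := hf' v v'
    rw [ha, cross_add_P_right, cross_add_right]
  · rintro x (hx | ⟨a, rfl⟩) y (hy | ⟨b, rfl⟩)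
    · exact h x hx y hy
    · obtain ⟨b', hb⟩ := hP' b
      simp [hb, cross_P_right, gr]
    · obtain ⟨a', ha⟩ := hP a
      simp [ha, cross_P_left, gl]
    · obtain ⟨b', hb⟩ := hP' b
      simp [hb, cross_P_right, gr]

/-! ### The associativity isomorphism of `⊛`. -/

section TensorAssoc

variable (M N K : SquareGroup.{u})

lemma otimes_add_P {M N : SquareGroup.{u}} (u : M.e) (w : M.ee) (z : N.e) :
    otimes (u + M.P w) z = otimes u z + (tensor M N).P (tmul w (N.Δ (N.bar z))) := by
  rw [add_otimes, P_otimes, cross_P_left, zero_tmul, map_zero, add_zero]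

lemma tensor_e_closure_univ : AddSubgroup.closure
    (Set.image2 otimes Set.univ Set.univ ∪ Set.range (tensor M N).P) = ⊤ :=
  ((Generates.univ M).tensor (Generates.univ N)).e

lemma tensor_ee_closure_univ : AddSubgroup.closure
    (Set.image2 tmul Set.univ Set.univ : Set (tensor M N).ee) = ⊤ :=
  ((Generates.univ M).tensor (Generates.univ N)).ee

/-- The easier direction: for fixed `x` the map `v ↦ x ⊛ v` is additive, so a family of honest
homomorphisms `f x` is built on `(N ⊛ K).e`. The hypotheses of `tensor_exists_hom` are then checked
for `v` on generators. -/
lemma exists_tensor_assoc_inv : ∃ F : tensor M (tensor N K) ⟶ tensor (tensor M N) K,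
    (∀ x y z, F.e (otimes x (otimes y z)) = otimes (otimes x y) z) ∧
      ∀ a b c, F.ee (tmul a (tmul b c)) = tmul (tmul a b) c := by
  let G : M.ee →+ (tensor N K).ee →+ (tensor (tensor M N) K).ee := (tensorLift (triadd
    (fun b c a => (tmul (tmul a b) c : (tensor (tensor M N) K).ee)) (by simp [tmul_add, add_tmul])
      (by simp [tmul_add]) (by simp [add_tmul]))).flip
  have hG : ∀ a b c, G a (tmul b c) = tmul (tmul a b) c := by simp [G]
  have hT : ∀ a w, (tensor (tensor M N) K).T (G a w) = - G (M.T a) ((tensor N K).T w) := by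
    intro a w
    refine DFunLike.congr_fun (f := (tensor (tensor M N) K).T.comp (G a)) (g := -((G (M.T a)).comp (tensor N K).T))
      (AddMonoidHom.eq_of_eqOn_dense (tensor_ee_closure_univ N K) ?_) w
    rintro _ ⟨b, _, c, _, rfl⟩
    simp [hG, T_tmul, neg_tmul]
  -- Applying `P` to `hT` removes the outer `T`; every cancellation below rests on this sign.
  have hPT : ∀ a w, (tensor (tensor M N) K).P (G (M.T a) ((tensor N K).T w)) = - (tensor (tensor M N) K).P (G a w) := by
    intro a w
    rw [← neg_eq_iff_eq_neg, ← map_neg, ← hT, P_T]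
  have h1 : ∀ x, ∃ f : (tensor N K).e → (tensor (tensor M N) K).e, (∀ y z, f (otimes y z) = otimes (otimes x y) z) ∧
      (∀ w, f ((tensor N K).P w) = (tensor (tensor M N) K).P (G (crossEffect M.H x x) w)) ∧
      ∀ u v, f (u + v) = f u + f v + (tensor (tensor M N) K).P ((0 : _ →+ _ →+ (tensor (tensor M N) K).ee) u v) := by
    intro x
    refine tensor_exists_twisted _ (by simp) (by simp) _ _ ?_ ?_ ?_ ?_ ?_
    · intro y z z'; simp [otimes_add]
    · intro y y' z; simp [otimes_add, add_otimes, tensor_cross, hG]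
    · intro y b; simp [otimes_P, tensor_cross, hG]
    · intro b z; simp [otimes_P, P_otimes, hG]
    · intro b c
      have h := hPT (crossEffect M.H x x) (tmul b c)
      rwa [T_cross, T_tmul, map_neg, map_neg G, AddMonoidHom.neg_apply, neg_neg] at h
  choose f hf hP hadd using h1
  replace hadd : ∀ x u v, f x (u + v) = f x u + f x v := by simpa using hadd
  have hc : ∀ x x' v v', crossEffect (tensor (tensor M N) K).H (f x v) (f x' v') =
      G (crossEffect M.H x x') (crossEffect (tensor N K).H v v') := by
    intro x x' v v'
    refine cross_eq_of_generates (tensor_e_closure_univ N K) (tensor_e_closure_univ N K)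
      (fun u v => ⟨0, by simp [hadd]⟩) (fun u v => ⟨0, by simp [hadd]⟩)
      (fun a => ⟨_, hP x a⟩) (fun a => ⟨_, hP x' a⟩)
      (biadd (fun v v' => G (crossEffect M.H x x') (crossEffect (tensor N K).H v v'))
        (by simp [cross_add_left]) (by simp [cross_add_right])) (by simp [cross_P_left])
      (by simp [cross_P_right]) ?_ v v'
    rintro _ ⟨y, _, z, _, rfl⟩ _ ⟨y', _, z', _, rfl⟩
    simp [hf, tensor_cross, hG]
  have add_f : ∀ x x' v, f (x + x') v = f x v + f x' v +
      (tensor (tensor M N) K).P (G (crossEffect M.H x' x) ((tensor N K).H v)) := by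
    intro x x' v
    refine eq_of_add_eq (tensor_e_closure_univ N K) (fun _ _ => 0) (f := f (x + x'))
      (g := fun v => f x v + f x' v + (tensor (tensor M N) K).P (G (crossEffect M.H x' x) ((tensor N K).H v)))
      (fun u v => by rw [hadd, add_zero]) (fun u v => ?_) ?_ v
    -- Additivity of the right-hand side in `v`: exchanging `f x v` and `f x' u` costs `P G((x|x'),
    -- (v|u))`, and the cross-effect of `H` contributes `P G((x'|x), (u|v))`. These are opposite.
    · have h := hPT (crossEffect M.H x x') (crossEffect (tensor N K).H v u)
      rw [T_cross, T_cross, map_neg, map_neg G, AddMonoidHom.neg_apply,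
        neg_neg] at h
      have h3 : ∀ c a b d : (tensor (tensor M N) K).ee, c + (a + b + d) = a + b + (d + c) := by
        intros; abel
      rw [hadd, hadd, add_zero, add_add_add_swap, hc, H_add, (G _).map_add, (G _).map_add,
        add_P_add_P, add_P_add_add_P, h3, map_add, map_add _ _ (G _ (crossEffect _ v u)), h,
        neg_add_cancel, add_zero]
    · rintro _ (⟨y, _, z, _, rfl⟩ | ⟨w, rfl⟩)
      · simp only [hf, tensor_H_otimes, (G _).map_add, hG]
        rw [add_otimes, otimes_add_P, add_otimes, tensor_cross, add_P_add_P]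
      -- On `P w` the correction is evaluated at `H P w = w + T w`; its two parts give the two mixed
      -- terms of `(x + x'|x + x')_H`.
      · have h := hPT (crossEffect M.H x x') w
        rw [T_cross, map_neg, AddMonoidHom.neg_apply, map_neg, neg_inj] at h
        have h2 : G (crossEffect M.H (x + x') (x + x')) w = G (crossEffect M.H x x) w +
            G (crossEffect M.H x' x') w + (G (crossEffect M.H x' x) w +
            G (crossEffect M.H x x') w) := by
          simp only [cross_add_left, cross_add_right, map_add, AddMonoidHom.add_apply]; abel
        simp only [hP, H_P]
        rw [h2, map_add, map_add, map_add (tensor (tensor M N) K).P (G _ w), ← h, map_add, map_add]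
  have P_f : ∀ a v, f (M.P a) v =
      (tensor (tensor M N) K).P (G a ((tensor N K).Δ ((tensor N K).bar v))) := by
    intro a v
    refine eq_of_add_eq (tensor_e_closure_univ N K) (fun _ _ => 0) (f := f (M.P a))
      (g := fun v => (tensor (tensor M N) K).P (G a ((tensor N K).Δ ((tensor N K).bar v))))
      (fun u v => by rw [hadd, add_zero]) (fun u v => by simp) ?_ v
    rintro _ (⟨y, _, z, _, rfl⟩ | ⟨w, rfl⟩)
    · simp [hf, Δ_otimes, P_otimes, hG]
    · simp [hP, cross_P_left, Δ_P]
  have hH : ∀ x v, (tensor (tensor M N) K).H (f x v) = G (crossEffect M.H x x) ((tensor N K).H v) +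
      G (M.H x) ((tensor N K).Δ ((tensor N K).bar v)) := by
    intro x v
    refine eq_of_add_eq (tensor_e_closure_univ N K)
      (fun u v => G (crossEffect M.H x x) (crossEffect (tensor N K).H u v))
      (f := fun v => (tensor (tensor M N) K).H (f x v)) (g := fun v => G (crossEffect M.H x x) ((tensor N K).H v) +
        G (M.H x) ((tensor N K).Δ ((tensor N K).bar v)))
      (fun u v => by rw [hadd, H_add, hc]) (fun u v => by simp [H_add]; abel) ?_ v
    rintro _ (⟨y, _, z, _, rfl⟩ | ⟨w, rfl⟩)
    · simp only [hf, tensor_H_otimes, tensor_cross, hG, Δ_otimes, map_add, add_tmul]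
      abel
    · simp [hP, Δ_P, H_P, hT, T_cross]
  obtain ⟨F, hF, hF'⟩ := tensor_exists_hom G f hadd add_f hP P_f hT hH hc
  exact ⟨F, fun x y z => by rw [hF, hf], fun a b c => by rw [hF', hG]⟩

/-- Now `u ↦ u ⊛ z` has defect `P((v|u)_H ⊗ H z)`, so `f z` is built as a twisted map with the
corresponding cocycle. Each identity in `u` is proved by matching defects and comparing generators.
-/
lemma exists_tensor_assoc_hom : ∃ F : tensor (tensor M N) K ⟶ tensor M (tensor N K),
    (∀ x y z, F.e (otimes (otimes x y) z) = otimes x (otimes y z)) ∧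
      ∀ a b c, F.ee (tmul (tmul a b) c) = tmul a (tmul b c) := by
  let G : (tensor M N).ee →+ K.ee →+ (tensor M (tensor N K)).ee := tensorLift (triadd
    (fun a b c => (tmul a (tmul b c) : (tensor M (tensor N K)).ee)) (by simp [add_tmul])
      (by simp [tmul_add, add_tmul]) (by simp [tmul_add]))
  have hG : ∀ a b c, G (tmul a b) c = tmul a (tmul b c) := by simp [G]
  have hT : ∀ w c, (tensor M (tensor N K)).T (G w c) = - G ((tensor M N).T w) (K.T c) := by
    intro w c
    refine DFunLike.congr_fun (f := (tensor M (tensor N K)).T.comp (G.flip c))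
      (g := -((G.flip (K.T c)).comp (tensor M N).T))
      (AddMonoidHom.eq_of_eqOn_dense (tensor_ee_closure_univ M N) ?_) w
    rintro _ ⟨a, _, b, _, rfl⟩
    simp [hG, T_tmul, tmul_neg]
  have hPT : ∀ w c, (tensor M (tensor N K)).P (G ((tensor M N).T w) (K.T c)) = - (tensor M (tensor N K)).P (G w c) := by
    intro w c
    rw [← neg_eq_iff_eq_neg, ← map_neg, ← hT, P_T]
  have hl : ∀ z u u' v, G (crossEffect (tensor M N).H v (u + u')) z =
      G (crossEffect (tensor M N).H v u) z + G (crossEffect (tensor M N).H v u') z := by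
    simp [cross_add_right]
  have hr : ∀ z u v v', G (crossEffect (tensor M N).H (v + v') u) z =
      G (crossEffect (tensor M N).H v u) z + G (crossEffect (tensor M N).H v' u) z := by
    simp [cross_add_left]
  have h1 : ∀ z, ∃ f : (tensor M N).e → (tensor M (tensor N K)).e, (∀ x y, f (otimes x y) = otimes x (otimes y z)) ∧
      (∀ w, f ((tensor M N).P w) = (tensor M (tensor N K)).P (G.flip (K.Δ (K.bar z)) w)) ∧
      ∀ u v, f (u + v) = f u + f v + (tensor M (tensor N K)).P (biadd
        (fun u v => G (crossEffect (tensor M N).H v u) (K.H z)) (hl _) (fun u => hr _ u) u v) := by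
    intro z
    refine tensor_exists_twisted _ (by simp [cross_P_right]) (by simp [cross_P_left]) _ _ ?_ ?_ ?_
      ?_ ?_
    · intro x y y'; simp [otimes_add, add_otimes, otimes_P, tensor_cross, hG]
    · intro x x' y
      simp only [add_otimes, tensor_cross, biadd_apply, hG, AddMonoidHom.flip_apply,
        tensor_H_otimes, tmul_add, map_add, add_assoc]
    · intro x b; simp [otimes_P, P_otimes, hG]
    · intro a y; simp [P_otimes, Δ_otimes, hG]
    · intro a b
      have h := hPT (tmul a b) (K.Δ (K.bar z))
      simpa [T_tmul, T_Δ] using h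
  choose f hf hP hadd using h1
  simp only [biadd_apply, AddMonoidHom.flip_apply] at hP hadd
  have hc : ∀ u u' z z', crossEffect (tensor M (tensor N K)).H (f z u) (f z' u') =
      G (crossEffect (tensor M N).H u u') (crossEffect K.H z z') := by
    intro u u' z z'
    refine cross_eq_of_generates (tensor_e_closure_univ M N) (tensor_e_closure_univ M N)
      (fun u v => ⟨_, hadd z u v⟩) (fun u v => ⟨_, hadd z' u v⟩)
      (fun a => ⟨_, hP z a⟩) (fun a => ⟨_, hP z' a⟩)
      (biadd (fun u u' => G (crossEffect (tensor M N).H u u') (crossEffect K.H z z'))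
        (by simp [cross_add_left]) (by simp [cross_add_right])) (by simp [cross_P_left])
      (by simp [cross_P_right]) ?_ u u'
    rintro _ ⟨x, _, y, _, rfl⟩ _ ⟨x', _, y', _, rfl⟩
    simp [hf, tensor_cross, hG]
  have f_add : ∀ u z z', f (z + z') u = f z u + f z' u := by
    intro u z z'
    refine eq_of_add_eq (tensor_e_closure_univ M N)
      (fun u v => (tensor M (tensor N K)).P (G (crossEffect (tensor M N).H v u) (K.H (z + z'))))
      (f := f (z + z')) (g := fun u => f z u + f z' u) (hadd _) (fun u v => ?_) ?_ u
    -- The interchange commutator supplies the `(z|z')_H` part of `H(z + z')` in the required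
    -- defect.
    · rw [hadd, hadd, add_P_add_add_P, add_add_add_swap, hc, H_add, (G _).map_add,
        (G _).map_add, add_P_add_P, add_comm (G _ (crossEffect _ _ _))]
    · rintro _ (⟨x, _, y, _, rfl⟩ | ⟨w, rfl⟩)
      · simp [hf, otimes_add]
      · simp [hP]
  have f_P : ∀ u c, f (K.P c) u = (tensor M (tensor N K)).P (G (crossEffect (tensor M N).H u u) c) := by
    intro u c
    refine eq_of_add_eq (tensor_e_closure_univ M N)
      (fun u v => (tensor M (tensor N K)).P (G (crossEffect (tensor M N).H v u) (K.H (K.P c))))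
      (f := f (K.P c)) (g := fun u => (tensor M (tensor N K)).P (G (crossEffect (tensor M N).H u u) c)) (hadd _)
      (fun u v => ?_) ?_ u
    -- The mixed terms `(v|u)` and `(u|v)` paired with `c` become, under `P`, `(v|u)` paired with `c
    -- + T c = H P c`, the required defect.
    · have h := hPT (crossEffect (tensor M N).H u v) c
      rw [T_cross, map_neg, AddMonoidHom.neg_apply, map_neg, neg_inj] at h
      have h2 : G (crossEffect (tensor M N).H (u + v) (u + v)) c =
          G (crossEffect (tensor M N).H u u) c + G (crossEffect (tensor M N).H v v) c +
          (G (crossEffect (tensor M N).H v u) c + G (crossEffect (tensor M N).H u v) c) := by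
        simp only [cross_add_left, cross_add_right, map_add, AddMonoidHom.add_apply]; abel
      rw [h2, map_add, map_add, map_add (tensor M (tensor N K)).P (G _ c), ← h, H_P, map_add, map_add]
    · rintro _ (⟨x, _, y, _, rfl⟩ | ⟨w, rfl⟩)
      · simp [hf, otimes_P, tensor_cross, hG]
      · simp [hP, Δ_P, cross_P_left]
  have hH : ∀ u z, (tensor M (tensor N K)).H (f z u) = G (crossEffect (tensor M N).H u u) (K.H z) +
      G ((tensor M N).H u) (K.Δ (K.bar z)) := by
    intro u z
    refine eq_of_add_eq (tensor_e_closure_univ M N)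
      (fun u v => G (crossEffect (tensor M N).H u v) (crossEffect K.H z z) +
        (tensor M (tensor N K)).H ((tensor M (tensor N K)).P (G (crossEffect (tensor M N).H v u) (K.H z))))
      (f := fun u => (tensor M (tensor N K)).H (f z u)) (g := fun u => G (crossEffect (tensor M N).H u u) (K.H z) +
        G ((tensor M N).H u) (K.Δ (K.bar z))) (fun u v => ?_) (fun u v => ?_) ?_ u
    · rw [hadd, H_add_P, H_add, hc, add_assoc]
    -- The defects match after expanding `Δ z = (z|z) - H z + T H z`.
    · rw [H_P, hT, T_cross, Δ_eq, H_add]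
      simp only [cross_add_left, cross_add_right, map_add, map_neg, map_sub,
        AddMonoidHom.add_apply, AddMonoidHom.neg_apply]
      abel
    · rintro _ (⟨x, _, y, _, rfl⟩ | ⟨w, rfl⟩)
      · simp only [hf, tensor_H_otimes, tensor_cross, hG, Δ_otimes, map_add, tmul_add,
          AddMonoidHom.add_apply]
        abel
      · simp [hP, H_P, hT, T_Δ, cross_P_left]
  obtain ⟨F, hF, hF'⟩ := tensor_exists_hom G (fun u z => f z u) f_add (fun u v z => hadd z u v) f_P
    (fun w z => hP z w) hT hH hc
  exact ⟨F, fun x y z => by rw [hF, hf], fun a b c => by rw [hF', hG]⟩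

lemma exists_tensor_assoc : ∃ α : tensor (tensor M N) K ≅ tensor M (tensor N K),
    (∀ x y z, α.hom.e (otimes (otimes x y) z) = otimes x (otimes y z)) ∧
      ∀ a b c, α.hom.ee (tmul (tmul a b) c) = tmul a (tmul b c) := by
  obtain ⟨F, hF, hF'⟩ := exists_tensor_assoc_hom M N K
  obtain ⟨G, hG, hG'⟩ := exists_tensor_assoc_inv M N K
  have hM := Generates.univ M
  have hN := Generates.univ N
  have hK := Generates.univ K
  refine ⟨⟨F, G, ((hM.tensor hN).tensor hK).hom_ext ?_ ?_,
    (hM.tensor (hN.tensor hK)).hom_ext ?_ ?_⟩, hF, hF'⟩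
  · rintro _ ⟨_, ⟨x, _, y, _, rfl⟩, z, _, rfl⟩
    rw [comp_e, hF, hG, id_e]
  · rintro _ ⟨_, ⟨x, _, y, _, rfl⟩, z, _, rfl⟩
    rw [comp_ee, hF', hG', id_ee]
  · rintro _ ⟨x, _, _, ⟨y, _, z, _, rfl⟩, rfl⟩
    rw [comp_e, hG, hF, id_e]
  · rintro _ ⟨x, _, _, ⟨y, _, z, _, rfl⟩, rfl⟩
    rw [comp_ee, hG', hF', id_ee]

end TensorAssoc

end SquareGroup

namespace SquareGroup

/-! ### The associativity isomorphism of `□`. -/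

section BoxAssoc

variable (M N K : SquareGroup.{u})

lemma boxO_add_P {M N : SquareGroup.{u}} (u : M.e) (w : M.ee) (z : N.e) :
    boxO (u + M.P w) z = boxO u z + (box M N).P (boxInl w z) := by
  rw [add_boxO, P_boxO, boxInr_P, map_zero, add_zero]

lemma box_e_closure_univ : AddSubgroup.closure
    (Set.image2 boxO Set.univ Set.univ ∪ Set.range (box M N).P) = ⊤ :=
  ((Generates.univ M).box (Generates.univ N)).e

lemma box_ee_hom_ext {M N : SquareGroup.{u}} {A : Type*} [AddCommGroup A]
    {f g : (box M N).ee →+ A} (hl : ∀ a z, f (boxInl a z) = g (boxInl a z))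
    (hr : ∀ x y c, f (boxInr x y c) = g (boxInr x y c)) (w : (box M N).ee) : f w = g w := by
  refine DFunLike.congr_fun (AddMonoidHom.eq_of_eqOn_dense
    ((Generates.univ M).box (Generates.univ N)).ee ?_) w
  rintro _ (⟨a, _, z, _, rfl⟩ | ⟨x, _, y, _, c, _, rfl⟩)
  exacts [hl a z, hr x y c]

lemma box_e_hom_ext {M N : SquareGroup.{u}} {A : Type*} [AddCommGroup A]
    {f g : (box M N).e →+ A} (h : ∀ x z, f (boxO x z) = g (boxO x z))
    (hP : ∀ w, f ((box M N).P w) = g ((box M N).P w)) (u : (box M N).e) : f u = g u := by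
  refine DFunLike.congr_fun (AddMonoidHom.eq_of_eqOn_dense (box_e_closure_univ M N) ?_) u
  rintro _ (⟨x, _, z, _, rfl⟩ | ⟨w, rfl⟩)
  exacts [h x z, hP w]

/-- As for `⊛`, the maps `f x` are homomorphisms on `(N □ K).e`. In addition the `ee`-data must be
built from both summands of each `ee`-level: `h` from its values on `y ⊗ z`, and `k` from the
universal property of `(N □ K).ee`. -/
lemma exists_box_assoc_inv : ∃ F : box M (box N K) ⟶ (box (box M N) K),
    (∀ x y z, F.e (boxO x (boxO y z)) = boxO (boxO x y) z) ∧
    (∀ a y z, F.ee (boxInl a (boxO y z)) = boxInl (boxInl a y) z) ∧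
    (∀ x x' b z, F.ee (boxInr x x' (boxInl b z)) = boxInl (boxInr x x' b) z) ∧
      ∀ x x' y y' c, F.ee (boxInr x x' (boxInr y y' c)) = boxInr (boxO x y) (boxO x' y') c := by
  let h : M.ee →+ (box N K).e →+ (box (box M N) K).ee := (boxEHom (triadd
    (fun y z a => (boxInl (boxInl a y) z : (box (box M N) K).ee)) (by simp [boxInl_add, add_boxInl])
    (by simp [boxInl_add]) (by simp [add_boxInl]))
    (fun y c => by ext a; simp [boxInl_P])).flip
  have hh : ∀ a y z, h a (boxO y z) = boxInl (boxInl a y) z := by simp [h]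
  have hhP : ∀ a w, h a ((box N K).P w) = 0 := by
    intro a w
    simp only [h, AddMonoidHom.flip_apply]
    rw [boxEHom_P]
    · rfl
    · intro b z; ext a; simp [boxInl_P, zero_boxInl]
  let k₀ : (box N K).ee →+ M.e →+ M.e →+ (box (box M N) K).ee := boxLift
    (biadd (fun b z => biadd (fun x x' => (boxInl (boxInr x x' b) z : (box (box M N) K).ee))
      (by simp [add_boxInr, add_boxInl]) (by simp [boxInr_add_mid, add_boxInl]))
      (by intros; ext; simp [boxInr_add, add_boxInl]) (by intros; ext; simp [boxInl_add]))
    (triadd (fun y y' c => biadd (fun x x' => (boxInr (boxO x y) (boxO x' y') c : (box (box M N) K).ee))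
      (by simp [add_boxO, add_boxInr, P_boxInr]) (by simp [add_boxO, boxInr_add_mid, boxInr_P]))
      (by intros; ext; simp [boxO_add, add_boxInr])
      (by intros; ext; simp [boxO_add, boxInr_add_mid])
      (by intros; ext; simp [boxInr_add]))
    (by intros; ext; simp [boxInl_P])
    (by intros; ext; simp [boxO_P, P_boxInr])
    (by intros; ext; simp [boxO_P, boxInr_P])
    -- The bracket `x̄ ⊗ x̄' ⊗ (y|y')_H` is the cross-effect of `x' ⊗ y` and `x ⊗ y'`, so the
    -- relation for `N □ K` follows from that for `(M □ N) □ K`.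
    (by intros; ext; simp [← box_cross, boxInl_cross])
  let k : M.e →+ M.e →+ (box N K).ee →+ (box (box M N) K).ee :=
    triadd (fun x x' w => k₀ w x x') (by simp) (by simp) (by simp)
  have kl : ∀ x x' b z, k x x' (boxInl b z) = boxInl (boxInr x x' b) z := by simp [k, k₀]
  have kr : ∀ x x' y y' c, k x x' (boxInr y y' c) = boxInr (boxO x y) (boxO x' y') c := by
    simp [k, k₀]
  have hTk : ∀ x x' w, (box (box M N) K).T (k x x' w) = k x' x ((box N K).T w) := by
    intro x x' w
    refine box_ee_hom_ext (f := (box (box M N) K).T.comp (k x x')) (g := (k x' x).comp (box N K).T) ?_ ?_ w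
    · intro b z; simp [kl, T_boxInl, T_boxInr]
    · intro y y' c; simp [kr, T_boxInr]
  have hPk : ∀ x x' w, (box (box M N) K).P (k x' x ((box N K).T w)) = (box (box M N) K).P (k x x' w) := by
    intro x x' w
    rw [← hTk, P_T]
  have P_k : ∀ a x w, k (M.P a) x w = 0 := by
    intro a x w
    refine box_ee_hom_ext (f := k (M.P a) x) (g := 0) ?_ ?_ w
    · intro b z; simp [kl, P_boxInr, zero_boxInl]
    · intro y y' c; simp [kr, P_boxO, P_boxInr]
  have k_P : ∀ x a w, k x (M.P a) w = 0 := by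
    intro x a w
    refine box_ee_hom_ext (f := k x (M.P a)) (g := 0) ?_ ?_ w
    · intro b z; simp [kl, boxInr_P, zero_boxInl]
    · intro y y' c; simp [kr, P_boxO, boxInr_P]
  have h1 : ∀ x, ∃ f : (box N K).e → (box (box M N) K).e, (∀ y z, f (boxO y z) = boxO (boxO x y) z) ∧
      (∀ w, f ((box N K).P w) = (box (box M N) K).P (k x x w)) ∧
      ∀ u v, f (u + v) = f u + f v + (box (box M N) K).P ((0 : _ →+ _ →+ (box (box M N) K).ee) u v) := by
    intro x
    refine box_exists_twisted _ (by simp) (by simp) _ _ ?_ ?_ ?_ ?_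
    · intro y z z'; simp [boxO_add]
    · intro y y' z; simp [boxO_add, add_boxO, kr]
    · intro y b; simp [boxO_P, kr]
    · intro b z; simp [boxO_P, P_boxO, kl]
  choose f hf hP hadd using h1
  replace hadd : ∀ x u v, f x (u + v) = f x u + f x v := by simpa using hadd
  have hc : ∀ x x' v v', crossEffect (box (box M N) K).H (f x v) (f x' v') =
      k x' x (crossEffect (box N K).H v v') := by
    intro x x' v v'
    refine cross_eq_of_generates (box_e_closure_univ N K) (box_e_closure_univ N K)
      (fun u v => ⟨0, by simp [hadd]⟩) (fun u v => ⟨0, by simp [hadd]⟩)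
      (fun a => ⟨_, hP x a⟩) (fun a => ⟨_, hP x' a⟩)
      (biadd (fun v v' => k x' x (crossEffect (box N K).H v v'))
        (by simp [cross_add_left]) (by simp [cross_add_right])) (by simp [cross_P_left])
      (by simp [cross_P_right]) ?_ v v'
    rintro _ ⟨y, _, z, _, rfl⟩ _ ⟨y', _, z', _, rfl⟩
    simp [hf, box_cross, kr]
  have add_f : ∀ x x' v, f (x + x') v = f x v + f x' v + (box (box M N) K).P (k x x' ((box N K).H v)) := by
    intro x x' v
    refine eq_of_add_eq (box_e_closure_univ N K) (fun _ _ => 0) (f := f (x + x'))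
      (g := fun v => f x v + f x' v + (box (box M N) K).P (k x x' ((box N K).H v)))
      (fun u v => by rw [hadd, add_zero]) (fun u v => ?_) ?_ v
    -- The interchange commutator cancels the cross-effect of `H`, since `P` identifies `k x' x w`
    -- with `k x x' (T w)`.
    · have h := hPk x' x (crossEffect (box N K).H v u)
      rw [T_cross, map_neg, map_neg] at h
      have h3 : ∀ c a b d : (box (box M N) K).ee, c + (a + b + d) = a + b + (d + c) := by
        intros; abel
      rw [hadd, hadd, add_zero, add_add_add_swap, hc, H_add, (k _ _).map_add, (k _ _).map_add,
        add_P_add_P, add_P_add_add_P, h3, map_add, map_add _ _ (k _ _ (crossEffect _ v u)), ← h,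
        add_neg_cancel, add_zero]
    · rintro _ (⟨y, _, z, _, rfl⟩ | ⟨w, rfl⟩)
      · simp only [hf, box_H_o, (k _ _).map_add, kl, kr]
        rw [add_boxO, boxO_add_P, add_boxO, add_P_add_P, add_comm (boxInl _ _)]
      -- The two mixed terms come from `H P w = w + T w`, as `P` turns `k x x' (T w)` into `k x' x
      -- w`.
      · have h2 : k (x + x') (x + x') w = k x x w + k x' x' w + (k x x' w + k x' x w) := by
          simp only [map_add, AddMonoidHom.add_apply]; abel
        simp only [hP, H_P]
        rw [h2, map_add, map_add, map_add (box (box M N) K).P (k _ _ _), ← hPk x' x, map_add, map_add]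
  have P_f : ∀ a v, f (M.P a) v = (box (box M N) K).P (h a v) := by
    intro a v
    refine eq_of_add_eq (box_e_closure_univ N K) (fun _ _ => 0) (f := f (M.P a))
      (g := fun v => (box (box M N) K).P (h a v))
      (fun u v => by rw [hadd, add_zero]) (fun u v => by simp) ?_ v
    rintro _ (⟨y, _, z, _, rfl⟩ | ⟨w, rfl⟩)
    · simp [hf, P_boxO, hh]
    · simp [hP, P_k, hhP]
  have hTh : ∀ a v, (box (box M N) K).T (h a v) = h (M.T a) v := by
    intro a v
    refine box_e_hom_ext (f := (box (box M N) K).T.comp (h a)) (g := h (M.T a)) ?_ ?_ v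
    · intro y z; simp [hh, T_boxInl]
    · intro w; simp [hhP]
  have hk : ∀ x x' v, h (crossEffect M.H x x') v =
      k x' x ((box N K).Δ ((box N K).bar v)) := by
    intro x x' v
    refine box_e_hom_ext (f := h (crossEffect M.H x x')) (g := (k x' x).comp (box N K).ΔHom) ?_ ?_ v
    · intro y z; simp [ΔHom, hh, kl, Δ_boxO, boxInl_cross]
    · intro w; simp [ΔHom, hhP, Δ_P]
  have hH : ∀ x v, (box (box M N) K).H (f x v) = h (M.H x) v + k x x ((box N K).H v) := by
    intro x v
    refine eq_of_add_eq (box_e_closure_univ N K)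
      (fun u v => k x x (crossEffect (box N K).H u v))
      (f := fun v => (box (box M N) K).H (f x v)) (g := fun v => h (M.H x) v + k x x ((box N K).H v))
      (fun u v => by rw [hadd, H_add, hc]) (fun u v => by simp [H_add]; abel) ?_ v
    rintro _ (⟨y, _, z, _, rfl⟩ | ⟨w, rfl⟩)
    · simp only [hf, box_H_o, hh, kl, kr, (k _ _).map_add, add_boxInl]
      abel
    · simp [hP, hhP, H_P, hTk]
  obtain ⟨F, hF, hl, hr⟩ := box_exists_hom h k f hhP P_k k_P hk hadd add_f hP P_f hTh hTk hH hc
  exact ⟨F, fun x y z => by rw [hF, hf], fun a y z => by rw [hl, hh],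
    fun x x' b z => by rw [hr, kl], fun x x' y y' c => by rw [hr, kr]⟩

/-- The defect of `u ↦ u ⊗ z` is `[u, v] ⊗ H z`, so `f z` is a twisted map with cocycle `k u v (H
z)`. The map `k` must therefore exist on all of `(M □ N).e` first. -/
lemma exists_box_assoc_hom : ∃ F : box (box M N) K ⟶ (box M (box N K)),
    (∀ x y z, F.e (boxO (boxO x y) z) = boxO x (boxO y z)) ∧
    (∀ a y z, F.ee (boxInl (boxInl a y) z) = boxInl a (boxO y z)) ∧
    (∀ x x' b z, F.ee (boxInl (boxInr x x' b) z) = boxInr x x' (boxInl b z)) ∧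
      ∀ x x' y y' c, F.ee (boxInr (boxO x y) (boxO x' y') c) = boxInr x x' (boxInr y y' c) := by
  let h : (box M N).ee →+ K.e →+ (box M (box N K)).ee := boxLift
    (triadd (fun a y z => (boxInl a (boxO y z) : (box M (box N K)).ee)) (by simp [add_boxInl])
      (by simp [add_boxO, boxInl_add, boxInl_P]) (by simp [boxO_add, boxInl_add]))
    (triadd (fun x x' b => AddMonoidHom.mk' (fun z => (boxInr x x' (boxInl b z) : (box M (box N K)).ee))
      (by simp [boxInl_add, boxInr_add])) (by intros; ext; simp [add_boxInr])
      (by intros; ext; simp [boxInr_add_mid]) (by intros; ext; simp [add_boxInl, boxInr_add]))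
    (by intros; ext; simp [P_boxO, boxInl_P])
    (by intros; ext; simp [P_boxInr])
    (by intros; ext; simp [boxInr_P])
    -- The relation holds because `Δ(y ⊗ z) = Δ y ⊗ z̄`.
    (by intros; ext; simp [boxInl_cross, Δ_boxO])
  have hl : ∀ a y z, h (boxInl a y) z = boxInl a (boxO y z) := by simp [h]
  have hr : ∀ x x' b z, h (boxInr x x' b) z = boxInr x x' (boxInl b z) := by simp [h]
  have h_P : ∀ w c, h w (K.P c) = 0 := by
    intro w c
    refine box_ee_hom_ext (f := h.flip (K.P c)) (g := 0) ?_ ?_ w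
    · intro a y; simp [hl, boxO_P, boxInl_P]
    · intro x x' b; simp [hr, boxInl_P, boxInr_zero]
  have hTh : ∀ w z, (box M (box N K)).T (h w z) = h ((box M N).T w) z := by
    intro w z
    refine box_ee_hom_ext (f := (box M (box N K)).T.comp (h.flip z)) (g := (h.flip z).comp (box M N).T) ?_ ?_ w
    · intro a y; simp [hl, T_boxInl]
    · intro x x' b; simp [hr, T_boxInl, T_boxInr]
  let k₀ : (box M N).e →+ M.e →+ N.e →+ K.ee →+ (box M (box N K)).ee := boxEHom
    (biadd (fun x y => triadd (fun x' y' c => (boxInr x x' (boxInr y y' c) : (box M (box N K)).ee))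
      (by simp [boxInr_add_mid]) (by simp [boxInr_add_mid, boxInr_add]) (by simp [boxInr_add]))
      (by intros; ext; simp [add_boxInr]) (by intros; ext; simp [add_boxInr, boxInr_add]))
    (by intros; ext; simp [P_boxInr, boxInr_zero])
  have k₀_o : ∀ x y x' y' c, k₀ (boxO x y) x' y' c = boxInr x x' (boxInr y y' c) := by simp [k₀]
  have k₀_P : ∀ w, k₀ ((box M N).P w) = 0 :=
    boxEHom_P _ _ (by intros; ext; simp [P_boxInr])
  -- The expression factors through the cokernels in both variables, so it extends from the elements
  -- `x ⊗ y` one variable at a time: `k₀` treats the first, and this step the second.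
  let k : (box M N).e →+ (box M N).e →+ K.ee →+ (box M (box N K)).ee := (boxEHom
    (biadd (fun x' y' => AddMonoidHom.mk' (fun u => k₀ u x' y') (by simp))
      (by intros; ext; simp) (by intros; ext; simp))
    (by
      intro x' b
      ext u c
      refine box_e_hom_ext (f := AddMonoidHom.mk' (fun u => k₀ u x' (N.P b) c) (by simp))
        (g := 0) ?_ ?_ u
      · intro x y; simp [k₀_o, boxInr_P, boxInr_zero]
      · intro w; simp [k₀_P])).flip
  have hk_o : ∀ x y x' y' c, k (boxO x y) (boxO x' y') c = boxInr x x' (boxInr y y' c) := by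
    simp [k, k₀_o]
  have k_P : ∀ u w c, k u ((box M N).P w) c = 0 := by
    intro u w c
    simp only [k, AddMonoidHom.flip_apply]
    rw [boxEHom_P]
    · rfl
    · intro a y
      ext u c
      refine box_e_hom_ext (f := AddMonoidHom.mk' (fun u => k₀ u (M.P a) y c) (by simp))
        (g := 0) ?_ ?_ u
      · intro x y; simp [k₀_o, boxInr_P]
      · intro w; simp [k₀_P]
  have P_k : ∀ w u c, k ((box M N).P w) u c = 0 := by
    intro w u c
    refine box_e_hom_ext (f := (k ((box M N).P w)).flip c) (g := 0) ?_ ?_ u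
    · intro x y; simp [k, k₀_P]
    · intro w'; simp [k_P]
  have hTk : ∀ u u' c, (box M (box N K)).T (k u u' c) = k u' u (K.T c) := by
    intro u u' c
    refine biadd_ext (box_e_closure_univ M N) (box_e_closure_univ M N)
      (f := biadd (fun u u' => (box M (box N K)).T (k u u' c)) (by simp) (by simp))
      (g := biadd (fun u u' => k u' u (K.T c)) (by simp) (by simp)) ?_ u u'
    rintro _ (⟨x, _, y, _, rfl⟩ | ⟨w, rfl⟩) _ (⟨x', _, y', _, rfl⟩ | ⟨w', rfl⟩)
    · simp [hk_o, T_boxInr]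
    all_goals simp [k_P, P_k]
  have hPk : ∀ u u' c, (box M (box N K)).P (k u' u (K.T c)) = (box M (box N K)).P (k u u' c) := by
    intro u u' c
    rw [← hTk, P_T]
  have hk : ∀ u u' z, h (crossEffect (box M N).H u u') z = k u' u (K.Δ (K.bar z)) := by
    intro u u' z
    refine biadd_ext (box_e_closure_univ M N) (box_e_closure_univ M N)
      (f := biadd (fun u u' => h (crossEffect (box M N).H u u') z) (by simp [cross_add_left])
        (by simp [cross_add_right]))
      (g := biadd (fun u u' => k u' u (K.Δ (K.bar z))) (by simp) (by simp)) ?_ u u'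
    rintro _ (⟨x, _, y, _, rfl⟩ | ⟨w, rfl⟩) _ (⟨x', _, y', _, rfl⟩ | ⟨w', rfl⟩)
    · simp [hk_o, box_cross, hr, boxInl_cross]
    all_goals simp [k_P, P_k, cross_P_left, cross_P_right]
  have h1 : ∀ z, ∃ f : (box M N).e → (box M (box N K)).e, (∀ x y, f (boxO x y) = boxO x (boxO y z)) ∧
      (∀ w, f ((box M N).P w) = (box M (box N K)).P (h.flip z w)) ∧
      ∀ u v, f (u + v) = f u + f v + (box M (box N K)).P (biadd
        (fun u v => k u v (K.H z)) (by simp) (by simp) u v) := by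
    intro z
    refine box_exists_twisted _ (by simp [P_k]) (by simp [k_P]) _ _ ?_ ?_ ?_ ?_
    · intro x y y'; simp [boxO_add, add_boxO, boxO_P, hk_o]
    · intro x x' y
      simp only [add_boxO, biadd_apply, hk_o, hr, AddMonoidHom.flip_apply, box_H_o, boxInr_add,
        add_comm (boxInr _ _ (boxInl _ _)), map_add, add_assoc]
    · intro x b; simp [boxO_P, P_boxO, hr]
    · intro a y; simp [P_boxO, hl]
  choose f hf hP hadd using h1
  simp only [biadd_apply, AddMonoidHom.flip_apply] at hP hadd
  have hc : ∀ u u' z z', crossEffect (box M (box N K)).H (f z u) (f z' u') = k u' u (crossEffect K.H z z') := by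
    intro u u' z z'
    refine cross_eq_of_generates (box_e_closure_univ M N) (box_e_closure_univ M N)
      (fun u v => ⟨_, hadd z u v⟩) (fun u v => ⟨_, hadd z' u v⟩)
      (fun a => ⟨_, hP z a⟩) (fun a => ⟨_, hP z' a⟩)
      (biadd (fun u u' => k u' u (crossEffect K.H z z')) (by simp) (by simp))
      (by simp [k_P]) (by simp [P_k]) ?_ u u'
    rintro _ ⟨x, _, y, _, rfl⟩ _ ⟨x', _, y', _, rfl⟩
    simp [hf, box_cross, hk_o]
  have f_add : ∀ u z z', f (z + z') u = f z u + f z' u := by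
    intro u z z'
    refine eq_of_add_eq (box_e_closure_univ M N) (fun u v => (box M (box N K)).P (k u v (K.H (z + z'))))
      (f := f (z + z')) (g := fun u => f z u + f z' u) (hadd _) (fun u v => ?_) ?_ u
    -- The interchange commutator is the `(z|z')_H` part of the defect at `z + z'`.
    · rw [hadd, hadd, add_P_add_add_P, add_add_add_swap, hc, H_add, (k _ _).map_add,
        (k _ _).map_add, add_P_add_P, add_comm (k _ _ (crossEffect _ _ _))]
    · rintro _ (⟨x, _, y, _, rfl⟩ | ⟨w, rfl⟩)
      · simp [hf, boxO_add]
      · simp [hP]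
  have f_P : ∀ u c, f (K.P c) u = (box M (box N K)).P (k u u c) := by
    intro u c
    refine eq_of_add_eq (box_e_closure_univ M N) (fun u v => (box M (box N K)).P (k u v (K.H (K.P c))))
      (f := f (K.P c)) (g := fun u => (box M (box N K)).P (k u u c)) (hadd _) (fun u v => ?_) ?_ u
    -- Under `P` the mixed terms become `k u v (c + T c) = k u v (H P c)`, which is the defect of `f
    -- (K.P c)`.
    · have h2 : k (u + v) (u + v) c = k u u c + k v v c + (k u v c + k v u c) := by
        simp only [map_add, AddMonoidHom.add_apply]; abel
      rw [h2, map_add, map_add, map_add (box M (box N K)).P (k _ _ c), ← hPk v u, H_P, map_add, map_add]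
    · rintro _ (⟨x, _, y, _, rfl⟩ | ⟨w, rfl⟩)
      · simp [hf, boxO_P, hk_o]
      · simp [hP, h_P, P_k]
  have hH : ∀ u z, (box M (box N K)).H (f z u) = h ((box M N).H u) z + k u u (K.H z) := by
    intro u z
    refine eq_of_add_eq (box_e_closure_univ M N)
      (fun u v => k v u (crossEffect K.H z z) + (box M (box N K)).H ((box M (box N K)).P (k u v (K.H z))))
      (f := fun u => (box M (box N K)).H (f z u)) (g := fun u => h ((box M N).H u) z + k u u (K.H z))
      (fun u v => ?_) (fun u v => ?_) ?_ u
    · rw [hadd, H_add_P, H_add, hc, add_assoc]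
    -- By `hk` the cross-effect of `H` enters as `k v u (Δ z)`; expanding `Δ z` matches the two
    -- defects.
    · rw [H_P, hTk, H_add, map_add, map_add, AddMonoidHom.add_apply, AddMonoidHom.add_apply, hk,
        Δ_eq]
      simp only [map_add, map_sub, AddMonoidHom.add_apply]
      abel
    · rintro _ (⟨x, _, y, _, rfl⟩ | ⟨w, rfl⟩)
      · simp only [hf, box_H_o, hk_o, hl, hr, map_add, boxInr_add, AddMonoidHom.add_apply]
        abel
      · simp [hP, H_P, hTh, P_k]
  obtain ⟨F, hF, hFl, hFr⟩ := box_exists_hom h k (fun u z => f z u) h_P P_k k_P hk f_add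
    (fun u v z => hadd z u v) f_P (fun w z => hP z w) hTh hTk hH hc
  exact ⟨F, fun x y z => by rw [hF, hf], fun a y z => by rw [hFl, hl],
    fun x x' b z => by rw [hFl, hr], fun x x' y y' c => by rw [hFr, hk_o]⟩

lemma exists_box_assoc : ∃ α : box (box M N) K ≅ box M (box N K),
    (∀ x y z, α.hom.e (boxO (boxO x y) z) = boxO x (boxO y z)) ∧
    (∀ a y z, α.hom.ee (boxInl (boxInl a y) z) = boxInl a (boxO y z)) ∧
    (∀ x x' b z, α.hom.ee (boxInl (boxInr x x' b) z) = boxInr x x' (boxInl b z)) ∧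
      ∀ x x' y y' c,
        α.hom.ee (boxInr (boxO x y) (boxO x' y') c) = boxInr x x' (boxInr y y' c) := by
  obtain ⟨F, hF, hF₁, hF₂, hF₃⟩ := exists_box_assoc_hom M N K
  obtain ⟨G, hG, hG₁, hG₂, hG₃⟩ := exists_box_assoc_inv M N K
  have hM := Generates.univ M
  have hN := Generates.univ N
  have hK := Generates.univ K
  refine ⟨⟨F, G, ((hM.box hN).box hK).hom_ext ?_ ?_, (hM.box (hN.box hK)).hom_ext ?_ ?_⟩,
    hF, hF₁, hF₂, hF₃⟩
  · rintro _ ⟨_, ⟨x, _, y, _, rfl⟩, z, _, rfl⟩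
    rw [comp_e, hF, hG, id_e]
  · rintro _ (⟨_, ⟨a, _, y, _, rfl⟩ | ⟨x, _, x', _, b, _, rfl⟩, z, _, rfl⟩ |
      ⟨_, ⟨x, _, y, _, rfl⟩, _, ⟨x', _, y', _, rfl⟩, c, _, rfl⟩)
    · rw [comp_ee, hF₁, hG₁, id_ee]
    · rw [comp_ee, hF₂, hG₂, id_ee]
    · rw [comp_ee, hF₃, hG₃, id_ee]
  · rintro _ ⟨x, _, _, ⟨y, _, z, _, rfl⟩, rfl⟩
    rw [comp_e, hG, hF, id_e]
  · rintro _ (⟨a, _, _, ⟨y, _, z, _, rfl⟩, rfl⟩ |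
      ⟨x, _, x', _, _, ⟨b, _, z, _, rfl⟩ | ⟨y, _, y', _, c, _, rfl⟩, rfl⟩)
    · rw [comp_ee, hG₁, hF₁, id_ee]
    · rw [comp_ee, hG₂, hF₂, id_ee]
    · rw [comp_ee, hG₃, hF₃, id_ee]

end BoxAssoc

end SquareGroup

namespace SquareGroup

/-! ### The two monoidal structures and the morphism `σ`. -/

section Structures

lemma tensor_hom_ext {M N L : SquareGroup.{u}} {f g : tensor M N ⟶ L}
    (he : ∀ x y, f.e (otimes x y) = g.e (otimes x y))
    (hee : ∀ a b, f.ee (tmul a b) = g.ee (tmul a b)) : f = g := by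
  refine ((Generates.univ M).tensor (Generates.univ N)).hom_ext ?_ ?_
  · rintro _ ⟨x, _, y, _, rfl⟩
    exact he x y
  · rintro _ ⟨a, _, b, _, rfl⟩
    exact hee a b

lemma box_hom_ext {M N L : SquareGroup.{u}} {f g : box M N ⟶ L}
    (he : ∀ x z, f.e (boxO x z) = g.e (boxO x z))
    (hl : ∀ a z, f.ee (boxInl a z) = g.ee (boxInl a z))
    (hr : ∀ x y c, f.ee (boxInr x y c) = g.ee (boxInr x y c)) : f = g := by
  refine ((Generates.univ M).box (Generates.univ N)).hom_ext ?_ ?_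
  · rintro _ ⟨x, _, z, _, rfl⟩
    exact he x z
  · rintro _ (⟨a, _, z, _, rfl⟩ | ⟨x, _, y, _, c, _, rfl⟩)
    exacts [hl a z, hr x y c]

lemma exists_tensor_map {M M' N N' : SquareGroup.{u}} (f : M ⟶ M') (g : N ⟶ N') :
    ∃ F : tensor M N ⟶ tensor M' N', (∀ x y, F.e (otimes x y) = otimes (f.e x) (g.e y)) ∧
      ∀ a b, F.ee (tmul a b) = tmul (f.ee a) (g.ee b) := by
  obtain ⟨F, hF, hF'⟩ := tensor_exists_hom (L := tensor M' N')
    (biadd (fun a b => tmul (f.ee a) (g.ee b)) (by simp [add_tmul]) (by simp [tmul_add]))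
    (fun x y => otimes (f.e x) (g.e y)) (by simp [otimes_add])
    (by simp [add_otimes, Hom.map_cross, Hom.map_H])
    (by simp [otimes_P, Hom.map_cross, Hom.map_P])
    (by simp [P_otimes, Hom.map_Δ, Hom.map_P])
    (by simp [T_tmul, Hom.map_T])
    (by simp [tensor_H_otimes, Hom.map_cross, Hom.map_H, Hom.map_Δ])
    (by simp [tensor_cross, Hom.map_cross])
  exact ⟨F, hF, hF'⟩

lemma exists_box_map {M M' N N' : SquareGroup.{u}} (f : M ⟶ M') (g : N ⟶ N') :
    ∃ F : box M N ⟶ box M' N', (∀ x z, F.e (boxO x z) = boxO (f.e x) (g.e z)) ∧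
      (∀ a z, F.ee (boxInl a z) = boxInl (f.ee a) (g.e z)) ∧
      ∀ x y c, F.ee (boxInr x y c) = boxInr (f.e x) (f.e y) (g.ee c) := by
  obtain ⟨F, hF, hF'⟩ := box_exists_hom (L := box M' N')
    (biadd (fun a z => boxInl (f.ee a) (g.e z)) (by simp [add_boxInl]) (by simp [boxInl_add]))
    (triadd (fun x y c => boxInr (f.e x) (f.e y) (g.ee c)) (by simp [add_boxInr])
      (by simp [boxInr_add_mid]) (by simp [boxInr_add]))
    (fun x z => boxO (f.e x) (g.e z)) (by simp [Hom.map_P, boxInl_P])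
    (by simp [Hom.map_P, P_boxInr]) (by simp [Hom.map_P, boxInr_P])
    (by simp [Hom.map_cross, boxInl_cross, Hom.map_Δ]) (by simp [boxO_add])
    (by simp [add_boxO, Hom.map_H])
    (by simp [boxO_P, Hom.map_P])
    (by simp [P_boxO, Hom.map_P])
    (by simp [T_boxInl, Hom.map_T])
    (by simp [T_boxInr, Hom.map_T])
    (by simp [box_H_o, Hom.map_H])
    (by simp [box_cross, Hom.map_cross])
  exact ⟨F, hF, hF'⟩

/-- All coherence laws are checked on iterated generators, where associators only move brackets. For
a factor `ℤ_nil` the generator `1` avoids the binomial corrections. -/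
lemma exists_isTensorStructure :
    ∃ S : MonoidalOn tensor.{u}, IsTensorStructure S := by
  choose tmap map_e map_ee using @exists_tensor_map.{u}
  choose α α_e α_ee using exists_tensor_assoc.{u}
  choose l l_e l_ee using exists_tensor_lunit.{u}
  choose r r_e r_ee using exists_tensor_runit.{u}
  refine ⟨{
      map := tmap
      assoc := α
      lunit := l
      runit := r
      map_id := ?_
      map_comp := ?_
      assoc_naturality := ?_
      lunit_naturality := ?_
      runit_naturality := ?_
      pentagon := ?_
      triangle := ?_ }, ?_⟩
  · intro M N
    exact tensor_hom_ext (by simp [map_e]) (by simp [map_ee])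
  · intro M M' M'' N N' N'' f f' g g'
    exact tensor_hom_ext (by simp [map_e]) (by simp [map_ee])
  · intro M M' N N' K K' f g h
    refine (((Generates.univ M).tensor (Generates.univ N)).tensor (Generates.univ K)).hom_ext ?_ ?_
    · rintro _ ⟨_, ⟨x, _, y, _, rfl⟩, z, _, rfl⟩
      simp [map_e, α_e]
    · rintro _ ⟨_, ⟨x, _, y, _, rfl⟩, z, _, rfl⟩
      simp [map_ee, α_ee]
  · intro M N f
    refine (Znil.generates.tensor (Generates.univ M)).hom_ext ?_ ?_
    · rintro _ ⟨_, rfl, y, _, rfl⟩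
      simp [map_e, l_e, znilAct_one]
    · rintro _ ⟨_, rfl, y, _, rfl⟩
      simp [map_ee, l_ee]
  · intro M N f
    exact tensor_hom_ext (by simp [map_e, r_e]) (by simp [map_ee, r_ee])
  · intro L M N K
    refine ((((Generates.univ L).tensor (Generates.univ M)).tensor (Generates.univ N)).tensor
      (Generates.univ K)).hom_ext ?_ ?_
    · rintro _ ⟨_, ⟨_, ⟨w, _, x, _, rfl⟩, y, _, rfl⟩, z, _, rfl⟩
      simp [map_e, α_e]
    · rintro _ ⟨_, ⟨_, ⟨w, _, x, _, rfl⟩, y, _, rfl⟩, z, _, rfl⟩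
      simp [map_ee, α_ee]
  · intro M N
    refine (((Generates.univ M).tensor Znil.generates).tensor (Generates.univ N)).hom_ext ?_ ?_
    · rintro _ ⟨_, ⟨x, _, _, rfl, rfl⟩, z, _, rfl⟩
      simp [map_e, α_e, l_e, r_e, znilAct_one]
    · rintro _ ⟨_, ⟨x, _, _, rfl, rfl⟩, z, _, rfl⟩
      simp [map_ee, α_ee, l_ee, r_ee]
  -- The formulas for `a ⊗̄ b` follow from those on the `ee`-level, as `a ⊗̄ b = P(a ⊗ b)`.
  · have hP : ∀ {A B : SquareGroup.{u}} (f : A ⟶ B) (w : A.ee), f.e (A.P w) = B.P (f.ee w) :=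
      fun f w => f.map_P w
    constructor
    · exact map_e
    · intro M M' N N' f g a b
      simp only [← tensor_P, hP, map_ee]
    · exact map_ee
    · exact α_e _ _ _
    · intro M N K a b z
      simp only [← tensor_P, P_otimes, hP, α_ee]
    · intro M N K a b z
      simp only [← tensor_P, hP, α_ee]
    · exact α_ee _ _ _
    · intro M n y
      exact l_e M _ y
    · intro M n b
      simp only [← tensor_P, hP, l_ee, map_zsmul, Znil.toEE_ofEE]
    · intro M n b
      exact l_ee M _ b
    · intro M x n
      exact r_e M x _
    · intro M a n
      simp only [← tensor_P, hP, r_ee, map_zsmul, Znil.toEE_ofEE]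
    · intro M a n
      exact r_ee M a _

lemma exists_isBoxStructure :
    ∃ Q : MonoidalOn box.{u}, IsBoxStructure Q := by
  choose bmap map_e map_l map_r using @exists_box_map.{u}
  choose α α_e α_ll α_rl α_r using exists_box_assoc.{u}
  choose l l_e l_l l_r using exists_box_lunit.{u}
  choose r r_e r_l r_r using exists_box_runit.{u}
  refine ⟨{
      map := bmap
      assoc := α
      lunit := l
      runit := r
      map_id := ?_
      map_comp := ?_
      assoc_naturality := ?_
      lunit_naturality := ?_
      runit_naturality := ?_
      pentagon := ?_
      triangle := ?_ }, ?_⟩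
  · intro M N
    exact box_hom_ext (by simp [map_e]) (by simp [map_l]) (by simp [map_r])
  · intro M M' M'' N N' N'' f f' g g'
    exact box_hom_ext (by simp [map_e]) (by simp [map_l]) (by simp [map_r])
  · intro M M' N N' K K' f g h
    refine (((Generates.univ M).box (Generates.univ N)).box (Generates.univ K)).hom_ext ?_ ?_
    · rintro _ ⟨_, ⟨x, _, y, _, rfl⟩, z, _, rfl⟩
      simp [map_e, α_e]
    · rintro _ (⟨_, ⟨a, _, y, _, rfl⟩ | ⟨x, _, x', _, b, _, rfl⟩, z, _, rfl⟩ |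
        ⟨_, ⟨x, _, y, _, rfl⟩, _, ⟨x', _, y', _, rfl⟩, c, _, rfl⟩) <;>
      simp [map_e, map_l, map_r, α_ll, α_rl, α_r]
  · intro M N f
    refine (Znil.generates.box (Generates.univ M)).hom_ext ?_ ?_
    · rintro _ ⟨_, rfl, y, _, rfl⟩
      simp [map_e, l_e, znilAct_one]
    · rintro _ (⟨_, rfl, y, _, rfl⟩ | ⟨_, rfl, _, rfl, b, _, rfl⟩) <;>
      simp [map_l, map_r, l_l, l_r, Hom.map_Δ]
  · intro M N f
    exact box_hom_ext (by simp [map_e, r_e]) (by simp [map_l, r_l])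
      (by simp [map_r, r_r, Hom.map_cross])
  · intro L M N K
    refine ((((Generates.univ L).box (Generates.univ M)).box (Generates.univ N)).box
      (Generates.univ K)).hom_ext ?_ ?_
    · rintro _ ⟨_, ⟨_, ⟨w, _, x, _, rfl⟩, y, _, rfl⟩, z, _, rfl⟩
      simp [map_e, α_e]
    · rintro _ (⟨_, ⟨_, ⟨a, _, x, _, rfl⟩ | ⟨w, _, w', _, b, _, rfl⟩, y, _, rfl⟩ |
          ⟨_, ⟨w, _, x, _, rfl⟩, _, ⟨w', _, x', _, rfl⟩, b, _, rfl⟩, z, _, rfl⟩ |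
        ⟨_, ⟨_, ⟨w, _, x, _, rfl⟩, y, _, rfl⟩, _, ⟨_, ⟨w', _, x', _, rfl⟩, y', _, rfl⟩, c, _,
          rfl⟩) <;>
      simp [map_l, map_r, α_e, α_ll, α_rl, α_r]
  · intro M N
    refine (((Generates.univ M).box Znil.generates).box (Generates.univ N)).hom_ext ?_ ?_
    · rintro _ ⟨_, ⟨x, _, _, rfl, rfl⟩, z, _, rfl⟩
      simp [map_e, α_e, l_e, r_e, znilAct_one]
    -- For `(x̄ ⊗ x̄' ⊗ 1) ⊗ z̄` the two sides are `x̄ ⊗ x̄' ⊗ Δ z̄` and `(x'|x)_H ⊗ z̄`, equal by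
    -- the defining relation.
    · rintro _ (⟨_, ⟨a, _, _, rfl, rfl⟩ | ⟨x, _, x', _, _, rfl, rfl⟩, z, _, rfl⟩ |
        ⟨_, ⟨x, _, _, rfl, rfl⟩, _, ⟨x', _, _, rfl, rfl⟩, c, _, rfl⟩) <;>
      simp [map_l, map_r, α_ll, α_rl, α_r, l_e, l_l, l_r, r_e, r_l, r_r, znilAct_one,
        boxInl_cross]
  · have hP : ∀ {A B : SquareGroup.{u}} (f : A ⟶ B) (w : A.ee), f.e (A.P w) = B.P (f.ee w) :=
      fun f w => f.map_P w
    constructor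
    · exact map_e
    · intro M M' N N' f g x y c
      simp only [← box_P_inr, hP, map_r]
    · exact map_l
    · exact map_r
    · exact α_e _ _ _
    · intro M N K x x' b z
      simp only [← box_P_inr, P_boxO, hP, α_rl]
    · intro M N K x x' y y' c
      simp only [← box_P_inr, hP, α_r]
    · exact α_ll _ _ _
    · exact α_rl _ _ _
    · exact α_r _ _ _
    · intro M n y
      exact l_e M _ y
    · intro M m n c
      simp only [← box_P_inr, hP, l_r, map_zsmul, Znil.toE_ofE]
    · intro M n y
      exact l_l M _ y
    · intro M m n c
      exact l_r M _ _ c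
    · intro M x n
      exact r_e M x _
    · intro M x y n
      simp only [← box_P_inr, hP, r_r, map_zsmul, Znil.toEE_ofEE]
    · intro M a n
      exact r_l M a _
    · intro M x y n
      exact r_r M x y _

/-- The coherence laws are propositions and an isomorphism is determined by its forward map, so only
four families of morphisms are compared, on generators. -/
lemma IsTensorStructure.unique {S S' : MonoidalOn tensor.{u}} (h : IsTensorStructure S)
    (h' : IsTensorStructure S') : S = S' := by
  refine MonoidalOn.ext ?_ ?_ ?_ ?_
  · funext M M' N N' f g
    exact tensor_hom_ext (by simp [h.map_e, h'.map_e]) (by simp [h.map_ee, h'.map_ee])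
  · funext M N K
    refine Iso.ext (((((Generates.univ M).tensor (Generates.univ N)).tensor
      (Generates.univ K))).hom_ext ?_ ?_)
    · rintro _ ⟨_, ⟨x, _, y, _, rfl⟩, z, _, rfl⟩
      rw [h.assoc_e, h'.assoc_e]
    · rintro _ ⟨_, ⟨x, _, y, _, rfl⟩, z, _, rfl⟩
      rw [h.assoc_ee, h'.assoc_ee]
  · funext M
    refine Iso.ext ((Znil.generates.tensor (Generates.univ M)).hom_ext ?_ ?_)
    · rintro _ ⟨_, rfl, y, _, rfl⟩
      rw [h.lunit_e, h'.lunit_e]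
    · rintro _ ⟨_, rfl, y, _, rfl⟩
      rw [h.lunit_ee, h'.lunit_ee]
  · funext M
    refine Iso.ext (((Generates.univ M).tensor Znil.generates).hom_ext ?_ ?_)
    · rintro _ ⟨x, _, _, rfl, rfl⟩
      rw [h.runit_e, h'.runit_e]
    · rintro _ ⟨x, _, _, rfl, rfl⟩
      rw [h.runit_ee, h'.runit_ee]

lemma IsBoxStructure.unique {Q Q' : MonoidalOn box.{u}} (h : IsBoxStructure Q)
    (h' : IsBoxStructure Q') : Q = Q' := by
  refine MonoidalOn.ext ?_ ?_ ?_ ?_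
  · funext M M' N N' f g
    exact box_hom_ext (by simp [h.map_e, h'.map_e]) (by simp [h.map_ee_inl, h'.map_ee_inl])
      (by simp [h.map_ee_inr, h'.map_ee_inr])
  · funext M N K
    refine Iso.ext ((((Generates.univ M).box (Generates.univ N)).box
      (Generates.univ K)).hom_ext ?_ ?_)
    · rintro _ ⟨_, ⟨x, _, y, _, rfl⟩, z, _, rfl⟩
      rw [h.assoc_e, h'.assoc_e]
    · rintro _ (⟨_, ⟨a, _, y, _, rfl⟩ | ⟨x, _, x', _, b, _, rfl⟩, z, _, rfl⟩ |
        ⟨_, ⟨x, _, y, _, rfl⟩, _, ⟨x', _, y', _, rfl⟩, c, _, rfl⟩)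
      · rw [h.assoc_ee_inl_inl, h'.assoc_ee_inl_inl]
      · rw [h.assoc_ee_inr_inl, h'.assoc_ee_inr_inl]
      · rw [h.assoc_ee_inr, h'.assoc_ee_inr]
  · funext M
    refine Iso.ext ((Znil.generates.box (Generates.univ M)).hom_ext ?_ ?_)
    · rintro _ ⟨_, rfl, y, _, rfl⟩
      rw [h.lunit_e, h'.lunit_e]
    · rintro _ (⟨_, rfl, y, _, rfl⟩ | ⟨_, rfl, _, rfl, b, _, rfl⟩)
      · rw [h.lunit_ee_inl, h'.lunit_ee_inl]
      · rw [h.lunit_ee_inr, h'.lunit_ee_inr]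
  · funext M
    refine Iso.ext (((Generates.univ M).box Znil.generates).hom_ext ?_ ?_)
    · rintro _ ⟨x, _, _, rfl, rfl⟩
      rw [h.runit_e, h'.runit_e]
    · rintro _ (⟨a, _, _, rfl, rfl⟩ | ⟨x, _, y, _, _, rfl, rfl⟩)
      · rw [h.runit_ee_inl, h'.runit_ee_inl]
      · rw [h.runit_ee_inr, h'.runit_ee_inr]

/-- The relation `(x|y)_H ⊗ z̄ = ȳ ⊗ x̄ ⊗ Δ z̄` is sent to a literal equality, and compatibility
with `T` on `a ⊗ z̄` is `T Δ = -Δ`. -/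
lemma exists_isSigma (M N : SquareGroup.{u}) : ∃ σ : box M N ⟶ tensor M N, IsSigma σ := by
  obtain ⟨F, hF, hl, hr⟩ := box_exists_hom (L := tensor M N)
    (biadd (fun a z => tmul a (N.Δ (N.bar z))) (by simp [add_tmul]) (by simp [tmul_add]))
    (triadd (fun x y c => tmul (crossEffect M.H y x) c) (by simp [cross_add_right, add_tmul])
      (by simp [cross_add_left, add_tmul]) (by simp [tmul_add]))
    otimes (by simp [Δ_P, tmul_zero]) (by simp [cross_P_right, zero_tmul])
    (by simp [cross_P_left, zero_tmul])
    (by simp) otimes_add (by simp [add_otimes])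
    (by simp [otimes_P]) (by simp [P_otimes])
    (by simp [T_tmul, T_Δ, tmul_neg])
    (by simp [T_tmul, T_cross, neg_tmul])
    (by simp [tensor_H_otimes, add_comm])
    (by simp [tensor_cross])
  refine ⟨F, hF, fun x y c => ?_, hl, hr⟩
  rw [← box_P_inr, F.map_P, hr, ← tensor_P]
  rfl

lemma IsSigma.unique {M N : SquareGroup.{u}} {σ τ : box M N ⟶ tensor M N} (h : IsSigma σ)
    (h' : IsSigma τ) : σ = τ :=
  box_hom_ext (fun x z => by rw [h.e_o, h'.e_o]) (fun a z => by rw [h.ee_inl, h'.ee_inl])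
    (fun x y c => by rw [h.ee_inr, h'.ee_inr])

/-! ### Coherence of `σ` with both monoidal structures. -/

section Lax

variable {S : MonoidalOn tensor.{u}} {Q : MonoidalOn box.{u}} (hS : IsTensorStructure S)
  (hQ : IsBoxStructure Q)

include hS hQ

lemma IsSigma.naturality {M M' N N' : SquareGroup.{u}} {σ : box M N ⟶ tensor M N}
    {σ' : box M' N' ⟶ tensor M' N'} (hσ : IsSigma σ) (hσ' : IsSigma σ') (f : M ⟶ M')
    (g : N ⟶ N') : Q.map f g ≫ σ' = σ ≫ S.map f g := by
  refine box_hom_ext ?_ ?_ ?_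
  · simp [hQ.map_e, hS.map_e, hσ.e_o, hσ'.e_o]
  · simp [hQ.map_ee_inl, hS.map_ee, hσ.ee_inl, hσ'.ee_inl, Hom.map_Δ]
  · simp [hQ.map_ee_inr, hS.map_ee, hσ.ee_inr, hσ'.ee_inr, Hom.map_cross]

lemma IsSigma.associativity {σ : ∀ M N : SquareGroup.{u}, box M N ⟶ tensor M N}
    (hσ : ∀ M N, IsSigma (σ M N)) (M N K : SquareGroup.{u}) :
    Q.map (σ M N) (𝟙 K) ≫ σ (tensor M N) K ≫ (S.assoc M N K).hom =
      (Q.assoc M N K).hom ≫ Q.map (𝟙 M) (σ N K) ≫ σ M (tensor N K) := by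
  refine (((Generates.univ M).box (Generates.univ N)).box (Generates.univ K)).hom_ext ?_ ?_
  · rintro _ ⟨_, ⟨x, _, y, _, rfl⟩, z, _, rfl⟩
    simp [hQ.map_e, hQ.assoc_e, hS.assoc_e, (hσ _ _).e_o]
  · rintro _ (⟨_, ⟨a, _, y, _, rfl⟩ | ⟨x, _, x', _, b, _, rfl⟩, z, _, rfl⟩ |
      ⟨_, ⟨x, _, y, _, rfl⟩, _, ⟨x', _, y', _, rfl⟩, c, _, rfl⟩)
    -- One path yields `Δ y ⊗ Δ z` and the other `Δ(y ⊛ z)`, so `Δ_otimes` is essential here.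
    · simp [hQ.map_ee_inl, hQ.assoc_ee_inl_inl, hS.assoc_ee, (hσ _ _).ee_inl, (hσ _ _).e_o,
        Δ_otimes]
    · simp [hQ.map_ee_inl, hQ.map_ee_inr, hQ.assoc_ee_inr_inl, hS.assoc_ee, (hσ _ _).ee_inl,
        (hσ _ _).ee_inr]
    · simp [hQ.map_ee_inr, hQ.assoc_ee_inr, hS.assoc_ee, (hσ _ _).ee_inr, (hσ _ _).e_o,
        tensor_cross]

/-- The factor `Q.map (𝟙 Znil) (𝟙 M)` is the whiskered unit morphism of the lax structure, here an
identity. -/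
lemma IsSigma.left_unitality {M : SquareGroup.{u}} {σ : box Znil M ⟶ tensor Znil M}
    (hσ : IsSigma σ) :
    (Q.lunit M).hom = Q.map (𝟙 Znil) (𝟙 M) ≫ σ ≫ (S.lunit M).hom := by
  rw [Q.map_id, Category.id_comp]
  refine (Znil.generates.box (Generates.univ M)).hom_ext ?_ ?_
  · rintro _ ⟨_, rfl, y, _, rfl⟩
    simp [hQ.lunit_e, hS.lunit_e, hσ.e_o]
  · rintro _ (⟨_, rfl, y, _, rfl⟩ | ⟨_, rfl, _, rfl, b, _, rfl⟩)
    · simp [hQ.lunit_ee_inl, hS.lunit_ee, hσ.ee_inl]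
    · simp [hQ.lunit_ee_inr, hS.lunit_ee, hσ.ee_inr, Znil.cross_one]

lemma IsSigma.right_unitality {M : SquareGroup.{u}} {σ : box M Znil ⟶ tensor M Znil}
    (hσ : IsSigma σ) :
    (Q.runit M).hom = Q.map (𝟙 M) (𝟙 Znil) ≫ σ ≫ (S.runit M).hom := by
  rw [Q.map_id, Category.id_comp]
  refine ((Generates.univ M).box Znil.generates).hom_ext ?_ ?_
  · rintro _ ⟨x, _, _, rfl, rfl⟩
    simp [hQ.runit_e, hS.runit_e, hσ.e_o]
  · rintro _ (⟨a, _, _, rfl, rfl⟩ | ⟨x, _, y, _, _, rfl, rfl⟩)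
    · simp [hQ.runit_ee_inl, hS.runit_ee, hσ.ee_inl, Znil.Δ_ofE]
    · simp [hQ.runit_ee_inr, hS.runit_ee, hσ.ee_inr]

end Lax

end Structures

end SquareGroup

theorem mainTheorem10 :
    (∀ M N : SquareGroup.{u}, ∃! σ : SquareGroup.box M N ⟶ SquareGroup.tensor M N,
      SquareGroup.IsSigma σ) ∧
    (∃! S : SquareGroup.MonoidalOn SquareGroup.tensor.{u}, SquareGroup.IsTensorStructure S) ∧
    (∃! Q : SquareGroup.MonoidalOn SquareGroup.box.{u}, SquareGroup.IsBoxStructure Q) ∧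
    ∀ (S : SquareGroup.MonoidalOn SquareGroup.tensor.{u})
      (Q : SquareGroup.MonoidalOn SquareGroup.box.{u}),
      SquareGroup.IsTensorStructure S → SquareGroup.IsBoxStructure Q →
      ∃ L : (SquareGroup.MonoidalOn.idFunctor S Q).LaxMonoidal,
        L.ε = 𝟙 SquareGroup.Znil.{u} ∧
        ∀ M N : SquareGroup.{u}, SquareGroup.IsSigma (M := M) (N := N) (L.μ M N) := by
  choose σ hσ using SquareGroup.exists_isSigma.{u}
  refine ⟨fun M N => ⟨σ M N, hσ M N, fun τ hτ => hτ.unique (hσ M N)⟩, ?_, ?_, ?_⟩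
  · obtain ⟨S, hS⟩ := SquareGroup.exists_isTensorStructure.{u}
    exact ⟨S, hS, fun S' hS' => hS'.unique hS⟩
  · obtain ⟨Q, hQ⟩ := SquareGroup.exists_isBoxStructure.{u}
    exact ⟨Q, hQ, fun Q' hQ' => hQ'.unique hQ⟩
  · intro S Q hS hQ
    -- Naturality in each variable separately is joint naturality with an identity in the other
    -- variable.
    exact ⟨{ ε := 𝟙 SquareGroup.Znil.{u}
             μ := σ
             μ_natural_left := fun f X =>
              (hσ _ _).naturality hS hQ (hσ _ _) f (𝟙 (show SquareGroup.{u} from X))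
             μ_natural_right := fun X f =>
              (hσ _ _).naturality hS hQ (hσ _ _) (𝟙 (show SquareGroup.{u} from X)) f
             associativity := fun M N K => SquareGroup.IsSigma.associativity hS hQ hσ M N K
             left_unitality := fun M => (hσ SquareGroup.Znil M).left_unitality hS hQ
             right_unitality := fun M => (hσ M SquareGroup.Znil).right_unitality hS hQ },
      rfl, hσ⟩
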